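/- Let $B>0$, $R>0$, and let $D_R\subset\mathbb R^2$ be an open disk of radius $R$. Let $H_B$ be the magnetic Dirichlet Laplacian on $D_R$ with constant field $B$: the self-adjoint operator in $L^2(D_R;\mathbb C)$ given by the Friedrichs extension of the quadratic form $$a[u]=\int_{D_R}|(-i\nabla+A)u|^2\,dx,\quad u\in C_0^\infty(D_R),\qquad A(x_1,x_2)=\frac B2\begin{pmatrix}-x_2\\x_1\end{pmatrix}.$$ It has compact resolvent; let $\lambda_1(D_R,B)\le\lambda_2(D_R,B)\le\dots$ be its eigenvalues, sorted and repeated according to multiplicity. For $b>0$ and $z>0$ let $M(a,b,z)=\sum_{k=0}^\infty\frac{(a)_k}{(b)_k\,k!}z^k$ be Kummer's function, where $(c)_0=1$ and $(c)_k=c(c+1)\cdots(c+k-1)$, and let $a_1(b,z)>a_2(b,z)>\dots$ be the real roots of $a\mapsto M(a,b,z)$ in decreasing order. For $m\in\mathbb N=\{1,2,\dots\}$ and $l\in\mathbb Z$ put $$\lambda_{m,l}(B)=\Bigl(l+|l|+1-2a_m\bigl(|l|+1,\tfrac{BR^2}{2}\bigr)\Bigr)B.$$ Then for every $n\in\mathbb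 N$: if $B\ge \dfrac{2n}{R^2}$, then $$\lambda_n(D_R,B)=\lambda_{1,-(n-1)}(B).$$ -/

import Mathlib

open MeasureTheory
open scoped ContDiff

/-- The Euclidean plane `ℝ²`. -/
abbrev Plane : Type := EuclideanSpace ℝ (Fin 2)

/-- The Hilbert space `L²(Ω; ℂ)`. -/
abbrev L2Scalar (Ω : Set Plane) : Type := Lp ℂ 2 (volume.restrict Ω)

/-- The Hilbert space `L²(Ω; ℂ²)`. -/
abbrev L2Vector (Ω : Set Plane) : Type :=
  Lp (EuclideanSpace ℂ (Fin 2)) 2 (volume.restrict Ω)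

/-- `φ ∈ C₀^∞(Ω)`: complex-valued, smooth, with compact support contained in `Ω`. -/
def IsTestFunction (Ω : Set Plane) (φ : Plane → ℂ) : Prop :=
  ContDiff ℝ ∞ φ ∧ HasCompactSupport φ ∧ tsupport φ ⊆ Ω

/-- The standard linear gauge `A(x) = (B/2) (-x₂, x₁)`. -/
noncomputable def vectorPotential (B : ℝ) (x : Plane) : Plane :=
  !₂[-(B / 2) * x 1, (B / 2) * x 0]

/-- The magnetic gradient `(-i∇ + A) φ` of a differentiable function. -/
noncomputable def magneticGradient (B : ℝ) (φ : Plane → ℂ) (x : Plane) :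
    EuclideanSpace ℂ (Fin 2) :=
  WithLp.toLp 2 fun j : Fin 2 =>
    -Complex.I * fderiv ℝ φ x (EuclideanSpace.single j 1) + (vectorPotential B x j : ℂ) * φ x

/-- The graph `{(φ, (-i∇ + A) φ) : φ ∈ C₀^∞(Ω)}` in `L²(Ω; ℂ) × L²(Ω; ℂ²)`. -/
def testGraph (Ω : Set Plane) (B : ℝ) : Submodule ℂ (L2Scalar Ω × L2Vector Ω) where
  carrier := {p | ∃ φ : Plane → ℂ, IsTestFunction Ω φ ∧
    p.1 =ᵐ[volume.restrict Ω] φ ∧ p.2 =ᵐ[volume.restrict Ω] magneticGradient B φ}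
  zero_mem' := by
    refine ⟨fun _ => 0, ⟨contDiff_const, HasCompactSupport.zero, ?_⟩, ?_, ?_⟩
    · simp [tsupport, Function.support]
    · exact Lp.coeFn_zero _ _ _
    · have h : magneticGradient B (fun _ => (0 : ℂ)) = 0 := by
        funext x
        ext j
        simp [magneticGradient]
      rw [h]
      exact Lp.coeFn_zero _ _ _
  add_mem' := by
    rintro p q ⟨φ, ⟨hφ, hφc, hφs⟩, hp1, hp2⟩ ⟨ψ, ⟨hψ, hψc, hψs⟩, hq1, hq2⟩
    refine ⟨φ + ψ, ⟨hφ.add hψ, hφc.add hψc, ?_⟩, ?_, ?_⟩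
    · exact (tsupport_add φ ψ).trans (Set.union_subset hφs hψs)
    · exact (Lp.coeFn_add _ _).trans (hp1.add hq1)
    · have h : magneticGradient B (φ + ψ) = magneticGradient B φ + magneticGradient B ψ := by
        funext x
        ext j
        have h1 := (hφ.differentiable (by simp)) x
        have h2 := (hψ.differentiable (by simp)) x
        simp [magneticGradient, fderiv_add h1 h2]
        ring
      rw [h]
      exact (Lp.coeFn_add _ _).trans (hp2.add hq2)
  smul_mem' := by
    rintro c p ⟨φ, ⟨hφ, hφc, hφs⟩, hp1, hp2⟩
    refine ⟨c • φ, ⟨contDiff_const.smul hφ, hφc.smul_left (f := fun _ => c), ?_⟩, ?_, ?_⟩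
    · exact (tsupport_smul_subset_right (fun _ => c) φ).trans hφs
    · exact (Lp.coeFn_smul _ _).trans (hp1.const_smul c)
    · have h : magneticGradient B (c • φ) = c • magneticGradient B φ := by
        funext x
        ext j
        have h1 := (hφ.differentiable (by simp)) x
        simp [magneticGradient, fderiv_const_smul h1 c]
        ring
      rw [h]
      exact (Lp.coeFn_smul _ _).trans (hp2.const_smul c)

/-- The closure of the quadratic form `a[u] = ∫_Ω |(-i∇ + A) u|²` on `C₀^∞(Ω)`: the pairs `(u, G)`
such that `u` lies in the domain of the closed form and `G = (-i∇ + A) u`. That is, some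
sequence `φₖ ∈ C₀^∞(Ω)` has `φₖ → u` and `(-i∇ + A) φₖ → G` in `L²(Ω)`. -/
noncomputable def formGraph (Ω : Set Plane) (B : ℝ) :
    Submodule ℂ (L2Scalar Ω × L2Vector Ω) :=
  (testGraph Ω B).topologicalClosure

/-- The graph of the magnetic Dirichlet Laplacian `H_B^Ω`, the self-adjoint operator of the closed
form (Friedrichs extension): `(u, f)` belongs to it, i.e. `H_B^Ω u = f`, when `u` is in the form
domain and `∫_Ω (-i∇ + A) u · conj ((-i∇ + A) φ) = ∫_Ω f conj φ` for all `φ ∈ C₀^∞(Ω)`.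
(Mathlib's inner product is conjugate-linear in its first argument.) -/
noncomputable def magneticLaplacianGraph (Ω : Set Plane) (B : ℝ) :
    Submodule ℂ (L2Scalar Ω × L2Scalar Ω) where
  carrier := {p | ∃ G : L2Vector Ω, (p.1, G) ∈ formGraph Ω B ∧
    ∀ q ∈ testGraph Ω B, inner ℂ q.2 G = inner ℂ q.1 p.2}
  zero_mem' := ⟨0, (formGraph Ω B).zero_mem, by simp⟩
  add_mem' := by
    rintro p p' ⟨G, hG, h⟩ ⟨G', hG', h'⟩
    refine ⟨G + G', (formGraph Ω B).add_mem hG hG', fun q hq => ?_⟩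
    rw [Prod.snd_add, inner_add_right, inner_add_right, h q hq, h' q hq]
  smul_mem' := by
    rintro c p ⟨G, hG, h⟩
    refine ⟨c • G, (formGraph Ω B).smul_mem c hG, fun q hq => ?_⟩
    rw [Prod.smul_snd, inner_smul_right, inner_smul_right, h q hq]

/-- The eigenspace `{u : H_B^Ω u = μ u}`. -/
noncomputable def magneticEigenspace (Ω : Set Plane) (B μ : ℝ) : Submodule ℂ (L2Scalar Ω) :=
  (magneticLaplacianGraph Ω B).comap (LinearMap.prod LinearMap.id ((μ : ℂ) • LinearMap.id))

/-- The number of eigenvalues of `H_B^Ω` that are at most `t`, counting multiplicities. Eigenspaces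
of different eigenvalues are independent, so the multiplicities add up to the dimension of the
sum of the eigenspaces. -/
noncomputable def eigenvalueCount (Ω : Set Plane) (B t : ℝ) : Cardinal :=
  Module.rank ℂ ↥(⨆ μ ∈ Set.Iic t, magneticEigenspace Ω B μ)

/-- `t` is the `n`-th eigenvalue (`n ≥ 1`) of `H_B^Ω` in the list `λ₁ ≤ λ₂ ≤ …` in which each
eigenvalue is repeated according to its multiplicity: the least `t` such that at least `n` of the
eigenvalues are at most `t`. -/
def IsSortedEigenvalue (Ω : Set Plane) (B : ℝ) (n : ℕ) (t : ℝ) : Prop :=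
  IsLeast {s : ℝ | (n : Cardinal) ≤ eigenvalueCount Ω B s} t

/-- The `n`-th sorted eigenvalue `λ_n(Ω, B)`, `n ≥ 1`. -/
noncomputable def sortedEigenvalue (Ω : Set Plane) (B : ℝ) (n : ℕ) : ℝ :=
  sInf {t : ℝ | IsSortedEigenvalue Ω B n t}

/-- Kummer's confluent hypergeometric function `M(a, b, z) = ∑ₖ (a)ₖ / ((b)ₖ k!) zᵏ`. -/
noncomputable def kummerM (a b z : ℝ) : ℝ :=
  ∑' k : ℕ, (ascPochhammer ℝ k).eval a / ((ascPochhammer ℝ k).eval b * (k.factorial : ℝ)) * z ^ k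

/-- `a` is the `m`-th root (`m ≥ 1`), in decreasing order, of `a ↦ M(a, b, z)`. -/
def IsKummerRoot (m : ℕ) (b z a : ℝ) : Prop :=
  kummerM a b z = 0 ∧ {a' : ℝ | a ≤ a' ∧ kummerM a' b z = 0}.encard = m

/-- The `m`-th root `a_m(b, z)` (`m ≥ 1`), in decreasing order, of `a ↦ M(a, b, z)`. -/
noncomputable def kummerRoot (m : ℕ) (b z : ℝ) : ℝ :=
  sSup {a : ℝ | IsKummerRoot m b z a}

/-- The eigenvalue branch `λ_{m,l}(B) = (l + |l| + 1 - 2 a_m(|l| + 1, B R² / 2)) B` of the disk of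
radius `R`. -/
noncomputable def eigenvalueBranch (R : ℝ) (m : ℕ) (l : ℤ) (B : ℝ) : ℝ :=
  ((l : ℝ) + |(l : ℝ)| + 1 - 2 * kummerRoot m (|(l : ℝ)| + 1) (B * R ^ 2 / 2)) * B

/-! Put z = BR²/2. Since M(-1, n, z) = 1 - z/n, the hypothesis on B says precisely that M(-1, n, z)
≤ 0, while M(a, n, z) ≥ 1 for a ≥ 0. Hence the largest root a of M(·, n, z) lies in [-1, 0), and Λ =
(1 - 2a)B satisfies B < Λ ≤ 3B, where 3B is the second Landau level. It remains to see that the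
eigenvalue count is at least n at Λ and less than n below Λ.

At least n (`le_eigenvalueCount`): for a in [-1, 0] the function M(a, b, z) increases with b, so
M(a, l+1, z) ≤ M(a, n, z) = 0 for l = 0, …, n-1. Each M(·, l+1, z) therefore has a root α in [a, 0),
and the function of angular momentum -l with profile rˡ exp(-Br²/4) M(α, l+1, Br²/2) is a Dirichlet
eigenfunction with eigenvalue (1 - 2α)B ≤ Λ. These n functions are linearly independent.

Fewer than n (`eigenvalueCount_lt`): on the form domain, Λ‖u‖² is at most a[u] plus a weighted sum
of the squared inner products of u with the n-1 lowest Landau level functions of angular momenta 0,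
…, -(n-2) (`form_inequality`). A vector in the span of the eigenspaces up to some s < Λ that is
orthogonal to these functions must vanish, so the span has dimension at most n-1.

The form inequality is proved mode by mode after recentring the gauge and expanding in e^{-ilθ}
(`mode_inequality`). For l < 0 every energy is at least 3B; for 0 ≤ l < n-1 it is at least 3B after
removal of the lowest Landau level (`radial_gap`); for l ≥ n-1 the Kummer function with parameter n
is a positive supersolution at level Λ (`radial_inequality_of_kummer`). -/

/-! ### Power series with factorially decaying coefficients. -/

/-- Coefficients of an exponential-type power series: `|cₖ| ≤ C / k!`. -/
def FactorialDecay (c : ℕ → ℝ) : Prop := ∃ C : ℝ, ∀ k, |c k| ≤ C / (k.factorial : ℝ)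

/-- The sum of the power series with coefficients `c`. -/
noncomputable def powerSum (c : ℕ → ℝ) (t : ℝ) : ℝ := ∑' k, c k * t ^ k

/-- The coefficients of the derivative of a power series. -/
def derivCoeff (c : ℕ → ℝ) (k : ℕ) : ℝ := (k + 1) * c (k + 1)

theorem FactorialDecay.derivCoeff {c : ℕ → ℝ} (hc : FactorialDecay c) :
    FactorialDecay (derivCoeff c) := by
  obtain ⟨C, hC⟩ := hc
  refine ⟨C, fun k => ?_⟩
  have h := hC (k + 1)
  have hk : (0 : ℝ) < k + 1 := by positivity
  have hf : (0 : ℝ) < k.factorial := by positivity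
  rw [Nat.factorial_succ, Nat.cast_mul, le_div_iff₀ (by positivity)] at h
  rw [_root_.derivCoeff, abs_mul, abs_of_pos hk, le_div_iff₀ hf]
  push_cast at h
  linarith

theorem FactorialDecay.summable {c : ℕ → ℝ} (hc : FactorialDecay c) (t : ℝ) :
    Summable fun k => c k * t ^ k := by
  obtain ⟨C, hC⟩ := hc
  refine Summable.of_norm_bounded (g := fun k => C * (|t| ^ k / (k.factorial : ℝ)))
    ((Real.summable_pow_div_factorial |t|).mul_left C) fun k => ?_
  rw [norm_mul, norm_pow, Real.norm_eq_abs, Real.norm_eq_abs]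
  calc |c k| * |t| ^ k ≤ C / (k.factorial : ℝ) * |t| ^ k := by gcongr; exact hC k
    _ = _ := by ring

theorem hasDerivAt_powerSum {c : ℕ → ℝ} (hc : FactorialDecay c) (t : ℝ) :
    HasDerivAt (powerSum c) (powerSum (derivCoeff c) t) t := by
  have hd := hc.derivCoeff
  obtain ⟨C, hC⟩ := hd
  -- Any radius beyond |t| would do; termwise differentiation needs a summable bound that is uniform
  -- on a ball containing t.
  set ρ : ℝ := |t| + 1
  have hρ : 0 ≤ ρ := by positivity
  have hu : Summable fun k : ℕ => |c k| * (k * ρ ^ (k - 1)) := by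
    rw [← summable_nat_add_iff 1]
    refine Summable.of_nonneg_of_le (fun k => by positivity) (fun k => ?_)
      ((Real.summable_pow_div_factorial ρ).mul_left C)
    have h := hC k
    rw [derivCoeff, abs_mul, abs_of_nonneg (by positivity)] at h
    calc |c (k + 1)| * (((k + 1 : ℕ) : ℝ) * ρ ^ (k + 1 - 1))
        = ((k + 1 : ℝ) * |c (k + 1)|) * ρ ^ k := by
          rw [Nat.add_sub_cancel]; push_cast; ring
      _ ≤ C / (k.factorial : ℝ) * ρ ^ k := by gcongr
      _ = _ := by ring
  have key := hasDerivAt_tsum_of_isPreconnected (𝕜 := ℝ) (t := Metric.ball (0 : ℝ) ρ)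
    (g := fun k y => c k * y ^ k) (g' := fun k y => c k * (k * y ^ (k - 1))) (y₀ := t) (y := t) hu
    Metric.isOpen_ball (convex_ball _ _).isPreconnected
    (fun k y _ => (hasDerivAt_pow k y).const_mul (c k)) ?_ ?_ (hc.summable t) ?_
  · have h0 : ∑' k : ℕ, c k * (k * t ^ (k - 1)) = powerSum (derivCoeff c) t := by
      have hs : Summable fun k : ℕ => c k * (k * t ^ (k - 1)) := by
        refine Summable.of_norm_bounded hu fun k => ?_
        rw [norm_mul, norm_mul, norm_pow, Real.norm_eq_abs, Real.norm_eq_abs, Real.norm_eq_abs,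
          Nat.abs_cast]
        gcongr
        simp [ρ]
      rw [hs.tsum_eq_zero_add]
      simp only [Nat.cast_zero, zero_mul, mul_zero, zero_add]
      unfold powerSum
      refine tsum_congr fun k => ?_
      simp only [derivCoeff, Nat.add_sub_cancel]
      push_cast
      ring
    rw [← h0]
    exact key
  · intro k y hy
    rw [norm_mul, norm_mul, norm_pow, Real.norm_eq_abs, Real.norm_eq_abs, Real.norm_eq_abs,
      Nat.abs_cast]
    have : |y| ≤ ρ := by simpa using (Metric.mem_ball.1 hy).le
    gcongr
  · simp [ρ]
  · simp [ρ]

/-- Factorial decay is inherited by `derivCoeff`, so the induction on the order of differentiability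
must run over all coefficient sequences at once. -/
theorem contDiff_powerSum {c : ℕ → ℝ} (hc : FactorialDecay c) : ContDiff ℝ ∞ (powerSum c) := by
  rw [contDiff_infty]
  intro n
  induction n generalizing c with
  | zero =>
    exact contDiff_zero.2 (continuous_iff_continuousAt.2 fun t =>
      (hasDerivAt_powerSum hc t).continuousAt)
  | succ n ih =>
    have hd : deriv (powerSum c) = powerSum (derivCoeff c) :=
      funext fun t => (hasDerivAt_powerSum hc t).deriv
    rw [Nat.cast_succ, contDiff_succ_iff_deriv]
    refine ⟨fun t => (hasDerivAt_powerSum hc t).differentiableAt, by simp, ?_⟩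
    rw [hd]
    exact ih hc.derivCoeff

/-! ### Kummer's function: signs of coefficients, differential equation, largest root. -/

/-- The Taylor coefficients of Kummer's function. -/
noncomputable def kummerCoeff (a b : ℝ) (k : ℕ) : ℝ :=
  (ascPochhammer ℝ k).eval a / ((ascPochhammer ℝ k).eval b * (k.factorial : ℝ))

theorem kummerM_eq_powerSum (a b : ℝ) : kummerM a b = powerSum (kummerCoeff a b) := rfl

@[simp] theorem kummerCoeff_zero (a b : ℝ) : kummerCoeff a b 0 = 1 := by simp [kummerCoeff]

theorem kummerCoeff_one (a b : ℝ) : kummerCoeff a b 1 = a / b := by simp [kummerCoeff]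

theorem ascPochhammer_eval_pos {b : ℝ} (hb : 0 < b) (k : ℕ) :
    0 < (ascPochhammer ℝ k).eval b := ascPochhammer_pos k b hb

/-- The ratio of consecutive coefficients with denominators cleared; signs, bounds, monotonicity and
the differential equation all come from this recursion. -/
theorem kummerCoeff_succ {a b : ℝ} (hb : 0 < b) (k : ℕ) :
    (k + 1) * (b + k) * kummerCoeff a b (k + 1) = (a + k) * kummerCoeff a b k := by
  have h1 := (ascPochhammer_eval_pos hb k).ne'
  have h2 : b + k ≠ 0 := by positivity
  have h3 : (k.factorial : ℝ) ≠ 0 := by positivity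
  have h4 : (k : ℝ) + 1 ≠ 0 := by positivity
  unfold kummerCoeff
  rw [ascPochhammer_succ_eval, ascPochhammer_succ_eval, Nat.factorial_succ]
  push_cast
  field_simp

theorem abs_kummerCoeff_le {a b : ℝ} (ha : -1 ≤ a) (ha' : a ≤ 0) (hb : 1 ≤ b) (k : ℕ) :
    |kummerCoeff a b k| ≤ 1 / (k.factorial : ℝ) := by
  induction k with
  | zero => simp
  | succ k ih =>
    have h := kummerCoeff_succ (a := a) (b := b) (by linarith) k
    have h1 : |a + k| ≤ b + k := by
      have hk : (0 : ℝ) ≤ k := by positivity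
      rw [abs_le]; constructor <;> linarith
    have hk1 : (0 : ℝ) < k + 1 := by positivity
    have hbk : 0 < b + k := by positivity
    have h2 : (k + 1) * (b + k) * |kummerCoeff a b (k + 1)| ≤ (b + k) * (1 / (k.factorial : ℝ)) := by
      rw [← abs_of_pos hk1, ← abs_of_pos hbk, ← abs_mul, ← abs_mul, h, abs_mul, abs_of_pos hbk]
      gcongr
    have h3 : (k + 1) * |kummerCoeff a b (k + 1)| ≤ 1 / (k.factorial : ℝ) := by
      refine le_of_mul_le_mul_left ?_ hbk
      linarith
    rw [Nat.factorial_succ, Nat.cast_mul, ← div_div, le_div_iff₀ (by positivity)]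
    rw [le_div_iff₀ (by positivity)] at h3 ⊢
    push_cast
    field_simp
    linarith

theorem factorialDecay_kummerCoeff {a b : ℝ} (ha : -1 ≤ a) (ha' : a ≤ 0) (hb : 1 ≤ b) :
    FactorialDecay (kummerCoeff a b) := ⟨1, abs_kummerCoeff_le ha ha' hb⟩

/-- In a(a+1)⋯(a+k) only the first factor is negative when -1 ≤ a ≤ 0. This sign pattern is why a is
kept in [-1, 0] throughout. -/
theorem kummerCoeff_nonpos {a b : ℝ} (ha : -1 ≤ a) (ha' : a ≤ 0) (hb : 1 ≤ b) (k : ℕ) :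
    kummerCoeff a b (k + 1) ≤ 0 := by
  induction k with
  | zero => rw [kummerCoeff_one]; exact div_nonpos_of_nonpos_of_nonneg ha' (by linarith)
  | succ k ih =>
    have h := kummerCoeff_succ (a := a) (b := b) (by linarith) (k + 1)
    have hp : 0 < (((k + 1 : ℕ) : ℝ) + 1) * (b + ((k + 1 : ℕ) : ℝ)) := by positivity
    have h1 : (a + ((k + 1 : ℕ) : ℝ)) * kummerCoeff a b (k + 1) ≤ 0 := by
      refine mul_nonpos_of_nonneg_of_nonpos ?_ ih
      have : (0 : ℝ) ≤ k := by positivity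
      push_cast; linarith
    rw [← h] at h1
    exact nonpos_of_mul_nonpos_right h1 hp

theorem kummerCoeff_mono_right {a b b' : ℝ} (ha : -1 ≤ a) (ha' : a ≤ 0) (hb : 1 ≤ b)
    (hbb : b ≤ b') (k : ℕ) : kummerCoeff a b k ≤ kummerCoeff a b' k := by
  induction k with
  | zero => simp
  | succ k ih =>
    have h := kummerCoeff_succ (a := a) (b := b) (by linarith) k
    have h' := kummerCoeff_succ (a := a) (b := b') (by linarith) k
    have hn := kummerCoeff_nonpos ha ha' hb k
    have hn' := kummerCoeff_nonpos ha ha' (hb.trans hbb) k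
    have hk : (0 : ℝ) ≤ k := by positivity
    -- The step from 0 to 1 is separate because the factor a + k is nonpositive there. For k ≥ 1 it
    -- is nonnegative, and enlarging b to b' in front of a nonpositive coefficient only decreases
    -- the product.
    rcases Nat.eq_zero_or_pos k with rfl | hk0
    · rw [kummerCoeff_one, kummerCoeff_one, div_le_div_iff₀ (by linarith) (by linarith)]
      nlinarith
    · have hk1 : (1 : ℝ) ≤ k := by exact_mod_cast hk0
      have h1 : (a + k) * kummerCoeff a b k ≤ (a + k) * kummerCoeff a b' k :=
        mul_le_mul_of_nonneg_left ih (by linarith)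
      rw [← h, ← h'] at h1
      have h2 : (b + k) * kummerCoeff a b (k + 1) ≤ (b' + k) * kummerCoeff a b' (k + 1) := by
        refine le_of_mul_le_mul_left ?_ (show (0 : ℝ) < k + 1 by positivity)
        linarith
      have h3 : (b' + k) * kummerCoeff a b (k + 1) ≤ (b + k) * kummerCoeff a b (k + 1) := by
        nlinarith
      exact le_of_mul_le_mul_left (h3.trans h2) (by linarith)

section
variable {a b : ℝ}

/-- The derivative of Kummer's function in its last argument. -/
noncomputable def kummerDeriv (a b : ℝ) : ℝ → ℝ := powerSum (derivCoeff (kummerCoeff a b))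

/-- The second derivative of Kummer's function in its last argument. -/
noncomputable def kummerDeriv2 (a b : ℝ) : ℝ → ℝ :=
  powerSum (derivCoeff (derivCoeff (kummerCoeff a b)))

theorem hasDerivAt_kummerM (ha : -1 ≤ a) (ha' : a ≤ 0) (hb : 1 ≤ b) (t : ℝ) :
    HasDerivAt (kummerM a b) (kummerDeriv a b t) t :=
  hasDerivAt_powerSum (factorialDecay_kummerCoeff ha ha' hb) t

theorem hasDerivAt_kummerDeriv (ha : -1 ≤ a) (ha' : a ≤ 0) (hb : 1 ≤ b) (t : ℝ) :
    HasDerivAt (kummerDeriv a b) (kummerDeriv2 a b t) t :=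
  hasDerivAt_powerSum (factorialDecay_kummerCoeff ha ha' hb).derivCoeff t

theorem contDiff_kummerM (ha : -1 ≤ a) (ha' : a ≤ 0) (hb : 1 ≤ b) :
    ContDiff ℝ ∞ (kummerM a b) :=
  contDiff_powerSum (factorialDecay_kummerCoeff ha ha' hb)

theorem powerSum_mul_self {c : ℕ → ℝ} (hc : FactorialDecay c) (t : ℝ) :
    t * powerSum (derivCoeff c) t = ∑' k : ℕ, k * c k * t ^ k := by
  have hs : Summable fun k : ℕ => k * c k * t ^ k := by
    rw [← summable_nat_add_iff 1]
    refine ((hc.derivCoeff.summable t).mul_left t).congr fun k => ?_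
    simp only [derivCoeff]; push_cast; ring
  rw [hs.tsum_eq_zero_add, powerSum, ← tsum_mul_left]
  simp only [Nat.cast_zero, zero_mul, zero_add]
  refine tsum_congr fun k => ?_
  simp only [derivCoeff]; push_cast; ring

theorem summable_mul_self {c : ℕ → ℝ} (hc : FactorialDecay c) (t : ℝ) :
    Summable fun k : ℕ => k * c k * t ^ k := by
  rw [← summable_nat_add_iff 1]
  refine ((hc.derivCoeff.summable t).mul_left t).congr fun k => ?_
  simp only [derivCoeff]; push_cast; ring

/-- Kummer's differential equation. -/
theorem kummer_ode (ha : -1 ≤ a) (ha' : a ≤ 0) (hb : 1 ≤ b) (t : ℝ) :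
    t * kummerDeriv2 a b t + (b - t) * kummerDeriv a b t - a * kummerM a b t = 0 := by
  have hc := factorialDecay_kummerCoeff ha ha' hb
  have e1 := powerSum_mul_self hc.derivCoeff t
  have e2 := powerSum_mul_self hc t
  have s1 := summable_mul_self hc.derivCoeff t
  have s2 := summable_mul_self hc t
  have s3 := hc.derivCoeff.summable t
  have s4 := hc.summable t
  -- Kummer's equation is the coefficient recursion summed against tᵏ.
  have e : (∑' k : ℕ, k * derivCoeff (kummerCoeff a b) k * t ^ k)
      + b * (∑' k : ℕ, derivCoeff (kummerCoeff a b) k * t ^ k)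
      = (∑' k : ℕ, k * kummerCoeff a b k * t ^ k) + a * ∑' k : ℕ, kummerCoeff a b k * t ^ k := by
    rw [← tsum_mul_left, ← tsum_mul_left, ← s1.tsum_add (s3.mul_left b),
      ← s2.tsum_add (s4.mul_left a)]
    refine tsum_congr fun k => ?_
    have h := kummerCoeff_succ (a := a) (b := b) (by linarith) k
    simp only [derivCoeff]
    linear_combination t ^ k * h
  have e0 : t * kummerDeriv2 a b t + (b - t) * kummerDeriv a b t - a * kummerM a b t
      = t * powerSum (derivCoeff (derivCoeff (kummerCoeff a b))) t
        + b * powerSum (derivCoeff (kummerCoeff a b)) t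
        - t * powerSum (derivCoeff (kummerCoeff a b)) t - a * powerSum (kummerCoeff a b) t := by
    rw [kummerM_eq_powerSum, kummerDeriv, kummerDeriv2]; ring
  rw [e0, e1, e2]
  unfold powerSum
  linarith

theorem kummerDeriv_nonpos (ha : -1 ≤ a) (ha' : a ≤ 0) (hb : 1 ≤ b) {t : ℝ} (ht : 0 ≤ t) :
    kummerDeriv a b t ≤ 0 := by
  refine tsum_nonpos fun k => ?_
  have := kummerCoeff_nonpos ha ha' hb k
  refine mul_nonpos_of_nonpos_of_nonneg ?_ (by positivity)
  exact mul_nonpos_of_nonneg_of_nonpos (by positivity) this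

theorem kummerM_mono_right {b' : ℝ} (ha : -1 ≤ a) (ha' : a ≤ 0) (hb : 1 ≤ b) (hbb : b ≤ b')
    {t : ℝ} (ht : 0 ≤ t) : kummerM a b t ≤ kummerM a b' t := by
  rw [kummerM_eq_powerSum, kummerM_eq_powerSum]
  refine ((factorialDecay_kummerCoeff ha ha' hb).summable t).tsum_le_tsum (fun k => ?_)
    ((factorialDecay_kummerCoeff ha ha' (hb.trans hbb)).summable t)
  exact mul_le_mul_of_nonneg_right (kummerCoeff_mono_right ha ha' hb hbb k) (by positivity)

/-- No coefficient beyond the constant one is positive, and the linear one, a/b, is strictly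
negative. -/
theorem kummerM_strictAnti (ha : -1 ≤ a) (ha' : a < 0) (hb : 1 ≤ b) {t t' : ℝ} (ht : 0 ≤ t)
    (htt : t < t') : kummerM a b t' < kummerM a b t := by
  rw [kummerM_eq_powerSum]
  have hd := factorialDecay_kummerCoeff ha ha'.le hb
  have h1 : kummerCoeff a b 1 * t' ^ 1 < kummerCoeff a b 1 * t ^ 1 := by
    have : kummerCoeff a b 1 < 0 := by
      rw [kummerCoeff_one]; exact div_neg_of_neg_of_pos ha' (by linarith)
    rw [pow_one, pow_one]
    exact mul_lt_mul_of_neg_left htt this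
  have hle : ∀ k, kummerCoeff a b k * t' ^ k ≤ kummerCoeff a b k * t ^ k := by
    rintro (_ | k)
    · rw [pow_zero, pow_zero]
    · have h2 : t ^ (k + 1) ≤ t' ^ (k + 1) := pow_le_pow_left₀ ht htt.le _
      exact mul_le_mul_of_nonpos_left h2 (kummerCoeff_nonpos ha ha'.le hb k)
  exact Summable.tsum_lt_tsum hle h1 (hd.summable t') (hd.summable t)

theorem continuousOn_kummerM_left (hb : 1 ≤ b) (z : ℝ) :
    ContinuousOn (fun a => kummerM a b z) (Set.Icc (-1) 0) := by
  refine continuousOn_tsum (f := fun k a => kummerCoeff a b k * z ^ k)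
    (u := fun k => |z| ^ k / (k.factorial : ℝ)) (fun k => ?_)
    (Real.summable_pow_div_factorial |z|) fun k a ha => ?_
  · have : Continuous fun a : ℝ => kummerCoeff a b k :=
      (ascPochhammer ℝ k).continuous.div_const _
    exact (this.mul continuous_const).continuousOn
  · rw [norm_mul, norm_pow, Real.norm_eq_abs, Real.norm_eq_abs]
    calc _ ≤ 1 / (k.factorial : ℝ) * |z| ^ k := by
          gcongr; exact abs_kummerCoeff_le ha.1 ha.2 hb k
      _ = _ := by ring

theorem kummerM_zero_left (b z : ℝ) : kummerM 0 b z = 1 := by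
  unfold kummerM
  rw [tsum_eq_single 0]
  · simp
  · intro k hk
    rw [ascPochhammer_eval_zero, if_neg hk]; simp

/-- The factor a + 1 kills all coefficients from the second on. This linear polynomial is the source
of the threshold BR²/2 ≥ n. -/
theorem kummerM_neg_one {b : ℝ} (hb : 0 < b) (z : ℝ) : kummerM (-1) b z = 1 - z / b := by
  rw [kummerM_eq_powerSum, powerSum, tsum_eq_sum (s := Finset.range 2)]
  · simp [Finset.sum_range_succ, kummerCoeff_one]; ring
  · intro k hk
    have h2 : ∀ j, kummerCoeff (-1) b (j + 2) = 0 := by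
      intro j
      induction j with
      | zero =>
        have h := kummerCoeff_succ (a := -1) (b := b) hb 1
        norm_num at h
        rcases h with h | h
        · linarith
        · exact h
      | succ j ih =>
        have h := kummerCoeff_succ (a := -1) (b := b) hb (j + 2)
        rw [ih, mul_zero] at h
        have hp : ((((j + 2 : ℕ) : ℝ) + 1) * (b + ((j + 2 : ℕ) : ℝ))) ≠ 0 := by positivity
        exact (mul_eq_zero.1 h).resolve_left hp
    obtain ⟨j, rfl⟩ : ∃ j, k = j + 2 := ⟨k - 2, by simp at hk; omega⟩
    rw [h2, zero_mul]

/-- Arbitrary real a is needed here in order to exclude positive roots. The estimate |a + k| ≤ (|a|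
+ 1)(b + k) gives the majorant. -/
theorem summable_kummerCoeff (a : ℝ) (hb : 1 ≤ b) (t : ℝ) :
    Summable fun k => kummerCoeff a b k * t ^ k := by
  have hA : ∀ k, |kummerCoeff a b k| ≤ (|a| + 1) ^ k / (k.factorial : ℝ) := by
    intro k
    induction k with
    | zero => simp
    | succ k ih =>
      have h := kummerCoeff_succ (a := a) (b := b) (by linarith) k
      have hk1 : (0 : ℝ) < k + 1 := by positivity
      have hbk : 0 < b + k := by positivity
      have h1 : |a + k| ≤ (|a| + 1) * (b + k) := by
        refine (abs_add_le _ _).trans ?_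
        rw [Nat.abs_cast]
        nlinarith [abs_nonneg a, (Nat.cast_nonneg k : (0 : ℝ) ≤ k),
          mul_nonneg (abs_nonneg a) (Nat.cast_nonneg k : (0 : ℝ) ≤ k)]
      have h2 : (b + k) * ((k + 1) * |kummerCoeff a b (k + 1)|)
          ≤ (b + k) * ((|a| + 1) ^ (k + 1) / (k.factorial : ℝ)) := by
        calc (b + k) * ((k + 1) * |kummerCoeff a b (k + 1)|)
            = |(k + 1) * (b + k) * kummerCoeff a b (k + 1)| := by
              rw [abs_mul, abs_mul, abs_of_pos hk1, abs_of_pos hbk]; ring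
          _ = |a + k| * |kummerCoeff a b k| := by rw [h, abs_mul]
          _ ≤ ((|a| + 1) * (b + k)) * ((|a| + 1) ^ k / (k.factorial : ℝ)) := by gcongr
          _ = _ := by ring
      have h3 := le_of_mul_le_mul_left h2 hbk
      rw [Nat.factorial_succ, Nat.cast_mul, le_div_iff₀ (by positivity)]
      rw [le_div_iff₀ (by positivity)] at h3
      push_cast
      linarith
  refine Summable.of_norm_bounded (g := fun k => ((|a| + 1) * |t|) ^ k / (k.factorial : ℝ))
    (Real.summable_pow_div_factorial _) fun k => ?_
  rw [norm_mul, norm_pow, Real.norm_eq_abs, Real.norm_eq_abs, mul_pow]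
  calc _ ≤ (|a| + 1) ^ k / (k.factorial : ℝ) * |t| ^ k := by gcongr; exact hA k
    _ = _ := by ring

/-- All terms are nonnegative and the constant one is 1, so there is no root in [0, ∞). -/
theorem one_le_kummerM (ha : 0 ≤ a) (hb : 1 ≤ b) {z : ℝ} (hz : 0 ≤ z) : 1 ≤ kummerM a b z := by
  have h := (summable_kummerCoeff a hb z).sum_le_tsum {0} fun k _ => by
    have h1 := (ascPochhammer_eval_pos (show 0 < b by linarith) k).le
    have h2 : 0 ≤ (ascPochhammer ℝ k).eval a := by
      rcases ha.eq_or_lt with rfl | ha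
      · rw [ascPochhammer_eval_zero]; split_ifs <;> norm_num
      · exact (ascPochhammer_eval_pos ha k).le
    unfold kummerCoeff
    positivity
  simpa [kummerM_eq_powerSum, powerSum] using h

/-- If Kummer's function is nonpositive at some `a₀ ∈ [-1, 0]`, its largest root lies in
`[a₀, 0)`. -/
theorem exists_isKummerRoot_one (hb : 1 ≤ b) {z a₀ : ℝ} (hz : 0 ≤ z) (ha₀ : -1 ≤ a₀)
    (ha₀' : a₀ ≤ 0) (h : kummerM a₀ b z ≤ 0) :
    ∃ a, IsKummerRoot 1 b z a ∧ a₀ ≤ a ∧ a < 0 := by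
  have hc := (continuousOn_kummerM_left hb z).mono (Set.Icc_subset_Icc_left ha₀)
  -- The roots in [a₀, 0] form a compact set, nonempty by the intermediate value theorem since M(0,
  -- b, z) = 1; its maximum is the largest root of all.
  set S : Set ℝ := Set.Icc a₀ 0 ∩ (fun a => kummerM a b z) ⁻¹' {0}
  have hS : IsCompact S := isCompact_Icc.of_isClosed_subset
    (hc.preimage_isClosed_of_isClosed isClosed_Icc isClosed_singleton) Set.inter_subset_left
  have hne : S.Nonempty := by
    obtain ⟨a, ha, h0⟩ := intermediate_value_Icc ha₀' hc
      (show (0 : ℝ) ∈ Set.Icc (kummerM a₀ b z) (kummerM 0 b z) from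
        ⟨h, by rw [kummerM_zero_left]; exact zero_le_one⟩)
    exact ⟨a, ha, h0⟩
  obtain ⟨a, haS, hmax⟩ := hS.exists_isGreatest hne
  have ha0 : a < 0 := by
    refine lt_of_le_of_ne haS.1.2 ?_
    rintro rfl
    have := haS.2
    simp [kummerM_zero_left] at this
  refine ⟨a, ⟨haS.2, ?_⟩, haS.1.1, ha0⟩
  have : {a' : ℝ | a ≤ a' ∧ kummerM a' b z = 0} = {a} := by
    ext a'
    simp only [Set.mem_ofPred_eq, Set.mem_singleton_iff]
    constructor
    · rintro ⟨h1, h2⟩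
      refine le_antisymm (hmax ⟨⟨haS.1.1.trans h1, ?_⟩, h2⟩) h1
      by_contra! hpos
      have := one_le_kummerM hpos.le hb hz
      linarith
    · rintro rfl
      exact ⟨le_rfl, haS.2⟩
  rw [this]
  simp

/-- The smaller of two distinct candidates would have both of them among the roots at or above it.
-/
theorem IsKummerRoot.unique {z a' : ℝ} (h : IsKummerRoot 1 b z a) (h' : IsKummerRoot 1 b z a') :
    a = a' := by
  wlog hle : a ≤ a' generalizing a a'
  · exact (this h' h (le_of_not_ge hle)).symm
  obtain ⟨x, hx⟩ := Set.encard_eq_one.1 (by simpa using h.2)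
  have h1 : a ∈ ({x} : Set ℝ) := hx ▸ ⟨le_rfl, h.1⟩
  have h2 : a' ∈ ({x} : Set ℝ) := hx ▸ ⟨hle, h'.1⟩
  rw [h1, h2]

theorem kummerRoot_eq {z : ℝ} (h : IsKummerRoot 1 b z a) : kummerRoot 1 b z = a := by
  have : {a' : ℝ | IsKummerRoot 1 b z a'} = {a} :=
    Set.eq_singleton_iff_unique_mem.2 ⟨h, fun _ h' => h'.unique h⟩
  rw [kummerRoot, this, csSup_singleton]

end

/-! ### Radial inequalities for a single angular mode. -/

/-- Jacobi's method: η plays the role of r times the logarithmic derivative of a positive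
supersolution at level Λ. From (r f' - η f)² ≥ 0 and the Riccati inequality, (η f²)' is at most the
form density minus Λ f² r, and η f² vanishes at both ends. -/
theorem radial_inequality_of_riccati {f f' b η η' : ℝ → ℝ} {B R Λ ℓ : ℝ} (hR : 0 ≤ R)
    (hf : ∀ r, HasDerivAt f (f' r) r) (hf' : Continuous f') (hb : Continuous b)
    (hbf : ∀ r ∈ Set.Ioo 0 R, r * b r = (-ℓ + B * r ^ 2 / 2) * f r)
    (hη : ContinuousOn η (Set.Icc 0 R)) (hη' : ∀ r ∈ Set.Ioo 0 R, HasDerivAt η (η' r) r)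
    (hric : ∀ r ∈ Set.Ioo 0 R, r * η' r + η r ^ 2 ≤ (ℓ - B * r ^ 2 / 2) ^ 2 - Λ * r ^ 2)
    (h0 : η 0 * f 0 = 0) (hfR : f R = 0) :
    Λ * ∫ r in 0..R, f r ^ 2 * r ≤ ∫ r in 0..R, (f' r ^ 2 + b r ^ 2) * r := by
  have hfc : Continuous f := continuous_iff_continuousAt.2 fun r => (hf r).continuousAt
  have key := intervalIntegral.sub_le_integral_of_hasDeriv_right_of_le
    (g := fun r => η r * f r ^ 2) (g' := fun r => η' r * f r ^ 2 + η r * (2 * f r * f' r))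
    (φ := fun r => (f' r ^ 2 + b r ^ 2) * r - Λ * (f r ^ 2 * r)) hR
    (hη.mul (hfc.pow 2).continuousOn) (fun r hr => ?_)
    (Continuous.integrableOn_Icc (by fun_prop)) (fun r hr => ?_)
  · rw [intervalIntegral.integral_sub (Continuous.intervalIntegrable (by fun_prop) _ _)
      (Continuous.intervalIntegrable (by fun_prop) _ _), intervalIntegral.integral_const_mul] at key
    have e0 : η 0 * f 0 ^ 2 = 0 := by rw [pow_two, ← mul_assoc, h0, zero_mul]
    rw [e0, hfR] at key
    linarith
  · have h2 : HasDerivAt (fun r => f r ^ 2) (2 * f r * f' r) r := by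
      simpa using (hf r).fun_pow 2
    exact ((hη' r hr).mul h2).hasDerivWithinAt
  · have hr0 : 0 < r := hr.1
    refine le_of_mul_le_mul_left ?_ hr0
    have h1 := hric r hr
    have h2 : (r * b r) ^ 2 = ((-ℓ + B * r ^ 2 / 2) * f r) ^ 2 := by rw [hbf r hr]
    nlinarith [sq_nonneg (r * f' r - η r * f r), mul_le_mul_of_nonneg_right h1 (sq_nonneg (f r))]

/-- The radial profile `r ↦ rˡ exp(-B r² / 4)` of the lowest Landau level. -/
noncomputable def landauProfile (B : ℝ) (l : ℕ) (r : ℝ) : ℝ := r ^ l * Real.exp (-(B * r ^ 2 / 4))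

theorem continuous_landauProfile (B : ℝ) (l : ℕ) : Continuous (landauProfile B l) := by
  unfold landauProfile; fun_prop

theorem landauProfile_pos (B : ℝ) (l : ℕ) {r : ℝ} (hr : 0 < r) : 0 < landauProfile B l r := by
  unfold landauProfile; positivity

theorem hasDerivAt_landauProfile (B : ℝ) (l : ℕ) {r : ℝ} (hr : 0 < r) :
    HasDerivAt (landauProfile B l) (landauProfile B l r * (l / r - B * r / 2)) r := by
  have h1 : HasDerivAt (fun r : ℝ => r ^ l) (l * r ^ (l - 1)) r := hasDerivAt_pow l r
  have h2 : HasDerivAt (fun r : ℝ => Real.exp (-(B * r ^ 2 / 4)))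
      (Real.exp (-(B * r ^ 2 / 4)) * -(B * (2 * r) / 4)) r := by
    have h3 : HasDerivAt (fun r : ℝ => -(B * r ^ 2 / 4)) (-(B * (2 * r) / 4)) r := by
      have h4 : HasDerivAt (fun r : ℝ => r ^ 2) (2 * r) r := by simpa using hasDerivAt_pow 2 r
      exact ((h4.const_mul B).div_const 4).neg
    exact h3.exp
  refine (h1.fun_mul h2).congr_deriv ?_
  unfold landauProfile
  rcases l with _ | l
  · simp; ring
  · rw [Nat.add_sub_cancel]; field_simp; ring

theorem landauProfile_norm_pos (B : ℝ) (l : ℕ) {R : ℝ} (hR : 0 < R) :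
    0 < ∫ r in 0..R, landauProfile B l r ^ 2 * r := by
  have := continuous_landauProfile B l
  refine intervalIntegral.intervalIntegral_pos_of_pos_on
    (Continuous.intervalIntegrable (by fun_prop) _ _) (fun r hr => ?_) hR
  have := landauProfile_pos B l hr.1
  have := hr.1
  positivity

/-- The inequality behind the gap between the Landau levels, on functions which are orthogonal
to the lowest level. -/
theorem radial_gap_of_orthogonal {f f' b : ℝ → ℝ} {B R m : ℝ} {l : ℕ} (hB : 0 < B) (hR : 0 < R)
    (hf : ∀ r, HasDerivAt f (f' r) r) (hf' : Continuous f') (hb : Continuous b)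
    (hbf : ∀ r ∈ Set.Ioo 0 R, r * b r = (-(l : ℝ) + B * r ^ 2 / 2) * f r)
    (h0 : l * f 0 = 0) (hfR : f R = 0)
    (horth : ∫ r in 0..R, (f r - m * landauProfile B l r) * landauProfile B l r * r = 0) :
    B * (∫ r in 0..R, f r ^ 2 * r) + 2 * B * ∫ r in 0..R, (f r - m * landauProfile B l r) ^ 2 * r
      ≤ ∫ r in 0..R, (f' r ^ 2 + b r ^ 2) * r := by
  have hfc : Continuous f := continuous_iff_continuousAt.2 fun r => (hf r).continuousAt
  have hχc := continuous_landauProfile B l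
  -- Let D = d/dr - (l/r - Br/2), so that Dχ = 0. With weight r dr and the given boundary values,
  -- the form is B‖f‖² + ‖Df‖², and Df = Dg; the claim becomes ‖Dg‖² ≥ 2B‖g‖² for g orthogonal to χ.
  -- Orthogonality makes H vanish at both ends, so that g = -D*w with w = q/r = H/(χ r). The bound
  -- then reflects DD* ≥ 2B, since DD* - 2B is D*D with l + 1 in place of l.
  set χ := landauProfile B l with hχ
  set g : ℝ → ℝ := fun r => f r - m * χ r with hg
  have hgc : Continuous g := by fun_prop
  set H : ℝ → ℝ := fun r => ∫ s in 0..r, g s * χ s * s with hH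
  have hHd : ∀ r, HasDerivAt H (g r * χ r * r) r := fun r =>
    intervalIntegral.integral_hasDerivAt_right (Continuous.intervalIntegrable (by fun_prop) _ _)
      (Continuous.stronglyMeasurableAtFilter (by fun_prop) _ _)
      (Continuous.continuousAt (by fun_prop))
  have hHc : Continuous H := continuous_iff_continuousAt.2 fun r => (hHd r).continuousAt
  set q : ℝ → ℝ := fun r => H r / χ r with hq
  obtain ⟨M, hM⟩ := isCompact_Icc.exists_bound_of_continuousOn (s := Set.Icc 0 R) hgc.continuousOn
  have hM0 : 0 ≤ M := (norm_nonneg _).trans (hM 0 ⟨le_rfl, hR.le⟩)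
  -- near the origin `q` is quadratically small
  set K := M * Real.exp (B * R ^ 2 / 4) with hK
  have hqb : ∀ r ∈ Set.Ioc 0 R, |q r| ≤ K * r ^ 2 := by
    intro r hr
    have h1 : ‖H r‖ ≤ M * r ^ (l + 1) * |r - 0| := by
      refine intervalIntegral.norm_integral_le_of_norm_le_const fun s hs => ?_
      rw [Set.uIoc_of_le hr.1.le] at hs
      have hs0 : 0 < s := hs.1
      have h2 : χ s ≤ s ^ l := by
        rw [hχ, landauProfile]
        exact mul_le_of_le_one_right (by positivity)
          (Real.exp_le_one_iff.2 (by have : 0 ≤ B * s ^ 2 / 4 := by positivity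
                                     linarith))
      have h3 := (landauProfile_pos B l hs0).le
      rw [norm_mul, norm_mul, Real.norm_of_nonneg h3, Real.norm_of_nonneg hs0.le]
      calc ‖g s‖ * χ s * s ≤ M * s ^ l * s := by
            gcongr
            exact hM s ⟨hs0.le, hs.2.trans hr.2⟩
        _ = M * s ^ (l + 1) := by ring
        _ ≤ M * r ^ (l + 1) := by gcongr; exact hs.2
    rw [sub_zero, abs_of_pos hr.1] at h1
    have hr0 := hr.1
    have h4 : r ^ l ≤ χ r * Real.exp (B * R ^ 2 / 4) := by
      rw [hχ, landauProfile, mul_assoc, ← Real.exp_add]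
      refine le_mul_of_one_le_right (by positivity) (Real.one_le_exp ?_)
      have : B * r ^ 2 ≤ B * R ^ 2 := by gcongr; exact hr.2
      linarith
    have h5 := landauProfile_pos B l hr.1
    rw [hq]
    simp only
    rw [abs_div, abs_of_pos h5, div_le_iff₀ h5]
    calc |H r| ≤ M * r ^ (l + 1) * r := h1
      _ = M * r ^ 2 * r ^ l := by ring
      _ ≤ M * r ^ 2 * (χ r * Real.exp (B * R ^ 2 / 4)) := by gcongr
      _ = _ := by rw [hK]; ring
  have hH0 : H 0 = 0 := by simp [hH]
  have hq0 : q 0 = 0 := by simp [hq, hH0]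
  have hHR : H R = 0 := horth
  have hqR : q R = 0 := by simp [hq, hHR]
  -- At r = 0 the quotient has the value 0 by the convention for division, and the quadratic bound
  -- shows that this is also its limit.
  have hqc : ContinuousOn (fun r => q r / r) (Set.Icc 0 R) := by
    intro r hr
    rcases hr.1.eq_or_lt with rfl | hr0
    · rw [ContinuousWithinAt, div_zero]
      refine squeeze_zero_norm' (a := fun r => K * r) ?_ ?_
      · filter_upwards [self_mem_nhdsWithin] with r hr
        rcases hr.1.eq_or_lt with rfl | hr0
        · simp
        · rw [norm_div, Real.norm_eq_abs, Real.norm_eq_abs, abs_of_pos hr0, div_le_iff₀ hr0]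
          have := hqb r ⟨hr0, hr.2⟩
          linarith
      · have : Continuous fun r : ℝ => K * r := by fun_prop
        simpa using (this.tendsto 0).mono_left nhdsWithin_le_nhds
    · have := (landauProfile_pos B l hr0).ne'
      exact (((hHc.continuousAt.div hχc.continuousAt this).div continuousAt_id
        hr0.ne')).continuousWithinAt
  have hqc' : ContinuousOn q (Set.Icc 0 R) := by
    refine (hqc.mul continuousOn_id).congr fun r hr => ?_
    rcases hr.1.eq_or_lt with rfl | hr0
    · simp [hq0]
    · exact (div_mul_cancel₀ (q r) hr0.ne').symm
  -- The primitive collects the boundary terms of three integrations by parts: the one in the form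
  -- itself, the one in ⟨Dg, w⟩ = -‖g‖², and the one comparing ‖D*w‖² with ‖w‖². All of them vanish
  -- at 0 and at R.
  have key := intervalIntegral.sub_le_integral_of_hasDeriv_right_of_le
    (g := fun r => (l - B * r ^ 2 / 2) * f r ^ 2 - 4 * B * (g r * q r)
      + 2 * B * (2 * l + 2 - B * r ^ 2) * (q r / r) ^ 2)
    (g' := fun r => (-(B * r)) * f r ^ 2 + (l - B * r ^ 2 / 2) * (2 * f r * f' r)
      - 4 * B * ((f' r - m * (χ r * (l / r - B * r / 2))) * q r
        + g r * (g r * r - q r * (l / r - B * r / 2)))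
      + (2 * B * (-(B * (2 * r))) * (q r / r) ^ 2 + 2 * B * (2 * l + 2 - B * r ^ 2) *
        (2 * (q r / r) * (((g r * r - q r * (l / r - B * r / 2)) * r - q r * 1) / r ^ 2))))
    (φ := fun r => (f' r ^ 2 + b r ^ 2) * r - (B * (f r ^ 2 * r) + 2 * B * (g r ^ 2 * r))) hR.le
    ?_ (fun r hr => ?_) (Continuous.integrableOn_Icc (by fun_prop)) (fun r hr => ?_)
  · rw [intervalIntegral.integral_sub (Continuous.intervalIntegrable (by fun_prop) _ _)
      (Continuous.intervalIntegrable (by fun_prop) _ _), intervalIntegral.integral_add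
      (Continuous.intervalIntegrable (by fun_prop) _ _)
      (Continuous.intervalIntegrable (by fun_prop) _ _), intervalIntegral.integral_const_mul,
      intervalIntegral.integral_const_mul] at key
    have e0 : (l : ℝ) * f 0 ^ 2 = 0 := by rw [pow_two, ← mul_assoc, h0, zero_mul]
    simp only [hqR, hq0, hfR] at key
    norm_num at key
    rw [e0] at key
    linarith
  · refine ContinuousOn.add (ContinuousOn.sub (Continuous.continuousOn (by fun_prop)) ?_) ?_
    · exact continuousOn_const.mul (hgc.continuousOn.mul hqc')
    · exact (Continuous.continuousOn (by fun_prop)).mul (hqc.pow 2)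
  · have hr0 : 0 < r := hr.1
    have hχ0 := (landauProfile_pos B l hr0).ne'
    have dχ := hasDerivAt_landauProfile B l hr0
    have dg : HasDerivAt g (f' r - m * (χ r * (l / r - B * r / 2))) r :=
      (hf r).sub (dχ.const_mul m)
    have dq : HasDerivAt q (g r * r - q r * (l / r - B * r / 2)) r := by
      refine ((hHd r).div dχ hχ0).congr_deriv ?_
      simp only [hq]
      rw [← hχ] at hχ0 ⊢
      field_simp
    have d2 : HasDerivAt (fun r : ℝ => r ^ 2) (2 * r) r := by simpa using hasDerivAt_pow 2 r
    have df2 : HasDerivAt (fun r => f r ^ 2) (2 * f r * f' r) r := by simpa using (hf r).fun_pow 2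
    have dq2 : HasDerivAt (fun r => (q r / r) ^ 2)
        (2 * (q r / r) * (((g r * r - q r * (l / r - B * r / 2)) * r - q r * 1) / r ^ 2)) r := by
      simpa using ((dq.fun_div (hasDerivAt_id' r) hr0.ne').fun_pow 2)
    have dl : HasDerivAt (fun r : ℝ => (l : ℝ) - B * r ^ 2 / 2) (-(B * r)) r := by
      refine (((d2.const_mul B).div_const 2).const_sub (l : ℝ)).congr_deriv ?_
      ring
    have dW : HasDerivAt (fun r : ℝ => 2 * B * (2 * l + 2 - B * r ^ 2))
        (2 * B * (-(B * (2 * r)))) r :=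
      ((d2.const_mul B).const_sub (2 * (l : ℝ) + 2)).const_mul (2 * B)
    exact (((dl.mul df2).sub ((dg.mul dq).const_mul (4 * B))).add (dW.mul dq2)).hasDerivWithinAt
  · have hr0 : 0 < r := hr.1
    have hb2 : b r = (-(l : ℝ) + B * r ^ 2 / 2) * f r / r := by
      rw [eq_div_iff hr0.ne', ← hbf r hr]; ring
    rw [hb2, ← sub_nonneg]
    -- The defect equals r(Dg + 2Bw)² + 2Br(D₁w)², where D₁ is D with l + 1 in place of l. Its
    -- integral is ‖Dg‖² - 2B‖g‖².
    have hsq : 0 ≤ r * ((f' r - m * (χ r * (l / r - B * r / 2))) - (l / r - B * r / 2) * g r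
        + 2 * B * (q r / r)) ^ 2 + 2 * B * r * (g r - (2 * l + 2 - B * r ^ 2) * q r / r ^ 2) ^ 2 := by
      positivity
    refine hsq.trans_eq ?_
    simp only [hg]
    field_simp
    ring

/-- With m the projection coefficient of f on the lowest Landau profile, Pythagoras turns the gap
for the orthogonal remainder into a bound for f itself with a rank-one correction. -/
theorem radial_gap {f f' b : ℝ → ℝ} {B R : ℝ} {l : ℕ} (hB : 0 < B) (hR : 0 < R)
    (hf : ∀ r, HasDerivAt f (f' r) r) (hf' : Continuous f') (hb : Continuous b)
    (hbf : ∀ r ∈ Set.Ioo 0 R, r * b r = (-(l : ℝ) + B * r ^ 2 / 2) * f r)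
    (h0 : l * f 0 = 0) (hfR : f R = 0) :
    3 * B * ∫ r in 0..R, f r ^ 2 * r ≤ (∫ r in 0..R, (f' r ^ 2 + b r ^ 2) * r)
      + 2 * B / (∫ r in 0..R, landauProfile B l r ^ 2 * r)
        * (∫ r in 0..R, f r * landauProfile B l r * r) ^ 2 := by
  have hfc : Continuous f := continuous_iff_continuousAt.2 fun r => (hf r).continuousAt
  have hχc := continuous_landauProfile B l
  have hN := landauProfile_norm_pos B l hR
  set N := ∫ r in 0..R, landauProfile B l r ^ 2 * r with hNdef
  set P := ∫ r in 0..R, f r * landauProfile B l r * r with hP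
  set m := P / N with hm
  have horth : ∫ r in 0..R, (f r - m * landauProfile B l r) * landauProfile B l r * r = 0 := by
    have : ∀ r, (f r - m * landauProfile B l r) * landauProfile B l r * r
        = f r * landauProfile B l r * r - m * (landauProfile B l r ^ 2 * r) := fun r => by ring
    simp only [this]
    rw [intervalIntegral.integral_sub (Continuous.intervalIntegrable (by fun_prop) _ _)
      (Continuous.intervalIntegrable (by fun_prop) _ _), intervalIntegral.integral_const_mul,
      ← hNdef, ← hP, hm]
    field_simp
    ring
  have h := radial_gap_of_orthogonal hB hR hf hf' hb hbf h0 hfR horth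
  have e : ∫ r in 0..R, (f r - m * landauProfile B l r) ^ 2 * r
      = (∫ r in 0..R, f r ^ 2 * r) - P ^ 2 / N := by
    have : ∀ r, (f r - m * landauProfile B l r) ^ 2 * r
        = f r ^ 2 * r - 2 * m * (f r * landauProfile B l r * r)
          + m ^ 2 * (landauProfile B l r ^ 2 * r) := fun r => by ring
    simp only [this]
    rw [intervalIntegral.integral_add (Continuous.intervalIntegrable (by fun_prop) _ _)
      (Continuous.intervalIntegrable (by fun_prop) _ _), intervalIntegral.integral_sub
      (Continuous.intervalIntegrable (by fun_prop) _ _)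
      (Continuous.intervalIntegrable (by fun_prop) _ _), intervalIntegral.integral_const_mul,
      intervalIntegral.integral_const_mul, ← hNdef, ← hP, hm]
    field_simp
    ring
  rw [e] at h
  have e2 : 2 * B / N * P ^ 2 = 2 * B * (P ^ 2 / N) := by ring
  rw [e2]
  linarith

/-- Angular momenta of the unfavourable sign. -/
theorem radial_inequality_of_neg {f f' b : ℝ → ℝ} {B R ℓ : ℝ} (hB : 0 < B) (hR : 0 < R)
    (hℓ : ℓ ≤ -1)
    (hf : ∀ r, HasDerivAt f (f' r) r) (hf' : Continuous f') (hb : Continuous b)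
    (hbf : ∀ r ∈ Set.Ioo 0 R, r * b r = (-ℓ + B * r ^ 2 / 2) * f r)
    (h0 : f 0 = 0) (hfR : f R = 0) :
    3 * B * ∫ r in 0..R, f r ^ 2 * r ≤ ∫ r in 0..R, (f' r ^ 2 + b r ^ 2) * r := by
  -- This η belongs to r^{-ℓ} exp(-Br²/4), which solves the radial equation at level (1 - 2ℓ)B ≥ 3B.
  refine radial_inequality_of_riccati (η := fun r => -ℓ - B * r ^ 2 / 2)
    (η' := fun r => -(B * r)) hR.le hf hf' hb hbf (by fun_prop) (fun r _ => ?_)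
    (fun r hr => ?_) (by rw [h0, mul_zero]) hfR
  · have d2 : HasDerivAt (fun r : ℝ => r ^ 2) (2 * r) r := by simpa using hasDerivAt_pow 2 r
    refine (((d2.const_mul B).div_const 2).const_sub (-ℓ)).congr_deriv ?_
    ring
  · nlinarith [mul_nonneg (mul_nonneg hB.le (sq_nonneg r)) (show 0 ≤ -1 - ℓ by linarith)]

/-- High angular momenta: the Kummer function with parameter `n ≤ ℓ + 1` is a supersolution. -/
theorem radial_inequality_of_kummer {f f' b : ℝ → ℝ} {B R ℓ a n : ℝ} (hB : 0 < B)
    (ha : -1 ≤ a) (ha' : a < 0) (hn : 1 ≤ n) (hℓ : n ≤ ℓ + 1)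
    (hroot : kummerM a n (B * R ^ 2 / 2) = 0)
    (hf : ∀ r, HasDerivAt f (f' r) r) (hf' : Continuous f') (hb : Continuous b)
    (hbf : ∀ r ∈ Set.Ioo 0 R, r * b r = (-ℓ + B * r ^ 2 / 2) * f r)
    (h0 : ℓ * f 0 = 0) {R' : ℝ} (hR' : 0 < R') (hRR : R' < R) (hfR : ∀ r, R' ≤ r → f r = 0)
    (hbR : ∀ r, R' ≤ r → b r = 0) (hfR' : ∀ r, R' ≤ r → f' r = 0) :
    (1 - 2 * a) * B * ∫ r in 0..R, f r ^ 2 * r ≤ ∫ r in 0..R, (f' r ^ 2 + b r ^ 2) * r := by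
  have hfc : Continuous f := continuous_iff_continuousAt.2 fun r => (hf r).continuousAt
  -- The Kummer factor vanishes at R, where η is singular; since f is supported in [0, R'], the
  -- argument runs on [0, R'] only.
  have cut : ∀ h : ℝ → ℝ, Continuous h → (∀ r, R' ≤ r → h r = 0) →
      ∫ r in 0..R, h r = ∫ r in 0..R', h r := by
    intro h hc hz
    rw [← intervalIntegral.integral_add_adjacent_intervals (hc.intervalIntegrable 0 R')
      (hc.intervalIntegrable R' R)]
    rw [intervalIntegral.integral_congr (a := R') (g := fun _ => 0)
      fun r hr => hz r (by rw [Set.uIcc_of_le hRR.le] at hr; exact hr.1)]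
    simp
  rw [cut _ (by fun_prop) fun r hr => by simp [hfR r hr],
    cut _ (by fun_prop) fun r hr => by simp [hfR' r hr, hbR r hr]]
  have hpos : ∀ r ∈ Set.Icc 0 R', 0 < kummerM a n (B * r ^ 2 / 2) := by
    intro r hr
    rw [← hroot]
    refine kummerM_strictAnti ha ha' hn (by have := hr.1; positivity) ?_
    have : r ^ 2 < R ^ 2 := by
      have := hr.1; have := hr.2
      gcongr; linarith
    nlinarith
  have d2 : ∀ r : ℝ, HasDerivAt (fun r : ℝ => B * r ^ 2 / 2) (B * r) r := fun r => by
    have d2 : HasDerivAt (fun r : ℝ => r ^ 2) (2 * r) r := by simpa using hasDerivAt_pow 2 r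
    refine ((d2.const_mul B).div_const 2).congr_deriv ?_
    ring
  have dF : ∀ r : ℝ, HasDerivAt (fun r => kummerM a n (B * r ^ 2 / 2))
      (kummerDeriv a n (B * r ^ 2 / 2) * (B * r)) r := fun r =>
    HasDerivAt.comp r (hasDerivAt_kummerM ha ha'.le hn _) (d2 r)
  have dF' : ∀ r : ℝ, HasDerivAt (fun r => kummerDeriv a n (B * r ^ 2 / 2))
      (kummerDeriv2 a n (B * r ^ 2 / 2) * (B * r)) r := fun r =>
    HasDerivAt.comp r (hasDerivAt_kummerDeriv ha ha'.le hn _) (d2 r)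
  -- Here η is r times the logarithmic derivative of r^ℓ exp(-Br²/4) M(a, n, Br²/2).
  have dη : ∀ r ∈ Set.Icc 0 R', HasDerivAt
      (fun r => 2 * (B * r ^ 2 / 2) * kummerDeriv a n (B * r ^ 2 / 2)
        / kummerM a n (B * r ^ 2 / 2) + (ℓ - B * r ^ 2 / 2))
      (((2 * (B * r) * kummerDeriv a n (B * r ^ 2 / 2)
        + 2 * (B * r ^ 2 / 2) * (kummerDeriv2 a n (B * r ^ 2 / 2) * (B * r)))
          * kummerM a n (B * r ^ 2 / 2)
        - 2 * (B * r ^ 2 / 2) * kummerDeriv a n (B * r ^ 2 / 2)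
          * (kummerDeriv a n (B * r ^ 2 / 2) * (B * r))) / kummerM a n (B * r ^ 2 / 2) ^ 2
        + (-(B * r))) r := fun r hr =>
    (((((d2 r).const_mul 2).mul (dF' r)).div (dF r) (hpos r hr).ne').add
      ((d2 r).const_sub ℓ))
  refine radial_inequality_of_riccati hR'.le hf hf' hb
    (fun r hr => hbf r ⟨hr.1, hr.2.trans hRR⟩)
    (fun r hr => (dη r hr).continuousAt.continuousWithinAt)
    (fun r hr => dη r ⟨hr.1.le, hr.2.le⟩) (fun r hr => ?_) ?_ (hfR R' le_rfl)
  · have hr0 : 0 < r := hr.1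
    have hF := hpos r ⟨hr.1.le, hr.2.le⟩
    set t := B * r ^ 2 / 2 with ht
    have ht0 : 0 < t := by positivity
    have hode := kummer_ode ha ha'.le hn t
    have hd := kummerDeriv_nonpos ha ha'.le hn ht0.le
    set F := kummerM a n t
    set F1 := kummerDeriv a n t
    set F2 := kummerDeriv2 a n t
    have hBr : B * r * r = 2 * t := by rw [ht]; ring
    have hBr2 : B * r ^ 2 = 2 * t := by rw [ht]; ring
    rw [← sub_nonneg]
    -- By Kummer's equation the Riccati defect is zero for n = ℓ + 1. In general it carries the
    -- factor (n - 1 - ℓ) F1, a product of two nonpositive numbers.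
    have e : (ℓ - t) ^ 2 - (1 - 2 * a) * B * r ^ 2
        - (r * (((2 * (B * r) * F1 + 2 * t * (F2 * (B * r))) * F - 2 * t * F1 * (F1 * (B * r)))
          / F ^ 2 + -(B * r)) + (2 * t * F1 / F + (ℓ - t)) ^ 2)
        = 4 * t * ((n - 1 - ℓ) * F1) / F := by
      have e1 : (1 - 2 * a) * B * r ^ 2 = (1 - 2 * a) * (2 * t) := by rw [mul_assoc, hBr2]
      have e2 : r * (((2 * (B * r) * F1 + 2 * t * (F2 * (B * r))) * F - 2 * t * F1 * (F1 * (B * r)))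
          / F ^ 2 + -(B * r)) = ((2 * (2 * t) * F1 + 2 * t * (F2 * (2 * t))) * F
            - 2 * t * F1 * (F1 * (2 * t))) / F ^ 2 + -(2 * t) := by
        rw [← hBr]; ring
      rw [e1, e2]
      have hF0 := hF.ne'
      field_simp
      linear_combination (-4 * t * F) * hode
    rw [e]
    have : 0 ≤ (n - 1 - ℓ) * F1 := mul_nonneg_of_nonpos_of_nonpos (by linarith) hd
    positivity
  · simpa using h0

/-! ### Fourier expansion in the angle. -/

open Real in
/-- The coefficient of `e^{-ilθ}` in the Fourier series of `θ ↦ q r θ`. -/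
noncomputable def angularCoeff (q : ℝ → ℝ → ℂ) (l : ℤ) (r : ℝ) : ℂ :=
  (1 / (2 * π) : ℝ) • ∫ θ in (-π)..π, Complex.exp (Complex.I * l * θ) * q r θ

section Angular
open Real Function

variable {q q' : ℝ → ℝ → ℂ}

theorem continuous_section (hq : Continuous (uncurry q)) (r : ℝ) : Continuous (q r) :=
  hq.comp (by fun_prop : Continuous fun θ : ℝ => (r, θ))

theorem continuous_angularCoeff (hq : Continuous (uncurry q)) (l : ℤ) :
    Continuous (angularCoeff q l) := by
  have h : Continuous fun p : ℝ × ℝ => Complex.exp (Complex.I * l * p.2) * uncurry q p := by fun_prop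
  have h' := intervalIntegral.continuous_parametric_intervalIntegral_of_continuous' (μ := volume)
    (f := fun r θ : ℝ => Complex.exp (Complex.I * l * θ) * q r θ) h (-π) π
  exact h'.const_smul (1 / (2 * π) : ℝ)

theorem hasDerivAt_angularCoeff (hq : Continuous (uncurry q)) (hq' : Continuous (uncurry q'))
    (h : ∀ r θ, HasDerivAt (fun r => q r θ) (q' r θ) r) (l : ℤ) (r : ℝ) :
    HasDerivAt (angularCoeff q l) (angularCoeff q' l r) r := by
  unfold angularCoeff
  refine HasDerivAt.fun_const_smul _ ?_
  have hqs := continuous_section hq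
  have hqs' := continuous_section hq'
  have hcomp : IsCompact (Metric.closedBall r 1 ×ˢ Set.Icc (-π) π) :=
    (isCompact_closedBall r 1).prod isCompact_Icc
  obtain ⟨M, hM⟩ := hcomp.exists_bound_of_continuousOn hq'.continuousOn
  refine (intervalIntegral.hasDerivAt_integral_of_dominated_loc_of_deriv_le
    (F := fun r θ => Complex.exp (Complex.I * l * θ) * q r θ)
    (F' := fun r θ => Complex.exp (Complex.I * l * θ) * q' r θ) (bound := fun _ => M)
    (Metric.closedBall_mem_nhds r one_pos) ?_ ?_ ?_ ?_ ?_ ?_).2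
  · exact Filter.Eventually.of_forall fun x =>
      (Continuous.aestronglyMeasurable (by have := hqs x; fun_prop))
  · exact Continuous.intervalIntegrable (by have := hqs r; fun_prop) _ _
  · exact Continuous.aestronglyMeasurable (by have := hqs' r; fun_prop)
  · refine Filter.Eventually.of_forall fun θ hθ x hx => ?_
    rw [Set.uIoc_of_le (by linarith [pi_pos])] at hθ
    have e : ‖Complex.exp (Complex.I * l * θ)‖ = 1 := by
      rw [Complex.norm_exp]; simp
    rw [norm_mul, e, one_mul]
    exact hM (x, θ) ⟨hx, hθ.1.le, hθ.2⟩
  · exact intervalIntegrable_const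
  · exact Filter.Eventually.of_forall fun θ _ x _ => (h x θ).const_mul _

theorem angularCoeff_of_hasDerivAt {r : ℝ} {f f' : ℝ → ℂ} (hf : ∀ θ, HasDerivAt f (f' θ) θ)
    (hf' : Continuous f') (hper : f (-π) = f π) (l : ℤ) :
    angularCoeff (fun _ => f') l r = -Complex.I * l * angularCoeff (fun _ => f) l r := by
  have hfc : Continuous f := continuous_iff_continuousAt.2 fun θ => (hf θ).continuousAt
  have hexp : ∀ θ : ℝ, HasDerivAt (fun θ : ℝ => Complex.exp (Complex.I * l * θ))
      (Complex.exp (Complex.I * l * θ) * (Complex.I * l)) θ := by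
    intro θ
    have h1 : HasDerivAt (fun θ : ℝ => Complex.I * l * (θ : ℂ)) (Complex.I * l * 1) θ :=
      (Complex.ofRealCLM.hasDerivAt (x := θ)).const_mul _
    rw [mul_one] at h1
    exact h1.cexp
  have key := intervalIntegral.integral_mul_deriv_eq_deriv_mul (a := -π) (b := π)
    (fun x _ => hexp x) (fun x _ => hf x) (Continuous.intervalIntegrable (by fun_prop) _ _)
    (hf'.intervalIntegrable _ _)
  have e1 : Complex.exp (Complex.I * l * ((-π : ℝ) : ℂ)) = Complex.exp (Complex.I * l * (π : ℝ)) := by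
    rw [Complex.exp_eq_exp_iff_exists_int]
    refine ⟨-l, ?_⟩
    push_cast; ring
  unfold angularCoeff
  rw [key, hper, e1, sub_self, zero_sub, ← intervalIntegral.integral_neg, mul_smul_comm,
    ← intervalIntegral.integral_const_mul]
  congr 1
  refine intervalIntegral.integral_congr fun θ _ => ?_
  simp only
  ring

theorem hasSum_sq_angularCoeff (hq : Continuous (uncurry q)) (r : ℝ) :
    HasSum (fun l : ℤ => ‖angularCoeff q l r‖ ^ 2) (1 / (2 * π) * ∫ θ in (-π)..π, ‖q r θ‖ ^ 2) := by
  have hqr := continuous_section hq r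
  have hab : -π < π := by linarith [pi_pos]
  have hL2 : MemLp (q r) 2 (volume.restrict (Set.Ioc (-π) π)) :=
    ((memLp_two_iff_integrable_sq_norm hqr.aestronglyMeasurable).2
      (((hqr.norm.pow 2).integrableOn_Icc).mono_set Set.Ioc_subset_Icc_self))
  have h := hasSum_sq_fourierCoeffOn hab hL2
  -- `angularCoeff` is indexed by e^{-ilθ}, opposite to `fourierCoeffOn`.
  rw [← (Equiv.neg ℤ).hasSum_iff] at h
  convert h using 1
  · funext l
    simp only [comp_apply, Equiv.neg_apply]
    rw [fourierCoeffOn_eq_integral]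
    unfold angularCoeff
    congr 3
    · ring
    · refine intervalIntegral.integral_congr fun θ _ => ?_
      simp only [fourier_coe_apply, smul_eq_mul]
      congr 2
      have : (π : ℂ) ≠ 0 := by exact_mod_cast pi_ne_zero
      push_cast
      field_simp
      ring
  · rw [smul_eq_mul, one_div]; congr 2; ring

/-- Parseval on each circle, integrated over r. Its partial sums are bounded by the full circular
integral, which justifies exchanging sum and integral. -/
theorem hasSum_integral_angularCoeff (hq : Continuous (uncurry q)) {R : ℝ} (hR : 0 ≤ R) :
    HasSum (fun l : ℤ => ∫ r in 0..R, ‖angularCoeff q l r‖ ^ 2 * r)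
      (1 / (2 * π) * ∫ r in 0..R, (∫ θ in (-π)..π, ‖q r θ‖ ^ 2) * r) := by
  have hc := continuous_angularCoeff hq
  have hcirc : Continuous fun r => ∫ θ in (-π)..π, ‖q r θ‖ ^ 2 :=
    intervalIntegral.continuous_parametric_intervalIntegral_of_continuous'
      (f := fun r θ => ‖q r θ‖ ^ 2)
      (by have : Continuous fun p : ℝ × ℝ => ‖uncurry q p‖ ^ 2 := by fun_prop
          exact this) _ _
  have hint : ∀ l, Integrable (fun r => ‖angularCoeff q l r‖ ^ 2 * r)
      (volume.restrict (Set.Ioc 0 R)) := fun l =>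
    (Continuous.integrableOn_Icc (by have := hc l; fun_prop)).mono_set Set.Ioc_subset_Icc_self
  have hnorm : ∀ l, ∫ r in Set.Ioc 0 R, ‖‖angularCoeff q l r‖ ^ 2 * r‖
      = ∫ r in Set.Ioc 0 R, ‖angularCoeff q l r‖ ^ 2 * r := fun l => by
    refine setIntegral_congr_fun measurableSet_Ioc fun r hr => ?_
    exact Real.norm_of_nonneg (mul_nonneg (sq_nonneg _) hr.1.le)
  have hsum : Summable fun l => ∫ r in Set.Ioc 0 R, ‖‖angularCoeff q l r‖ ^ 2 * r‖ := by
    refine summable_of_sum_le (c := ∫ r in Set.Ioc 0 R,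
      (1 / (2 * π) * ∫ θ in (-π)..π, ‖q r θ‖ ^ 2) * r)
      (fun l => integral_nonneg fun r => norm_nonneg _) fun s => ?_
    simp only [hnorm]
    rw [← integral_finsetSum _ fun l _ => hint l]
    refine setIntegral_mono_on (integrable_finsetSum _ fun l _ => hint l)
      ((Continuous.integrableOn_Icc (by fun_prop)).mono_set Set.Ioc_subset_Icc_self)
      measurableSet_Ioc fun r hr => ?_
    rw [← Finset.sum_mul]
    refine mul_le_mul_of_nonneg_right ?_ hr.1.le
    exact sum_le_hasSum s (fun _ _ => sq_nonneg _) (hasSum_sq_angularCoeff hq r)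
  have key := hasSum_integral_of_summable_integral_norm hint hsum
  have e : ∫ r in Set.Ioc 0 R, ∑' l : ℤ, ‖angularCoeff q l r‖ ^ 2 * r
      = 1 / (2 * π) * ∫ r in Set.Ioc 0 R, (∫ θ in (-π)..π, ‖q r θ‖ ^ 2) * r := by
    rw [← integral_const_mul]
    refine setIntegral_congr_fun measurableSet_Ioc fun r hr => ?_
    simp only [tsum_mul_right, (hasSum_sq_angularCoeff hq r).tsum_eq]
    ring
  simp only [intervalIntegral.integral_of_le hR]
  rw [← e]
  exact key

theorem angularCoeff_add (hq : Continuous (uncurry q)) (hq' : Continuous (uncurry q')) (l : ℤ)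
    (r : ℝ) : angularCoeff (fun r θ => q r θ + q' r θ) l r
      = angularCoeff q l r + angularCoeff q' l r := by
  have h1 := continuous_section hq r
  have h2 := continuous_section hq' r
  unfold angularCoeff
  rw [← smul_add, ← intervalIntegral.integral_add
    (Continuous.intervalIntegrable (by fun_prop) _ _)
    (Continuous.intervalIntegrable (by fun_prop) _ _)]
  simp only [mul_add]

theorem angularCoeff_smul (c : ℝ → ℂ) (q : ℝ → ℝ → ℂ) (l : ℤ) (r : ℝ) :
    angularCoeff (fun r θ => c r * q r θ) l r = c r * angularCoeff q l r := by
  unfold angularCoeff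
  rw [mul_smul_comm, ← intervalIntegral.integral_const_mul]
  simp only [mul_left_comm]

/-- The coefficient multiplying the projections to the lowest level. -/
noncomputable def gapConstant (B R : ℝ) (l : ℕ) : ℝ :=
  2 * B / ∫ r in 0..R, landauProfile B l r ^ 2 * r

/-- The radial inequality for one complex angular mode. -/
theorem mode_inequality {f f' b : ℝ → ℂ} {B R a : ℝ} {n : ℕ} {l : ℤ} (hB : 0 < B)
    (ha : -1 ≤ a) (ha' : a < 0) (hn : 1 ≤ n)
    (hroot : kummerM a n (B * R ^ 2 / 2) = 0)
    (hf : ∀ r, HasDerivAt f (f' r) r) (hf' : Continuous f') (hb : Continuous b)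
    (hbf : ∀ r, r * b r = (-l + B * r ^ 2 / 2) * f r)
    {R' : ℝ} (hR' : 0 < R') (hRR : R' < R) (hfR : ∀ r, R' ≤ r → f r = 0)
    (hbR : ∀ r, R' ≤ r → b r = 0) (hfR' : ∀ r, R' ≤ r → f' r = 0) :
    (1 - 2 * a) * B * ∫ r in 0..R, ‖f r‖ ^ 2 * r ≤ (∫ r in 0..R, (‖f' r‖ ^ 2 + ‖b r‖ ^ 2) * r)
      + (if 0 ≤ l ∧ l < n - 1 then gapConstant B R l.toNat
          * ‖∫ r in 0..R, f r * landauProfile B l.toNat r * r‖ ^ 2 else 0) := by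
  have hR : 0 < R := hR'.trans hRR
  have hfc : Continuous f := continuous_iff_continuousAt.2 fun r => (hf r).continuousAt
  have hχc := fun l => continuous_landauProfile B l
  -- the real and imaginary parts
  have hre : ∀ r, HasDerivAt (fun r => (f r).re) (f' r).re r := fun r =>
    Complex.reCLM.hasFDerivAt.comp_hasDerivAt r (hf r)
  have him : ∀ r, HasDerivAt (fun r => (f r).im) (f' r).im r := fun r =>
    Complex.imCLM.hasFDerivAt.comp_hasDerivAt r (hf r)
  have hbf' : ∀ r : ℝ, ((r : ℂ) * b r) = ((-(l : ℝ) + B * r ^ 2 / 2 : ℝ) : ℂ) * f r := fun r => by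
    rw [hbf r]; push_cast; ring
  have bre : ∀ r, r * (b r).re = (-(l : ℝ) + B * r ^ 2 / 2) * (f r).re := fun r => by
    have := congrArg Complex.re (hbf' r)
    rwa [Complex.re_ofReal_mul, Complex.re_ofReal_mul] at this
  have bim : ∀ r, r * (b r).im = (-(l : ℝ) + B * r ^ 2 / 2) * (f r).im := fun r => by
    have := congrArg Complex.im (hbf' r)
    rwa [Complex.im_ofReal_mul, Complex.im_ofReal_mul] at this
  -- Regularity at the origin is read off from the relation between b and f at r = 0.
  have zre : (l : ℝ) * (f 0).re = 0 := by have := bre 0; simp at this; simpa using this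
  have zim : (l : ℝ) * (f 0).im = 0 := by have := bim 0; simp at this; simpa using this
  have split : ∀ w : ℂ, ‖w‖ ^ 2 = w.re ^ 2 + w.im ^ 2 := fun w => by
    rw [← Complex.normSq_eq_norm_sq, Complex.normSq_apply]; ring
  have e1 : ∫ r in 0..R, ‖f r‖ ^ 2 * r
      = (∫ r in 0..R, (f r).re ^ 2 * r) + ∫ r in 0..R, (f r).im ^ 2 * r := by
    rw [← intervalIntegral.integral_add (Continuous.intervalIntegrable (by fun_prop) _ _)
      (Continuous.intervalIntegrable (by fun_prop) _ _)]
    simp only [split, add_mul]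
  have e2 : ∫ r in 0..R, (‖f' r‖ ^ 2 + ‖b r‖ ^ 2) * r
      = (∫ r in 0..R, ((f' r).re ^ 2 + (b r).re ^ 2) * r)
        + ∫ r in 0..R, ((f' r).im ^ 2 + (b r).im ^ 2) * r := by
    rw [← intervalIntegral.integral_add (Continuous.intervalIntegrable (by fun_prop) _ _)
      (Continuous.intervalIntegrable (by fun_prop) _ _)]
    congr 1; funext r
    rw [split, split]; ring
  -- Here a ≥ -1 enters: Λ does not exceed the second Landau level 3B, which is the bound available
  -- for all modes below n - 1.
  have hΛ : ∀ I : ℝ, 0 ≤ I → (1 - 2 * a) * B * I ≤ 3 * B * I := fun I hI => by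
    have : (1 - 2 * a) * B ≤ 3 * B := by nlinarith
    exact mul_le_mul_of_nonneg_right this hI
  have nonneg : ∀ g : ℝ → ℝ, 0 ≤ ∫ r in 0..R, g r ^ 2 * r := fun g =>
    intervalIntegral.integral_nonneg hR.le fun r hr => mul_nonneg (sq_nonneg _) hr.1
  have cre : Continuous fun r => (f' r).re := by fun_prop
  have cim : Continuous fun r => (f' r).im := by fun_prop
  have dre : Continuous fun r => (b r).re := by fun_prop
  have dim : Continuous fun r => (b r).im := by fun_prop
  have fR := hfR R hRR.le
  rw [e1, e2, mul_add]
  rcases lt_or_ge l 0 with hl | hl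
  · rw [if_neg (fun h => absurd h.1 (not_le.2 hl)), add_zero]
    have hl1 : (l : ℝ) ≤ -1 := by exact_mod_cast (by omega : l ≤ -1)
    have hl0 : (l : ℝ) ≠ 0 := by linarith
    have k1 := radial_inequality_of_neg hB hR hl1 hre cre dre (fun r _ => bre r)
      ((mul_eq_zero.1 zre).resolve_left hl0) (by rw [fR]; rfl)
    have k2 := radial_inequality_of_neg hB hR hl1 him cim dim (fun r _ => bim r)
      ((mul_eq_zero.1 zim).resolve_left hl0) (by rw [fR]; rfl)
    have n1 := hΛ _ (nonneg fun r => (f r).re)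
    have n2 := hΛ _ (nonneg fun r => (f r).im)
    linarith
  · obtain ⟨k, rfl⟩ := Int.eq_ofNat_of_zero_le hl
    by_cases hk : (k : ℤ) < n - 1
    · rw [if_pos ⟨hl, hk⟩, Int.toNat_natCast]
      simp only [Int.cast_natCast] at bre bim zre zim
      have k1 := radial_gap hB hR hre cre dre (fun r _ => bre r) zre (by rw [fR]; rfl)
      have k2 := radial_gap hB hR him cim dim (fun r _ => bim r) zim (by rw [fR]; rfl)
      have n1 := hΛ _ (nonneg fun r => (f r).re)
      have n2 := hΛ _ (nonneg fun r => (f r).im)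
      have hχ := hχc k
      have hi : IntervalIntegrable (fun r => f r * landauProfile B k r * r) volume 0 R :=
        Continuous.intervalIntegrable (by fun_prop) _ _
      have p1 : (∫ r in 0..R, f r * landauProfile B k r * r).re
          = ∫ r in 0..R, (f r).re * landauProfile B k r * r := by
        have := Complex.reCLM.intervalIntegral_comp_comm hi
        simp only [Complex.reCLM_apply] at this
        rw [← this]
        refine intervalIntegral.integral_congr fun r _ => ?_
        simp only [Complex.re_mul_ofReal]
      have p2 : (∫ r in 0..R, f r * landauProfile B k r * r).im
          = ∫ r in 0..R, (f r).im * landauProfile B k r * r := by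
        have := Complex.imCLM.intervalIntegral_comp_comm hi
        simp only [Complex.imCLM_apply] at this
        rw [← this]
        refine intervalIntegral.integral_congr fun r _ => ?_
        simp only [Complex.im_mul_ofReal]
      rw [split, p1, p2, gapConstant, mul_add]
      linarith
    · rw [if_neg (fun h => hk h.2), add_zero]
      have hk1 : (n : ℝ) ≤ ((k : ℤ) : ℝ) + 1 := by
        have : (n : ℤ) ≤ k + 1 := by omega
        exact_mod_cast this
      have hn1 : (1 : ℝ) ≤ n := by exact_mod_cast hn
      have k1 := radial_inequality_of_kummer hB ha ha' hn1 hk1 hroot hre cre dre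
        (fun r _ => bre r) zre hR' hRR (fun r hr => by rw [hfR r hr]; rfl)
        (fun r hr => by rw [hbR r hr]; rfl) (fun r hr => by rw [hfR' r hr]; rfl)
      have k2 := radial_inequality_of_kummer hB ha ha' hn1 hk1 hroot him cim dim
        (fun r _ => bim r) zim hR' hRR (fun r hr => by rw [hfR r hr]; rfl)
        (fun r hr => by rw [hbR r hr]; rfl) (fun r hr => by rw [hfR' r hr]; rfl)
      linarith

/-- The form inequality in polar coordinates: `ur` is the radial derivative of `u` and `p` its
covariant tangential derivative. -/
theorem polar_inequality {u ur p : ℝ → ℝ → ℂ} {B R a : ℝ} {n : ℕ} (hB : 0 < B)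
    (ha : -1 ≤ a) (ha' : a < 0) (hn : 1 ≤ n) (hroot : kummerM a n (B * R ^ 2 / 2) = 0)
    (hu : Continuous (uncurry u)) (hur : Continuous (uncurry ur)) (hp : Continuous (uncurry p))
    (hdr : ∀ r θ, HasDerivAt (fun r => u r θ) (ur r θ) r)
    (hdθ : ∀ r θ, HasDerivAt (fun θ => u r θ)
      (Complex.I * (r * p r θ - (B * r ^ 2 / 2 : ℝ) * u r θ)) θ)
    (hper : ∀ r, u r (-π) = u r π) {R' : ℝ} (hR' : 0 < R') (hRR : R' < R)
    (huR : ∀ r, R' ≤ r → ∀ θ, u r θ = 0) (hurR : ∀ r, R' ≤ r → ∀ θ, ur r θ = 0)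
    (hpR : ∀ r, R' ≤ r → ∀ θ, p r θ = 0) :
    (1 - 2 * a) * B * ∫ r in 0..R, (∫ θ in (-π)..π, ‖u r θ‖ ^ 2) * r
      ≤ (∫ r in 0..R, (∫ θ in (-π)..π, ‖ur r θ‖ ^ 2 + ‖p r θ‖ ^ 2) * r)
        + 2 * π * ∑ k ∈ Finset.range (n - 1), gapConstant B R k
          * ‖∫ r in 0..R, angularCoeff u k r * landauProfile B k r * r‖ ^ 2 := by
  have hR : 0 < R := hR'.trans hRR
  have zero : ∀ (v : ℝ → ℝ → ℂ), (∀ r, R' ≤ r → ∀ θ, v r θ = 0) → ∀ l r, R' ≤ r →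
      angularCoeff v l r = 0 := fun v hv l r hr => by
    unfold angularCoeff
    simp [hv r hr]
  have hbf : ∀ (l : ℤ) (r : ℝ), r * angularCoeff p l r
      = (-l + B * r ^ 2 / 2) * angularCoeff u l r := by
    intro l r
    have hus := continuous_section hu r
    have hps := continuous_section hp r
    have h1 := angularCoeff_of_hasDerivAt (r := r) (hdθ r) (by fun_prop) (hper r) l
    have h2 : angularCoeff (fun _ θ => Complex.I * (r * p r θ - (B * r ^ 2 / 2 : ℝ) * u r θ)) l r
        = Complex.I * r * angularCoeff p l r
          + -Complex.I * (B * r ^ 2 / 2 : ℝ) * angularCoeff u l r := by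
      rw [← angularCoeff_smul (fun r => Complex.I * r) p,
        ← angularCoeff_smul (fun r => -Complex.I * (B * r ^ 2 / 2 : ℝ)) u,
        ← angularCoeff_add]
      · unfold angularCoeff
        simp only
        congr 2; funext θ; ring
      · exact (by fun_prop : Continuous fun x : ℝ × ℝ => (Complex.I * x.1) * uncurry p x)
      · exact (by fun_prop : Continuous fun x : ℝ × ℝ =>
          (-Complex.I * (B * x.1 ^ 2 / 2 : ℝ)) * uncurry u x)
    rw [h2] at h1
    have h3 : angularCoeff (fun _ => fun θ => u r θ) l r = angularCoeff u l r := rfl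
    rw [h3] at h1
    have hI : Complex.I * Complex.I = -1 := Complex.I_mul_I
    push_cast at h1
    linear_combination (-Complex.I) * h1 + (r * angularCoeff p l r
      - (B * r ^ 2 / 2 - l) * angularCoeff u l r) * hI
  have hmode := fun l : ℤ => mode_inequality (l := l) hB ha ha' hn hroot
    (hasDerivAt_angularCoeff hu hur hdr l) (continuous_angularCoeff hur l)
    (continuous_angularCoeff hp l) (hbf l) hR' hRR (zero u huR l) (zero p hpR l) (zero ur hurR l)
  have s1 := (hasSum_integral_angularCoeff hu hR.le).mul_left ((1 - 2 * a) * B)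
  have s2 := (hasSum_integral_angularCoeff hur hR.le).add (hasSum_integral_angularCoeff hp hR.le)
  set E : ℕ → ℝ := fun k => gapConstant B R k
    * ‖∫ r in 0..R, angularCoeff u k r * landauProfile B k r * r‖ ^ 2 with hE
  set D : ℤ → ℝ := fun l => if 0 ≤ l ∧ l < n - 1 then gapConstant B R l.toNat
          * ‖∫ r in 0..R, angularCoeff u l r * landauProfile B l.toNat r * r‖ ^ 2 else 0 with hD
  -- The correction is present only for the finitely many modes 0 ≤ l < n - 1. The bound is an
  -- integer difference in `D` and truncated subtraction in `Finset.range`; since n ≥ 1 the two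
  -- agree.
  have s3 : HasSum D (∑ k ∈ Finset.range (n - 1), E k) := by
    have hinj : Function.Injective (Nat.cast : ℕ → ℤ) := Nat.cast_injective
    rw [← hinj.hasSum_iff]
    · have : ∑ k ∈ Finset.range (n - 1), E k
          = ∑ k ∈ Finset.range (n - 1), (D ∘ (Nat.cast : ℕ → ℤ)) k := by
        refine Finset.sum_congr rfl fun k hk => ?_
        have hk := Finset.mem_range.1 hk
        have : 0 ≤ (k : ℤ) ∧ (k : ℤ) < n - 1 := ⟨by positivity, by omega⟩
        simp only [comp_apply, hD, if_pos this, Int.toNat_natCast, hE]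
      rw [this]
      refine hasSum_sum_of_ne_finset_zero fun k hk => ?_
      have hk : ¬ k < n - 1 := fun h => hk (Finset.mem_range.2 h)
      simp only [comp_apply, hD]
      rw [if_neg]
      rintro ⟨_, h⟩
      omega
    · intro l hl
      simp only [hD]
      rw [if_neg]
      rintro ⟨h, _⟩
      exact hl ⟨l.toNat, Int.toNat_of_nonneg h⟩
  have key := hasSum_le (fun l => ?_) s1 (s2.add s3)
  · have e : ∫ r in 0..R, (∫ θ in (-π)..π, ‖ur r θ‖ ^ 2 + ‖p r θ‖ ^ 2) * r
        = (∫ r in 0..R, (∫ θ in (-π)..π, ‖ur r θ‖ ^ 2) * r)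
          + ∫ r in 0..R, (∫ θ in (-π)..π, ‖p r θ‖ ^ 2) * r := by
      have c1 : Continuous fun r => ∫ θ in (-π)..π, ‖ur r θ‖ ^ 2 :=
        intervalIntegral.continuous_parametric_intervalIntegral_of_continuous'
          (f := fun r θ => ‖ur r θ‖ ^ 2)
          (by exact (by fun_prop : Continuous fun p : ℝ × ℝ => ‖uncurry ur p‖ ^ 2)) _ _
      have c2 : Continuous fun r => ∫ θ in (-π)..π, ‖p r θ‖ ^ 2 :=
        intervalIntegral.continuous_parametric_intervalIntegral_of_continuous'
          (f := fun r θ => ‖p r θ‖ ^ 2)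
          (by exact (by fun_prop : Continuous fun x : ℝ × ℝ => ‖uncurry p x‖ ^ 2)) _ _
      rw [← intervalIntegral.integral_add (Continuous.intervalIntegrable (by fun_prop) _ _)
        (Continuous.intervalIntegrable (by fun_prop) _ _)]
      refine intervalIntegral.integral_congr fun r _ => ?_
      have := continuous_section hur r
      have := continuous_section hp r
      rw [intervalIntegral.integral_add (Continuous.intervalIntegrable (by fun_prop) _ _)
        (Continuous.intervalIntegrable (by fun_prop) _ _), add_mul]
    rw [e]
    have hpi : 0 < 2 * π := by positivity
    have := mul_le_mul_of_nonneg_left key hpi.le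
    have e3 : 2 * π * (1 / (2 * π)) = 1 := by field_simp
    linear_combination this + ((1 - 2 * a) * B * (∫ r in 0..R, (∫ θ in (-π)..π, ‖u r θ‖ ^ 2) * r)
      - (∫ r in 0..R, (∫ θ in (-π)..π, ‖ur r θ‖ ^ 2) * r)
      - (∫ r in 0..R, (∫ θ in (-π)..π, ‖p r θ‖ ^ 2) * r)) * (-e3)
  · have c1 := continuous_angularCoeff hur l
    have c2 := continuous_angularCoeff hp l
    have := hmode l
    rw [← intervalIntegral.integral_add (Continuous.intervalIntegrable (by fun_prop) _ _)
      (Continuous.intervalIntegrable (by fun_prop) _ _)]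
    simpa only [add_mul] using this

end Angular

/-! ### Polar coordinates, gauge recentring, and the inequality for test functions. -/

section PolarPlane
open Real Function

/-- The first (`j = 0`) and second (`j = 1`) coordinate vectors of the plane. -/
noncomputable abbrev planeBasis (j : Fin 2) : Plane := EuclideanSpace.single j (1 : ℝ)

/-- The point with polar coordinates `(r, θ)` around `c`. -/
noncomputable def polarPoint (c : Plane) (r θ : ℝ) : Plane :=
  c + ((r * cos θ) • planeBasis 0 + (r * sin θ) • planeBasis 1)

@[simp] theorem polarPoint_zero (c : Plane) (r θ : ℝ) : polarPoint c r θ 0 = c 0 + r * cos θ := by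
  simp [polarPoint]

@[simp] theorem polarPoint_one (c : Plane) (r θ : ℝ) : polarPoint c r θ 1 = c 1 + r * sin θ := by
  simp [polarPoint]

theorem dist_plane_sq (x y : Plane) : dist x y ^ 2 = (x 0 - y 0) ^ 2 + (x 1 - y 1) ^ 2 := by
  rw [EuclideanSpace.dist_eq, Real.sq_sqrt (by positivity)]
  simp [Fin.sum_univ_two, Real.dist_eq, sq_abs]

theorem dist_polarPoint (c : Plane) (r θ : ℝ) : dist (polarPoint c r θ) c = |r| := by
  have h := dist_plane_sq (polarPoint c r θ) c
  rw [polarPoint_zero, polarPoint_one] at h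
  have h2 : dist (polarPoint c r θ) c ^ 2 = |r| ^ 2 := by
    rw [h, sq_abs]; linear_combination r ^ 2 * sin_sq_add_cos_sq θ
  exact (pow_left_inj₀ dist_nonneg (abs_nonneg r) two_ne_zero).1 h2

theorem continuous_polarPoint (c : Plane) : Continuous (uncurry (polarPoint c)) := by
  unfold polarPoint
  simp only [uncurry_def]
  fun_prop

theorem measurePreserving_planeCoord (c : Plane) :
    MeasurePreserving (fun p : ℝ × ℝ => c + (p.1 • planeBasis 0 + p.2 • planeBasis 1)) := by
  have h1 : MeasurePreserving (MeasurableEquiv.finTwoArrow (α := ℝ)).symm volume volume :=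
    (volume_preserving_finTwoArrow ℝ).symm _
  have h2 := (measurePreserving_add_left (volume : Measure Plane) c).comp
    ((PiLp.volume_preserving_toLp (Fin 2)).comp h1)
  have e : (fun p : ℝ × ℝ => c + (p.1 • planeBasis 0 + p.2 • planeBasis 1))
      = (fun x => c + x) ∘ WithLp.toLp 2 ∘ (MeasurableEquiv.finTwoArrow (α := ℝ)).symm := by
    funext p
    ext j
    fin_cases j <;> simp [MeasurableEquiv.finTwoArrow]
  rw [e]
  exact h2

theorem measurableEmbedding_planeCoord (c : Plane) :
    MeasurableEmbedding (fun p : ℝ × ℝ => c + (p.1 • planeBasis 0 + p.2 • planeBasis 1)) := by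
  refine Continuous.measurableEmbedding (by fun_prop) fun p q h => ?_
  have h0 := congrArg (fun x : Plane => x 0) h
  have h1 := congrArg (fun x : Plane => x 1) h
  simp at h0 h1
  exact Prod.ext h0 h1

/-- After transport to ℝ × ℝ, the indicator of the ball cuts the target of `polarCoord` down to a
bounded rectangle, where continuity makes Fubini available. -/
theorem setIntegral_ball_eq_polar {E : Type*} [NormedAddCommGroup E] [NormedSpace ℝ E]
    {h : Plane → E} (hh : Continuous h) (c : Plane) {R : ℝ} (hR : 0 ≤ R) :
    ∫ x in Metric.ball c R, h x
      = ∫ r in 0..R, r • ∫ θ in (-π)..π, h (polarPoint c r θ) := by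
  have e1 : ∫ x in Metric.ball c R, h x = ∫ p : ℝ × ℝ,
      (Metric.ball c R).indicator h (c + (p.1 • planeBasis 0 + p.2 • planeBasis 1)) := by
    rw [(measurePreserving_planeCoord c).integral_comp (measurableEmbedding_planeCoord c)
      ((Metric.ball c R).indicator h), integral_indicator Metric.isOpen_ball.measurableSet]
  have hsub : Set.Ioo 0 R ×ˢ Set.Ioo (-π) π ⊆ polarCoord.target :=
    Set.prod_mono (fun x hx => hx.1) subset_rfl
  have e2 : ∀ p : ℝ × ℝ, c + ((polarCoord.symm p).1 • planeBasis 0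
      + (polarCoord.symm p).2 • planeBasis 1) = polarPoint c p.1 p.2 := fun p => rfl
  rw [e1, ← integral_comp_polarCoord_symm]
  simp only [e2]
  have hm : MeasurableSet (Set.Ioo 0 R ×ˢ Set.Ioo (-π) π) := measurableSet_Ioo.prod measurableSet_Ioo
  have hcont : Continuous fun p : ℝ × ℝ => p.1 • h (polarPoint c p.1 p.2) :=
    continuous_fst.smul (hh.comp (continuous_polarPoint c))
  have e3 := setIntegral_eq_of_subset_of_forall_sdiff_eq_zero (μ := volume)
    (f := fun p : ℝ × ℝ => p.1 • (Metric.ball c R).indicator h (polarPoint c p.1 p.2))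
    polarCoord.open_target.measurableSet hsub ?_
  · rw [e3, setIntegral_congr_fun hm (g := fun p => p.1 • h (polarPoint c p.1 p.2)) fun p hp => ?_]
    · rw [Measure.volume_eq_prod, setIntegral_prod]
      · rw [intervalIntegral.integral_of_le hR, integral_Ioc_eq_integral_Ioo]
        refine setIntegral_congr_fun measurableSet_Ioo fun r hr => ?_
        simp only
        rw [intervalIntegral.integral_of_le (by linarith [pi_pos]), integral_Ioc_eq_integral_Ioo,
          ← integral_smul]
      · exact (hcont.continuousOn.integrableOn_compact (isCompact_Icc.prod isCompact_Icc)).mono_set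
          (Set.prod_mono Set.Ioo_subset_Icc_self Set.Ioo_subset_Icc_self)
    · have : polarPoint c p.1 p.2 ∈ Metric.ball c R := by
        rw [Metric.mem_ball, dist_polarPoint, abs_of_pos hp.1.1]; exact hp.1.2
      simp only [Set.indicator_of_mem this]
  · rintro p ⟨hp, hp'⟩
    have : polarPoint c p.1 p.2 ∉ Metric.ball c R := by
      rw [Metric.mem_ball, dist_polarPoint, abs_of_pos hp.1]
      exact fun h => hp' ⟨⟨hp.1, h⟩, hp.2⟩
    simp [Set.indicator_of_notMem this]

theorem fderiv_apply_plane (φ : Plane → ℂ) (x : Plane) (a b : ℝ) :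
    fderiv ℝ φ x (a • planeBasis 0 + b • planeBasis 1)
      = a * fderiv ℝ φ x (planeBasis 0) + b * fderiv ℝ φ x (planeBasis 1) := by
  rw [map_add, map_smul, map_smul, Complex.real_smul, Complex.real_smul]

/-- The phase `A(c) · (x - c)` which recentres the vector potential at `c`. -/
noncomputable def gaugePhase (B : ℝ) (c x : Plane) : ℝ :=
  B / 2 * (c 0 * (x 1 - c 1) - c 1 * (x 0 - c 0))

/-- The gauge factor `exp (i A(c) · (x - c))`. -/
noncomputable def gaugeFactor (B : ℝ) (c x : Plane) : ℂ := Complex.exp (Complex.I * gaugePhase B c x)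

theorem norm_gaugeFactor (B : ℝ) (c x : Plane) : ‖gaugeFactor B c x‖ = 1 := by
  rw [gaugeFactor, mul_comm, Complex.norm_exp_ofReal_mul_I]

theorem continuous_gaugePhase (B : ℝ) (c : Plane) : Continuous (gaugePhase B c) := by
  unfold gaugePhase; fun_prop

theorem continuous_gaugeFactor (B : ℝ) (c : Plane) : Continuous (gaugeFactor B c) := by
  have := continuous_gaugePhase B c
  unfold gaugeFactor; fun_prop

theorem gaugePhase_polarPoint (B : ℝ) (c : Plane) (r θ : ℝ) :
    gaugePhase B c (polarPoint c r θ) = r * (B / 2 * (c 0 * sin θ - c 1 * cos θ)) := by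
  rw [gaugePhase, polarPoint_zero, polarPoint_one]; ring

/-- The coordinate `(x₁ - c₁) + i (x₂ - c₂)`. -/
noncomputable def complexCoord (c x : Plane) : ℂ := (x 0 - c 0 : ℝ) + Complex.I * (x 1 - c 1 : ℝ)

/-- The square of the distance to `c`. -/
noncomputable def distSq (c x : Plane) : ℝ := (x 0 - c 0) ^ 2 + (x 1 - c 1) ^ 2

theorem complexCoord_polarPoint (c : Plane) (r θ : ℝ) :
    complexCoord c (polarPoint c r θ) = r * Complex.exp (Complex.I * θ) := by
  rw [complexCoord, polarPoint_zero, polarPoint_one, mul_comm Complex.I (θ : ℂ), Complex.exp_mul_I]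
  push_cast; ring

theorem distSq_polarPoint (c : Plane) (r θ : ℝ) : distSq c (polarPoint c r θ) = r ^ 2 := by
  rw [distSq, polarPoint_zero, polarPoint_one]
  linear_combination r ^ 2 * sin_sq_add_cos_sq θ

/-- The function `conj (g wˡ) G(|x - c|²)` of angular momentum `-l` around `c`. -/
noncomputable def angularMode (B : ℝ) (c : Plane) (l : ℕ) (G : ℝ → ℝ) (x : Plane) : ℂ :=
  starRingEnd ℂ (gaugeFactor B c x * complexCoord c x ^ l) * (G (distSq c x) : ℝ)

theorem continuous_angularMode (B : ℝ) (c : Plane) (l : ℕ) {G : ℝ → ℝ} (hG : Continuous G) :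
    Continuous (angularMode B c l G) := by
  have h1 := continuous_gaugeFactor B c
  have h2 : Continuous (complexCoord c) := by unfold complexCoord; fun_prop
  have h3 : Continuous (distSq c) := by unfold distSq; fun_prop
  unfold angularMode
  exact (Complex.continuous_conj.comp (h1.mul (h2.pow l))).mul
    (Complex.continuous_ofReal.comp (hG.comp h3))

/-- The lowest Landau level wave function of angular momentum `-l` around `c`. -/
noncomputable def landauMode (B : ℝ) (c : Plane) (l : ℕ) : Plane → ℂ :=
  angularMode B c l fun s => Real.exp (-(B * s / 4))

theorem continuous_landauMode (B : ℝ) (c : Plane) (l : ℕ) : Continuous (landauMode B c l) :=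
  continuous_angularMode B c l (by fun_prop)

theorem continuous_vectorPotential (B : ℝ) (j : Fin 2) :
    Continuous fun x => vectorPotential B x j := by
  fin_cases j
  · exact (by simpa [vectorPotential] using by fun_prop :
      Continuous fun x : Plane => vectorPotential B x 0)
  · exact (by simpa [vectorPotential] using by fun_prop :
      Continuous fun x : Plane => vectorPotential B x 1)

theorem magneticGradient_apply (B : ℝ) (φ : Plane → ℂ) (x : Plane) (j : Fin 2) :
    magneticGradient B φ x j
      = -Complex.I * fderiv ℝ φ x (planeBasis j) + (vectorPotential B x j : ℂ) * φ x := rfl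

theorem continuous_magneticGradient {B : ℝ} {φ : Plane → ℂ} (hφ : ContDiff ℝ 1 φ) :
    Continuous (magneticGradient B φ) := by
  have h1 : Continuous (fderiv ℝ φ) := hφ.continuous_fderiv one_ne_zero
  have h2 := hφ.continuous
  refine (PiLp.continuous_toLp 2 _).comp (continuous_pi fun j => ?_)
  have h3 := continuous_vectorPotential B j
  fun_prop

theorem norm_magneticGradient_sq (B : ℝ) (φ : Plane → ℂ) (x : Plane) :
    ‖magneticGradient B φ x‖ ^ 2
      = ‖magneticGradient B φ x 0‖ ^ 2 + ‖magneticGradient B φ x 1‖ ^ 2 := by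
  rw [EuclideanSpace.norm_sq_eq, Fin.sum_univ_two]

theorem norm_sq_rotate (z w : ℂ) (θ : ℝ) :
    ‖(cos θ : ℂ) * z + (sin θ : ℂ) * w‖ ^ 2 + ‖-(sin θ : ℂ) * z + (cos θ : ℂ) * w‖ ^ 2
      = ‖z‖ ^ 2 + ‖w‖ ^ 2 := by
  simp only [← Complex.normSq_eq_norm_sq, Complex.normSq_apply, ← Complex.ofReal_neg, Complex.add_re, Complex.add_im,
    Complex.re_ofReal_mul, Complex.im_ofReal_mul]
  linear_combination (z.re ^ 2 + z.im ^ 2 + w.re ^ 2 + w.im ^ 2) * sin_sq_add_cos_sq θ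

theorem vectorPotential_zero (B : ℝ) (x : Plane) : vectorPotential B x 0 = -(B / 2) * x 1 := rfl
theorem vectorPotential_one (B : ℝ) (x : Plane) : vectorPotential B x 1 = B / 2 * x 0 := rfl

/-- The form inequality on test functions. -/
theorem test_inequality {c : Plane} {B R a : ℝ} {n : ℕ} (hB : 0 < B) (hR : 0 < R)
    (ha : -1 ≤ a) (ha' : a < 0) (hn : 1 ≤ n) (hroot : kummerM a n (B * R ^ 2 / 2) = 0)
    {φ : Plane → ℂ} (hφ : IsTestFunction (Metric.ball c R) φ) :
    (1 - 2 * a) * B * ∫ x in Metric.ball c R, ‖φ x‖ ^ 2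
      ≤ (∫ x in Metric.ball c R, ‖magneticGradient B φ x‖ ^ 2)
        + ∑ k ∈ Finset.range (n - 1), (1 / (2 * π) * gapConstant B R k)
          * ‖∫ x in Metric.ball c R, starRingEnd ℂ (landauMode B c k x) * φ x‖ ^ 2 := by
  obtain ⟨hsm, -, hsupp⟩ := hφ
  have hφc := hsm.continuous
  have hgc : Continuous (magneticGradient B φ) := continuous_magneticGradient (hsm.of_le (by simp))
  -- Compact support in the open disk leaves a margin, which keeps all modes away from the
  -- singularity of η at R.
  obtain ⟨R', ⟨hR', hRR⟩, hsub⟩ := exists_pos_lt_subset_ball hR (isClosed_tsupport φ) hsupp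
  have hout : ∀ r, R' ≤ r → ∀ θ, polarPoint c r θ ∉ tsupport φ := fun r hr θ h => by
    have := hsub h
    rw [Metric.mem_ball, dist_polarPoint, abs_of_pos (hR'.trans_le hr)] at this
    linarith
  have hout1 : ∀ r, R' ≤ r → ∀ θ, φ (polarPoint c r θ) = 0 := fun r hr θ =>
    image_eq_zero_of_notMem_tsupport (hout r hr θ)
  have hout2 : ∀ r, R' ≤ r → ∀ θ j, magneticGradient B φ (polarPoint c r θ) j = 0 :=
    fun r hr θ j => by
      have h0 : fderiv ℝ φ (polarPoint c r θ) = 0 :=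
        image_eq_zero_of_notMem_tsupport (f := fderiv ℝ φ)
          fun h => hout r hr θ (tsupport_fderiv_subset ℝ h)
      rw [magneticGradient_apply, hout1 r hr θ, h0]; simp
  -- A is linear, so multiplication by g = exp(i A(c)·(x - c)) replaces A(x) by A(x - c): the disk
  -- may be treated as centred at 0. Since A(x - c) is tangential, the radial component of the
  -- magnetic gradient is -i ∂_r u up to the phase g; p is the tangential component.
  set g : ℝ → ℝ → ℂ := fun r θ => gaugeFactor B c (polarPoint c r θ) with hg
  set u : ℝ → ℝ → ℂ := fun r θ => g r θ * φ (polarPoint c r θ) with hu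
  set ur : ℝ → ℝ → ℂ := fun r θ => Complex.I * g r θ *
    ((cos θ : ℂ) * magneticGradient B φ (polarPoint c r θ) 0
      + (sin θ : ℂ) * magneticGradient B φ (polarPoint c r θ) 1) with hur
  set p : ℝ → ℝ → ℂ := fun r θ => g r θ *
    (-(sin θ : ℂ) * magneticGradient B φ (polarPoint c r θ) 0
      + (cos θ : ℂ) * magneticGradient B φ (polarPoint c r θ) 1) with hp
  have hpc := continuous_polarPoint c
  have cg : Continuous (uncurry g) := (continuous_gaugeFactor B c).comp hpc
  have cφ : Continuous fun x : ℝ × ℝ => φ (uncurry (polarPoint c) x) := hφc.comp hpc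
  have cG : ∀ j, Continuous fun x : ℝ × ℝ => magneticGradient B φ (uncurry (polarPoint c) x) j :=
    fun j => (continuous_apply j).comp ((PiLp.continuous_ofLp 2 _).comp (hgc.comp hpc))
  have cG0 := cG 0
  have cG1 := cG 1
  have cu : Continuous (uncurry u) := cg.mul cφ
  have cur : Continuous (uncurry ur) := by
    exact (by fun_prop : Continuous fun x : ℝ × ℝ => Complex.I * uncurry g x *
      ((cos x.2 : ℂ) * magneticGradient B φ (uncurry (polarPoint c) x) 0
      + (sin x.2 : ℂ) * magneticGradient B φ (uncurry (polarPoint c) x) 1))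
  have cp : Continuous (uncurry p) := by
    exact (by fun_prop : Continuous fun x : ℝ × ℝ => uncurry g x *
      (-(sin x.2 : ℂ) * magneticGradient B φ (uncurry (polarPoint c) x) 0
      + (cos x.2 : ℂ) * magneticGradient B φ (uncurry (polarPoint c) x) 1))
  have hfd : ∀ x, HasFDerivAt φ (fderiv ℝ φ x) x := fun x =>
    (hsm.differentiable (by simp) x).hasFDerivAt
  have hdr : ∀ r θ, HasDerivAt (fun r => u r θ) (ur r θ) r := by
    intro r θ
    have d1 : HasDerivAt (fun r => polarPoint c r θ)
        (cos θ • planeBasis 0 + sin θ • planeBasis 1) r := by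
      unfold polarPoint
      have h1 : HasDerivAt (fun r : ℝ => r * cos θ) (1 * cos θ) r := (hasDerivAt_id' r).mul_const _
      have h2 : HasDerivAt (fun r : ℝ => r * sin θ) (1 * sin θ) r := (hasDerivAt_id' r).mul_const _
      rw [one_mul] at h1 h2
      exact ((h1.smul_const _).add (h2.smul_const _)).const_add c
    have d2 := (hfd (polarPoint c r θ)).comp_hasDerivAt r d1
    rw [fderiv_apply_plane] at d2
    have d3 : HasDerivAt (fun r => g r θ)
        (g r θ * (Complex.I * (B / 2 * (c 0 * sin θ - c 1 * cos θ) : ℝ))) r := by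
      simp only [hg, gaugeFactor, gaugePhase_polarPoint]
      have h1 : HasDerivAt (fun r : ℝ => ((r * (B / 2 * (c 0 * sin θ - c 1 * cos θ)) : ℝ) : ℂ))
          ((1 * (B / 2 * (c 0 * sin θ - c 1 * cos θ)) : ℝ) : ℂ) r :=
        ((hasDerivAt_id' r).mul_const _).ofReal_comp
      rw [one_mul] at h1
      exact (h1.const_mul Complex.I).cexp
    refine (d3.mul d2).congr_deriv ?_
    simp only [hur, magneticGradient_apply, vectorPotential_zero, vectorPotential_one,
      polarPoint_zero, polarPoint_one, comp_apply]
    push_cast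
    linear_combination (g r θ * (Complex.cos θ * fderiv ℝ φ (polarPoint c r θ) (planeBasis 0)
      + Complex.sin θ * fderiv ℝ φ (polarPoint c r θ) (planeBasis 1))) * Complex.I_mul_I
  have hdθ : ∀ r θ, HasDerivAt (fun θ => u r θ)
      (Complex.I * (r * p r θ - (B * r ^ 2 / 2 : ℝ) * u r θ)) θ := by
    intro r θ
    have d1 : HasDerivAt (fun θ => polarPoint c r θ)
        ((r * -sin θ) • planeBasis 0 + (r * cos θ) • planeBasis 1) θ := by
      unfold polarPoint
      exact ((((hasDerivAt_cos θ).const_mul r).smul_const _).add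
        (((hasDerivAt_sin θ).const_mul r).smul_const _)).const_add c
    have d2 := (hfd (polarPoint c r θ)).comp_hasDerivAt θ d1
    rw [fderiv_apply_plane] at d2
    have d3 : HasDerivAt (fun θ => g r θ)
        (g r θ * (Complex.I * (r * (B / 2 * (c 0 * cos θ - c 1 * -sin θ)) : ℝ))) θ := by
      simp only [hg, gaugeFactor, gaugePhase_polarPoint]
      have h1 : HasDerivAt (fun θ : ℝ => ((r * (B / 2 * (c 0 * sin θ - c 1 * cos θ)) : ℝ) : ℂ))
          ((r * (B / 2 * (c 0 * cos θ - c 1 * -sin θ)) : ℝ) : ℂ) θ :=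
        (((((hasDerivAt_sin θ).const_mul (c 0)).sub
          ((hasDerivAt_cos θ).const_mul (c 1))).const_mul (B / 2)).const_mul r).ofReal_comp
      exact (h1.const_mul Complex.I).cexp
    refine (d3.mul d2).congr_deriv ?_
    have hcs : (sin θ : ℂ) ^ 2 + (cos θ : ℂ) ^ 2 = 1 := by
      exact_mod_cast sin_sq_add_cos_sq θ
    simp only [hp, hu, magneticGradient_apply, vectorPotential_zero, vectorPotential_one,
      polarPoint_zero, polarPoint_one, comp_apply]
    push_cast at hcs ⊢
    linear_combination (g r θ * r * (-Complex.sin θ * fderiv ℝ φ (polarPoint c r θ) (planeBasis 0)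
      + Complex.cos θ * fderiv ℝ φ (polarPoint c r θ) (planeBasis 1))) * Complex.I_mul_I
      - (Complex.I * g r θ * φ (polarPoint c r θ) * (B * r ^ 2 / 2)) * hcs
  have hper : ∀ r, u r (-π) = u r π := by
    intro r
    have : polarPoint c r (-π) = polarPoint c r π := by simp [polarPoint]
    simp only [hu, hg, this]
  have key := polar_inequality hB ha ha' hn hroot cu cur cp hdr hdθ hper hR' hRR
    (fun r hr θ => by simp only [hu, hout1 r hr θ, mul_zero])
    (fun r hr θ => by simp only [hur, hout2 r hr θ]; simp)
    (fun r hr θ => by simp only [hp, hout2 r hr θ]; simp)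
  have hng : ∀ r θ, ‖g r θ‖ = 1 := fun r θ => norm_gaugeFactor _ _ _
  have e1 : ∫ x in Metric.ball c R, ‖φ x‖ ^ 2 = ∫ r in 0..R, (∫ θ in (-π)..π, ‖u r θ‖ ^ 2) * r := by
    rw [setIntegral_ball_eq_polar (by fun_prop) c hR.le]
    refine intervalIntegral.integral_congr fun r _ => ?_
    simp only [hu, norm_mul, hng, one_mul]
    rw [smul_eq_mul, mul_comm]
  have e2 : ∫ x in Metric.ball c R, ‖magneticGradient B φ x‖ ^ 2
      = ∫ r in 0..R, (∫ θ in (-π)..π, ‖ur r θ‖ ^ 2 + ‖p r θ‖ ^ 2) * r := by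
    rw [setIntegral_ball_eq_polar (by fun_prop) c hR.le]
    refine intervalIntegral.integral_congr fun r _ => ?_
    rw [smul_eq_mul, mul_comm]
    congr 1
    refine intervalIntegral.integral_congr fun θ _ => ?_
    simp only [hur, hp, norm_mul, hng, one_mul, Complex.norm_I]
    rw [norm_sq_rotate, norm_magneticGradient_sq]
  -- The conjugate in `angularMode` makes the inner product integrate g wᵏ φ, whose factor e^{ikθ}
  -- extracts the coefficient of e^{-ikθ} in u = gφ.
  have e3 : ∀ k : ℕ, ∫ r in 0..R, angularCoeff u k r * landauProfile B k r * r
      = (1 / (2 * π) : ℝ) • ∫ x in Metric.ball c R, starRingEnd ℂ (landauMode B c k x) * φ x := by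
    intro k
    have := continuous_landauMode B c k
    rw [setIntegral_ball_eq_polar (by fun_prop) c hR.le, ← intervalIntegral.integral_smul]
    refine intervalIntegral.integral_congr fun r _ => ?_
    simp only [angularCoeff]
    rw [smul_mul_assoc, smul_mul_assoc]
    refine congrArg (fun z : ℂ => (1 / (2 * π) : ℝ) • z) ?_
    rw [Complex.real_smul, mul_comm, mul_comm _ (landauProfile B k r : ℂ),
      ← intervalIntegral.integral_const_mul]
    refine congrArg (fun z : ℂ => (r : ℂ) * z) ?_
    refine intervalIntegral.integral_congr fun θ _ => ?_
    simp only [landauMode, angularMode, map_mul, Complex.conj_conj, Complex.conj_ofReal,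
      complexCoord_polarPoint, distSq_polarPoint, landauProfile, hu, hg, mul_pow]
    rw [← Complex.exp_nat_mul]
    push_cast
    rw [show (k : ℂ) * (Complex.I * θ) = Complex.I * k * θ by ring]
    ring
  rw [e1, e2]
  refine key.trans_eq ?_
  congr 1
  rw [Finset.mul_sum]
  refine Finset.sum_congr rfl fun k _ => ?_
  rw [e3, norm_smul, Real.norm_of_nonneg (by positivity), mul_pow]
  field_simp

end PolarPlane

/-! ### The closed form and the upper bound on the eigenvalue count. -/

section Form

theorem memLp_ball {E : Type*} [NormedAddCommGroup E] [SecondCountableTopology E]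
    {h : Plane → E} (hh : Continuous h) (c : Plane) (R : ℝ) :
    MemLp h 2 (volume.restrict (Metric.ball c R)) := by
  obtain ⟨M, hM⟩ := (isCompact_closedBall c R).exists_bound_of_continuousOn hh.continuousOn
  have : IsFiniteMeasure (volume.restrict (Metric.ball c R)) :=
    ⟨by rw [Measure.restrict_apply_univ]; exact measure_ball_lt_top⟩
  refine MemLp.of_bound hh.aestronglyMeasurable M ?_
  filter_upwards [ae_restrict_mem Metric.isOpen_ball.measurableSet] with x hx
  exact hM x (Metric.ball_subset_closedBall hx)

theorem ofReal_norm_sq {E : Type*} [NormedAddCommGroup E] [InnerProductSpace ℂ E] (x : E) :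
    ((‖x‖ ^ 2 : ℝ) : ℂ) = inner ℂ x x := by
  refine Eq.trans ?_ (inner_self_eq_norm_sq_to_K (𝕜 := ℂ) x).symm
  push_cast
  rfl

theorem L2_norm_sq_eq {E : Type*} [NormedAddCommGroup E] [InnerProductSpace ℂ E]
    {μ : Measure Plane} {f : Lp E 2 μ} {g : Plane → E} (h : f =ᵐ[μ] g) :
    ‖f‖ ^ 2 = ∫ x, ‖g x‖ ^ 2 ∂μ := by
  have h1 : ((‖f‖ ^ 2 : ℝ) : ℂ) = ((∫ x, ‖g x‖ ^ 2 ∂μ : ℝ) : ℂ) := by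
    rw [← integral_complex_ofReal, ofReal_norm_sq, L2.inner_def]
    refine integral_congr_ae ?_
    filter_upwards [h] with x hx
    rw [hx, ofReal_norm_sq]
  exact_mod_cast h1

theorem L2_inner_eq {μ : Measure Plane} {f f' : Lp ℂ 2 μ} {g g' : Plane → ℂ} (h : f =ᵐ[μ] g)
    (h' : f' =ᵐ[μ] g') : inner ℂ f f' = ∫ x, starRingEnd ℂ (g x) * g' x ∂μ := by
  rw [L2.inner_def]
  refine integral_congr_ae ?_
  filter_upwards [h, h'] with x hx hx'
  rw [hx, hx', RCLike.inner_apply, mul_comm]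

/-- The lowest Landau level wave functions in `L²` of the disk. -/
noncomputable def landauVector (B : ℝ) (c : Plane) (R : ℝ) (l : ℕ) : L2Scalar (Metric.ball c R) :=
  (memLp_ball (continuous_landauMode B c l) c R).toLp

variable {c : Plane} {B R a : ℝ} {n : ℕ}

/-- Both sides are continuous in the pair (u, G), so the inequality passes from test functions to
the closure of their graph. -/
theorem form_inequality (hB : 0 < B) (hR : 0 < R) (ha : -1 ≤ a) (ha' : a < 0) (hn : 1 ≤ n)
    (hroot : kummerM a n (B * R ^ 2 / 2) = 0)
    {q : L2Scalar (Metric.ball c R) × L2Vector (Metric.ball c R)}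
    (hq : q ∈ formGraph (Metric.ball c R) B) :
    (1 - 2 * a) * B * ‖q.1‖ ^ 2 ≤ ‖q.2‖ ^ 2
      + ∑ k ∈ Finset.range (n - 1), (1 / (2 * Real.pi) * gapConstant B R k)
          * ‖inner ℂ (landauVector B c R k) q.1‖ ^ 2 := by
  have hclosed : IsClosed {q : L2Scalar (Metric.ball c R) × L2Vector (Metric.ball c R) |
      (1 - 2 * a) * B * ‖q.1‖ ^ 2 ≤ ‖q.2‖ ^ 2
      + ∑ k ∈ Finset.range (n - 1), (1 / (2 * Real.pi) * gapConstant B R k)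
          * ‖inner ℂ (landauVector B c R k) q.1‖ ^ 2} :=
    isClosed_le (by fun_prop) (by fun_prop)
  refine closure_minimal (s := (testGraph (Metric.ball c R) B :
    Set (L2Scalar (Metric.ball c R) × L2Vector (Metric.ball c R)))) ?_ hclosed hq
  rintro p ⟨φ, hφ, h1, h2⟩
  have key := test_inequality (c := c) hB hR ha ha' hn hroot hφ
  rw [Set.mem_ofPred_eq, L2_norm_sq_eq h1, L2_norm_sq_eq h2]
  simp only [L2_inner_eq (MemLp.coeFn_toLp _) h1, landauVector]
  exact key

theorem inner_eq_of_mem_formGraph {Ω : Set Plane} {f : L2Scalar Ω} {G : L2Vector Ω}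
    (h : ∀ q ∈ testGraph Ω B, inner ℂ q.2 G = inner ℂ q.1 f)
    {q : L2Scalar Ω × L2Vector Ω} (hq : q ∈ formGraph Ω B) : inner ℂ q.2 G = inner ℂ q.1 f := by
  have hclosed : IsClosed {q : L2Scalar Ω × L2Vector Ω | inner ℂ q.2 G = inner ℂ q.1 f} :=
    isClosed_eq (by fun_prop) (by fun_prop)
  exact closure_minimal (s := (testGraph Ω B : Set (L2Scalar Ω × L2Vector Ω)))
    (fun p hp => h p hp) hclosed hq

/-- A vector in the span of the eigenspaces up to `s` satisfies `a[u] ≤ s ‖u‖²`. -/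
theorem exists_form_le_of_mem_iSup {Ω : Set Plane} {s : ℝ} {u : L2Scalar Ω}
    (hu : u ∈ ⨆ μ ∈ Set.Iic s, magneticEigenspace Ω B μ) :
    ∃ G : L2Vector Ω, (u, G) ∈ formGraph Ω B ∧ ‖G‖ ^ 2 ≤ s * ‖u‖ ^ 2 := by
  rw [iSup_subtype', Submodule.mem_iSup_iff_exists_finsupp] at hu
  obtain ⟨f, hf, rfl⟩ := hu
  have hf' : ∀ i : Set.Iic s, ∃ G : L2Vector Ω, (f i, G) ∈ formGraph Ω B ∧
      ∀ q ∈ formGraph Ω B, inner ℂ q.2 G = ((i : ℝ) : ℂ) * inner ℂ q.1 (f i) := by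
    intro i
    obtain ⟨G, hG, h⟩ := hf i
    refine ⟨G, hG, fun q hq => ?_⟩
    exact (inner_eq_of_mem_formGraph h hq).trans (inner_smul_right q.1 (f i) _)
  choose G hG hw using hf'
  have hGG : ∀ i j, inner ℂ (G i) (G j) = ((j : ℝ) : ℂ) * inner ℂ (f i) (f j) := fun i j =>
    hw j _ (hG i)
  -- Symmetry of the form gives j⟨fᵢ, fⱼ⟩ = i⟨fᵢ, fⱼ⟩. The gradients Gᵢ are then orthogonal too, and
  -- both norms of the sum split.
  have horth : ∀ i j, i ≠ j → inner ℂ (f i) (f j) = 0 := by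
    intro i j hij
    have h1 := hGG i j
    have h2 := congrArg (starRingEnd ℂ) (hGG j i)
    rw [map_mul, inner_conj_symm, inner_conj_symm, Complex.conj_ofReal, h1] at h2
    have h3 : (((j : ℝ) : ℂ) - ((i : ℝ) : ℂ)) * inner ℂ (f i) (f j) = 0 := by
      rw [sub_mul, h2, sub_self]
    refine (mul_eq_zero.1 h3).resolve_left ?_
    exact fun h => hij (Subtype.ext (Complex.ofReal_injective (sub_eq_zero.1 h))).symm
  set S := f.support
  have hu : ‖∑ i ∈ S, f i‖ ^ 2 = ∑ i ∈ S, ‖f i‖ ^ 2 := by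
    have : ((‖∑ i ∈ S, f i‖ ^ 2 : ℝ) : ℂ) = ((∑ i ∈ S, ‖f i‖ ^ 2 : ℝ) : ℂ) := by
      rw [ofReal_norm_sq, sum_inner]
      push_cast
      refine Finset.sum_congr rfl fun i hi => ?_
      rw [inner_sum, Finset.sum_eq_single i (fun j _ hj => horth i j hj.symm)
        (fun h => absurd hi h), ← ofReal_norm_sq, Complex.ofReal_pow]
    exact_mod_cast this
  have hGn : ‖∑ i ∈ S, G i‖ ^ 2 = ∑ i ∈ S, (i : ℝ) * ‖f i‖ ^ 2 := by
    have : ((‖∑ i ∈ S, G i‖ ^ 2 : ℝ) : ℂ) = ((∑ i ∈ S, (i : ℝ) * ‖f i‖ ^ 2 : ℝ) : ℂ) := by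
      rw [ofReal_norm_sq, sum_inner]
      push_cast
      refine Finset.sum_congr rfl fun i hi => ?_
      rw [inner_sum, Finset.sum_eq_single i
        (fun j _ hj => by rw [hGG, horth i j hj.symm, mul_zero]) (fun h => absurd hi h), hGG,
        ← ofReal_norm_sq, Complex.ofReal_pow]
    exact_mod_cast this
  refine ⟨∑ i ∈ S, G i, ?_, ?_⟩
  · have h := (formGraph Ω B).sum_mem (t := S) (f := fun i => (f i, G i)) fun i _ => hG i
    have e : ∑ i ∈ S, (f i, G i) = (∑ i ∈ S, f i, ∑ i ∈ S, G i) :=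
      Prod.ext (by simp [Prod.fst_sum]) (by simp [Prod.snd_sum])
    rw [e] at h
    exact h
  · change _ ≤ s * ‖∑ i ∈ S, f i‖ ^ 2
    rw [hGn, hu, Finset.mul_sum]
    exact Finset.sum_le_sum fun i _ => mul_le_mul_of_nonneg_right i.2 (sq_nonneg _)

/-- Pairing with the n - 1 Landau functions is injective on the span of the eigenspaces up to s: in
its kernel the form inequality gives Λ‖u‖² ≤ a[u] ≤ s‖u‖² with s < Λ. -/
theorem eigenvalueCount_lt (hB : 0 < B) (hR : 0 < R) (ha : -1 ≤ a) (ha' : a < 0) (hn : 1 ≤ n)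
    (hroot : kummerM a n (B * R ^ 2 / 2) = 0) {s : ℝ} (hs : s < (1 - 2 * a) * B) :
    eigenvalueCount (Metric.ball c R) B s < n := by
  set W := ⨆ μ ∈ Set.Iic s, magneticEigenspace (Metric.ball c R) B μ with hW
  let T : W →ₗ[ℂ] (Fin (n - 1) → ℂ) := LinearMap.pi fun k =>
    (innerSL ℂ (landauVector B c R k)).toLinearMap ∘ₗ W.subtype
  have hT : Function.Injective T := by
    rw [← LinearMap.ker_eq_bot, LinearMap.ker_eq_bot']
    rintro ⟨u, hu⟩ hTu
    have horth : ∀ k ∈ Finset.range (n - 1), inner ℂ (landauVector B c R k) u = 0 := fun k hk =>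
      congrFun hTu ⟨k, Finset.mem_range.1 hk⟩
    obtain ⟨G, hG, hle⟩ := exists_form_le_of_mem_iSup hu
    have key := form_inequality hB hR ha ha' hn hroot hG
    simp only at key
    rw [Finset.sum_eq_zero fun k hk => by rw [horth k hk]; simp, add_zero] at key
    have h0 : ‖u‖ ^ 2 ≤ 0 := by
      by_contra! hpos
      nlinarith
    have : u = 0 := by
      have := le_antisymm h0 (sq_nonneg _)
      simpa using this
    exact Subtype.ext this
  have h1 : eigenvalueCount (Metric.ball c R) B s ≤ ((n - 1 : ℕ) : Cardinal) := by
    refine (LinearMap.rank_le_of_injective T hT).trans ?_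
    rw [rank_fin_fun]
  refine h1.trans_lt ?_
  exact_mod_cast (by omega : n - 1 < n)

end Form

/-! ### Pointwise magnetic Laplacian of angular modes. -/

section Eigenfunction

variable {B : ℝ} {c : Plane} {l : ℕ}

theorem planeBasis_shift_same (x : Plane) (t : ℝ) (j : Fin 2) :
    (x + t • planeBasis j) j = x j + t := by simp

theorem planeBasis_shift_zero_one (x : Plane) (t : ℝ) : (x + t • planeBasis 0) 1 = x 1 := by simp

theorem planeBasis_shift_one_zero (x : Plane) (t : ℝ) : (x + t • planeBasis 1) 0 = x 0 := by simp

/-- Product rule for the gauge factor, the power of the conjugate coordinate and the radial profile.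
The truncated l - 1 at l = 0 is harmless because its term carries the factor l. -/
theorem hasLineDerivAt_angularMode_zero {G G' : ℝ → ℝ} (hG : ∀ s, HasDerivAt G (G' s) s)
    (x : Plane) :
    HasLineDerivAt ℝ (angularMode B c l G)
      (Complex.I * (B / 2 * c 1) * angularMode B c l G x + l * angularMode B c (l - 1) G x
        + 2 * (x 0 - c 0) * angularMode B c l G' x) x (planeBasis 0) := by
  have hg : HasDerivAt (fun t : ℝ => starRingEnd ℂ (gaugeFactor B c (x + t • planeBasis 0)))
      (starRingEnd ℂ (gaugeFactor B c x) * (Complex.I * (B / 2 * c 1))) 0 := by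
    have e : ∀ t : ℝ, starRingEnd ℂ (gaugeFactor B c (x + t • planeBasis 0))
        = starRingEnd ℂ (gaugeFactor B c x) * Complex.exp (Complex.I * (B / 2 * c 1) * t) := by
      intro t
      simp only [gaugeFactor, gaugePhase, planeBasis_shift_same, planeBasis_shift_zero_one,
        ← Complex.exp_conj, ← Complex.exp_add, map_mul, Complex.conj_I, Complex.conj_ofReal]
      congr 1
      push_cast
      ring
    simp only [e]
    have h1 : HasDerivAt (fun t : ℝ => Complex.I * (B / 2 * c 1) * (t : ℂ))
        (Complex.I * (B / 2 * c 1) * 1) 0 := (Complex.ofRealCLM.hasDerivAt (x := 0)).const_mul _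
    refine (h1.cexp.const_mul _).congr_deriv ?_
    simp
  have hw : HasDerivAt (fun t : ℝ => starRingEnd ℂ (complexCoord c (x + t • planeBasis 0)) ^ l)
      (l * starRingEnd ℂ (complexCoord c x) ^ (l - 1)) 0 := by
    have e : ∀ t : ℝ, starRingEnd ℂ (complexCoord c (x + t • planeBasis 0))
        = starRingEnd ℂ (complexCoord c x) + t := by
      intro t
      simp only [complexCoord, planeBasis_shift_same, planeBasis_shift_zero_one, map_add, map_mul,
        Complex.conj_I, Complex.conj_ofReal]
      push_cast
      ring
    simp only [e]
    have h1 : HasDerivAt (fun t : ℝ => starRingEnd ℂ (complexCoord c x) + (t : ℂ)) 1 0 :=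
      (Complex.ofRealCLM.hasDerivAt (x := 0)).const_add _
    refine (h1.fun_pow l).congr_deriv ?_
    simp
  have hs : HasDerivAt (fun t : ℝ => ((G (distSq c (x + t • planeBasis 0)) : ℝ) : ℂ))
      ((G' (distSq c x) * (2 * (x 0 - c 0)) : ℝ) : ℂ) 0 := by
    have h1 : HasDerivAt (fun t : ℝ => distSq c (x + t • planeBasis 0)) (2 * (x 0 - c 0)) 0 := by
      simp only [distSq, planeBasis_shift_same, planeBasis_shift_zero_one]
      have h2 : HasDerivAt (fun t : ℝ => x 0 + t - c 0) 1 0 :=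
        ((hasDerivAt_id' (0 : ℝ)).const_add _).sub_const _
      refine ((h2.fun_pow 2).add_const _).congr_deriv ?_
      simp
    have h3 : HasDerivAt G (G' (distSq c x)) (distSq c (x + (0 : ℝ) • planeBasis 0)) := by
      rw [zero_smul, add_zero]; exact hG _
    exact (h3.comp (0 : ℝ) h1).ofReal_comp
  have key := (hg.fun_mul hw).fun_mul hs
  simp only [zero_smul, add_zero] at key
  unfold HasLineDerivAt
  simp only [angularMode, map_mul, map_pow]
  refine key.congr_deriv ?_
  push_cast
  ring

theorem hasLineDerivAt_angularMode_one {G G' : ℝ → ℝ} (hG : ∀ s, HasDerivAt G (G' s) s)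
    (x : Plane) :
    HasLineDerivAt ℝ (angularMode B c l G)
      (-Complex.I * (B / 2 * c 0) * angularMode B c l G x
        - Complex.I * l * angularMode B c (l - 1) G x
        + 2 * (x 1 - c 1) * angularMode B c l G' x) x (planeBasis 1) := by
  have hg : HasDerivAt (fun t : ℝ => starRingEnd ℂ (gaugeFactor B c (x + t • planeBasis 1)))
      (starRingEnd ℂ (gaugeFactor B c x) * (-Complex.I * (B / 2 * c 0))) 0 := by
    have e : ∀ t : ℝ, starRingEnd ℂ (gaugeFactor B c (x + t • planeBasis 1))
        = starRingEnd ℂ (gaugeFactor B c x) * Complex.exp (-Complex.I * (B / 2 * c 0) * t) := by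
      intro t
      simp only [gaugeFactor, gaugePhase, planeBasis_shift_same, planeBasis_shift_one_zero,
        ← Complex.exp_conj, ← Complex.exp_add, map_mul, Complex.conj_I, Complex.conj_ofReal]
      congr 1
      push_cast
      ring
    simp only [e]
    have h1 : HasDerivAt (fun t : ℝ => -Complex.I * (B / 2 * c 0) * (t : ℂ))
        (-Complex.I * (B / 2 * c 0) * 1) 0 := (Complex.ofRealCLM.hasDerivAt (x := 0)).const_mul _
    refine (h1.cexp.const_mul _).congr_deriv ?_
    simp
  have hw : HasDerivAt (fun t : ℝ => starRingEnd ℂ (complexCoord c (x + t • planeBasis 1)) ^ l)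
      (l * starRingEnd ℂ (complexCoord c x) ^ (l - 1) * -Complex.I) 0 := by
    have e : ∀ t : ℝ, starRingEnd ℂ (complexCoord c (x + t • planeBasis 1))
        = starRingEnd ℂ (complexCoord c x) + -Complex.I * t := by
      intro t
      simp only [complexCoord, planeBasis_shift_same, planeBasis_shift_one_zero, map_add, map_mul,
        Complex.conj_I, Complex.conj_ofReal]
      push_cast
      ring
    simp only [e]
    have h1 : HasDerivAt (fun t : ℝ => starRingEnd ℂ (complexCoord c x) + -Complex.I * (t : ℂ))
        (-Complex.I * 1) 0 :=
      ((Complex.ofRealCLM.hasDerivAt (x := 0)).const_mul _).const_add _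
    refine (h1.fun_pow l).congr_deriv ?_
    simp
  have hs : HasDerivAt (fun t : ℝ => ((G (distSq c (x + t • planeBasis 1)) : ℝ) : ℂ))
      ((G' (distSq c x) * (2 * (x 1 - c 1)) : ℝ) : ℂ) 0 := by
    have h1 : HasDerivAt (fun t : ℝ => distSq c (x + t • planeBasis 1)) (2 * (x 1 - c 1)) 0 := by
      simp only [distSq, planeBasis_shift_same, planeBasis_shift_one_zero]
      have h2 : HasDerivAt (fun t : ℝ => x 1 + t - c 1) 1 0 :=
        ((hasDerivAt_id' (0 : ℝ)).const_add _).sub_const _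
      refine ((h2.fun_pow 2).const_add _).congr_deriv ?_
      simp
    have h3 : HasDerivAt G (G' (distSq c x)) (distSq c (x + (0 : ℝ) • planeBasis 1)) := by
      rw [zero_smul, add_zero]; exact hG _
    exact (h3.comp (0 : ℝ) h1).ofReal_comp
  have key := (hg.fun_mul hw).fun_mul hs
  simp only [zero_smul, add_zero] at key
  unfold HasLineDerivAt
  simp only [angularMode, map_mul, map_pow]
  refine key.congr_deriv ?_
  push_cast
  ring

theorem contDiff_angularMode {n : WithTop ℕ∞} {G : ℝ → ℝ} (hG : ContDiff ℝ n G) :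
    ContDiff ℝ n (angularMode B c l G) := by
  have h0 : ∀ j : Fin 2, ContDiff ℝ n fun x : Plane => x j := fun j => by fun_prop
  have h00 := h0 0
  have h01 := h0 1
  have h1 : ContDiff ℝ n (gaugePhase B c) := by unfold gaugePhase; fun_prop
  have h2 : ContDiff ℝ n (gaugeFactor B c) := by
    unfold gaugeFactor
    exact (contDiff_const.mul (Complex.ofRealCLM.contDiff.comp h1)).cexp
  have h3 : ContDiff ℝ n (complexCoord c) := by
    unfold complexCoord
    exact (Complex.ofRealCLM.contDiff.comp (h00.sub contDiff_const)).add
      (contDiff_const.mul (Complex.ofRealCLM.contDiff.comp (h01.sub contDiff_const)))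
  have h4 : ContDiff ℝ n (distSq c) := by unfold distSq; fun_prop
  unfold angularMode
  exact (Complex.conjCLE.contDiff.comp (h2.mul (h3.pow l))).mul
    (Complex.ofRealCLM.contDiff.comp (hG.comp h4))

theorem fderiv_eq_of_hasLineDerivAt {f : Plane → ℂ} {x v : Plane} {f' : ℂ}
    (hf : DifferentiableAt ℝ f x) (h : HasLineDerivAt ℝ f f' x v) : fderiv ℝ f x v = f' := by
  rw [← hf.lineDeriv_eq_fderiv, h.lineDeriv]

theorem magneticGradient_angularMode_zero {G G' : ℝ → ℝ} (hG : ∀ s, HasDerivAt G (G' s) s)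
    (hGc : ContDiff ℝ 1 G) (x : Plane) :
    magneticGradient B (angularMode B c l G) x 0
      = -Complex.I * l * angularMode B c (l - 1) G x
        - 2 * Complex.I * (x 0 - c 0) * angularMode B c l G' x
        - B / 2 * (x 1 - c 1) * angularMode B c l G x := by
  rw [magneticGradient_apply, fderiv_eq_of_hasLineDerivAt
    ((contDiff_angularMode hGc).differentiable one_ne_zero x)
    (hasLineDerivAt_angularMode_zero hG x), vectorPotential_zero]
  push_cast
  linear_combination (-(B / 2 * c 1) * angularMode B c l G x) * Complex.I_mul_I

theorem magneticGradient_angularMode_one {G G' : ℝ → ℝ} (hG : ∀ s, HasDerivAt G (G' s) s)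
    (hGc : ContDiff ℝ 1 G) (x : Plane) :
    magneticGradient B (angularMode B c l G) x 1
      = -l * angularMode B c (l - 1) G x
        - 2 * Complex.I * (x 1 - c 1) * angularMode B c l G' x
        + B / 2 * (x 0 - c 0) * angularMode B c l G x := by
  rw [magneticGradient_apply, fderiv_eq_of_hasLineDerivAt
    ((contDiff_angularMode hGc).differentiable one_ne_zero x)
    (hasLineDerivAt_angularMode_one hG x), vectorPotential_one]
  push_cast
  linear_combination ((B / 2 * c 0) * angularMode B c l G x + l * angularMode B c (l - 1) G x)
    * Complex.I_mul_I

/-- The first component of the magnetic gradient of an angular mode. -/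
noncomputable def gradZero (B : ℝ) (c : Plane) (l : ℕ) (G G' : ℝ → ℝ) (x : Plane) : ℂ :=
  -Complex.I * l * angularMode B c (l - 1) G x
    - 2 * Complex.I * (x 0 - c 0) * angularMode B c l G' x
    - B / 2 * (x 1 - c 1) * angularMode B c l G x

/-- The second component of the magnetic gradient of an angular mode. -/
noncomputable def gradOne (B : ℝ) (c : Plane) (l : ℕ) (G G' : ℝ → ℝ) (x : Plane) : ℂ :=
  -l * angularMode B c (l - 1) G x
    - 2 * Complex.I * (x 1 - c 1) * angularMode B c l G' x
    + B / 2 * (x 0 - c 0) * angularMode B c l G x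

theorem contDiff_coe_coord (n : WithTop ℕ∞) (j : Fin 2) :
    ContDiff ℝ n fun x : Plane => ((x j : ℝ) : ℂ) :=
  Complex.ofRealCLM.contDiff.comp (by fun_prop : ContDiff ℝ n fun x : Plane => x j)

theorem contDiff_gradZero {n : WithTop ℕ∞} {G G' : ℝ → ℝ} (hG : ContDiff ℝ n G)
    (hG' : ContDiff ℝ n G') : ContDiff ℝ n (gradZero B c l G G') := by
  have h0 := contDiff_coe_coord n 0
  have h1 := contDiff_coe_coord n 1
  have m0 := contDiff_angularMode (B := B) (c := c) (l := l - 1) hG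
  have m1 := contDiff_angularMode (B := B) (c := c) (l := l) hG
  have m2 := contDiff_angularMode (B := B) (c := c) (l := l) hG'
  unfold gradZero
  fun_prop

theorem contDiff_gradOne {n : WithTop ℕ∞} {G G' : ℝ → ℝ} (hG : ContDiff ℝ n G)
    (hG' : ContDiff ℝ n G') : ContDiff ℝ n (gradOne B c l G G') := by
  have h0 := contDiff_coe_coord n 0
  have h1 := contDiff_coe_coord n 1
  have m0 := contDiff_angularMode (B := B) (c := c) (l := l - 1) hG
  have m1 := contDiff_angularMode (B := B) (c := c) (l := l) hG
  have m2 := contDiff_angularMode (B := B) (c := c) (l := l) hG'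
  unfold gradOne
  fun_prop

/-- The magnetic Laplacian of an angular mode. -/
theorem magneticLaplacian_angularMode {G G' G'' : ℝ → ℝ} {Λ : ℝ}
    (hG : ∀ s, HasDerivAt G (G' s) s) (hG' : ∀ s, HasDerivAt G' (G'' s) s)
    (hGc : ContDiff ℝ 1 G) (hGc' : ContDiff ℝ 1 G')
    (hode : ∀ s, -(4 * (l + 1)) * G' s - 4 * s * G'' s - B * l * G s + B ^ 2 * s / 4 * G s
      = Λ * G s) (x : Plane) :
    magneticGradient B (gradZero B c l G G') x 0 + magneticGradient B (gradOne B c l G G') x 1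
      = Λ * angularMode B c l G x := by
  have c0 : HasDerivAt (fun t : ℝ => (((x + t • planeBasis 0) 0 : ℝ) : ℂ) - c 0) 1 0 := by
    simp only [planeBasis_shift_same]
    push_cast
    exact ((Complex.ofRealCLM.hasDerivAt (x := 0)).const_add _).sub_const _
  have c1 : HasDerivAt (fun t : ℝ => (((x + t • planeBasis 1) 1 : ℝ) : ℂ) - c 1) 1 0 := by
    simp only [planeBasis_shift_same]
    push_cast
    exact ((Complex.ofRealCLM.hasDerivAt (x := 0)).const_add _).sub_const _
  have d0 : HasLineDerivAt ℝ (gradZero B c l G G')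
      (-Complex.I * l * (Complex.I * (B / 2 * c 1) * angularMode B c (l - 1) G x
          + (l - 1 : ℕ) * angularMode B c (l - 1 - 1) G x
          + 2 * (x 0 - c 0) * angularMode B c (l - 1) G' x)
        - (2 * Complex.I * 1 * angularMode B c l G' x + 2 * Complex.I * (x 0 - c 0)
          * (Complex.I * (B / 2 * c 1) * angularMode B c l G' x + l * angularMode B c (l - 1) G' x
            + 2 * (x 0 - c 0) * angularMode B c l G'' x))
        - B / 2 * (x 1 - c 1) * (Complex.I * (B / 2 * c 1) * angularMode B c l G x
          + l * angularMode B c (l - 1) G x + 2 * (x 0 - c 0) * angularMode B c l G' x))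
      x (planeBasis 0) := by
    have a1 := (hasLineDerivAt_angularMode_zero (B := B) (c := c) (l := l - 1) hG x)
    have a2 := (hasLineDerivAt_angularMode_zero (B := B) (c := c) (l := l) hG' x)
    have a3 := (hasLineDerivAt_angularMode_zero (B := B) (c := c) (l := l) hG x)
    unfold HasLineDerivAt at a1 a2 a3 ⊢
    unfold gradZero
    simp only [planeBasis_shift_zero_one]
    have key := ((a1.const_mul (-Complex.I * l)).fun_sub
      ((c0.const_mul (2 * Complex.I)).fun_mul a2)).fun_sub (a3.const_mul (B / 2 * (x 1 - c 1) : ℂ))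
    simp only [zero_smul, add_zero] at key
    exact key
  have d1 : HasLineDerivAt ℝ (gradOne B c l G G')
      (-l * (-Complex.I * (B / 2 * c 0) * angularMode B c (l - 1) G x
          - Complex.I * (l - 1 : ℕ) * angularMode B c (l - 1 - 1) G x
          + 2 * (x 1 - c 1) * angularMode B c (l - 1) G' x)
        - (2 * Complex.I * 1 * angularMode B c l G' x + 2 * Complex.I * (x 1 - c 1)
          * (-Complex.I * (B / 2 * c 0) * angularMode B c l G' x
            - Complex.I * l * angularMode B c (l - 1) G' x
            + 2 * (x 1 - c 1) * angularMode B c l G'' x))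
        + B / 2 * (x 0 - c 0) * (-Complex.I * (B / 2 * c 0) * angularMode B c l G x
          - Complex.I * l * angularMode B c (l - 1) G x
          + 2 * (x 1 - c 1) * angularMode B c l G' x))
      x (planeBasis 1) := by
    have a1 := (hasLineDerivAt_angularMode_one (B := B) (c := c) (l := l - 1) hG x)
    have a2 := (hasLineDerivAt_angularMode_one (B := B) (c := c) (l := l) hG' x)
    have a3 := (hasLineDerivAt_angularMode_one (B := B) (c := c) (l := l) hG x)
    unfold HasLineDerivAt at a1 a2 a3 ⊢
    unfold gradOne
    simp only [planeBasis_shift_one_zero]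
    have key := ((a1.const_mul (-l : ℂ)).fun_sub
      ((c1.const_mul (2 * Complex.I)).fun_mul a2)).fun_add (a3.const_mul (B / 2 * (x 0 - c 0) : ℂ))
    simp only [zero_smul, add_zero] at key
    exact key
  rw [magneticGradient_apply, magneticGradient_apply,
    fderiv_eq_of_hasLineDerivAt ((contDiff_gradZero hGc hGc').differentiable one_ne_zero x) d0,
    fderiv_eq_of_hasLineDerivAt ((contDiff_gradOne hGc hGc').differentiable one_ne_zero x) d1,
    vectorPotential_zero, vectorPotential_one]
  -- Splitting off one conjugate coordinate makes modes of exponents l and l - 1 comparable; the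
  -- factor l covers l = 0.
  have hw : ∀ H : ℝ → ℝ, (l : ℂ) * angularMode B c l H x
      = l * ((x 0 - c 0) - Complex.I * (x 1 - c 1)) * angularMode B c (l - 1) H x := by
    intro H
    rcases l with _ | l
    · simp
    · simp only [angularMode, Nat.add_sub_cancel, map_mul, map_pow, pow_succ]
      have : starRingEnd ℂ (complexCoord c x) = (x 0 - c 0) - Complex.I * (x 1 - c 1) := by
        simp only [complexCoord, map_add, map_mul, Complex.conj_I, Complex.conj_ofReal]
        push_cast; ring
      rw [this]
      ring
  have hG0 := hw G
  have hG1 := hw G'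
  have hode' : -(4 * ((l : ℂ) + 1)) * angularMode B c l G' x
      - 4 * ((x 0 - c 0) ^ 2 + (x 1 - c 1) ^ 2) * angularMode B c l G'' x
      - B * l * angularMode B c l G x
      + B ^ 2 * ((x 0 - c 0) ^ 2 + (x 1 - c 1) ^ 2) / 4 * angularMode B c l G x
      = Λ * angularMode B c l G x := by
    have h := congrArg (fun r : ℝ => (r : ℂ)) (hode (distSq c x))
    have hs : ((distSq c x : ℝ) : ℂ) = (x 0 - c 0) ^ 2 + (x 1 - c 1) ^ 2 := by
      simp only [distSq]; push_cast; ring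
    push_cast at h
    rw [hs] at h
    simp only [angularMode]
    linear_combination starRingEnd ℂ (gaugeFactor B c x * complexCoord c x ^ l) * h
  rw [← hode']
  push_cast
  have g0 : gradZero B c l G G' x = -Complex.I * l * angularMode B c (l - 1) G x
    - 2 * Complex.I * (x 0 - c 0) * angularMode B c l G' x
    - B / 2 * (x 1 - c 1) * angularMode B c l G x := rfl
  have g1 : gradOne B c l G G' x = -l * angularMode B c (l - 1) G x
    - 2 * Complex.I * (x 1 - c 1) * angularMode B c l G' x
    + B / 2 * (x 0 - c 0) * angularMode B c l G x := rfl
  linear_combination 4 * hG1 + B * hG0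
    + (-(B / 2 * c 1) * gradZero B c l G G' x + B / 2 * c 0 * gradOne B c l G G' x
      + 4 * l * (x 0 - c 0) * angularMode B c (l - 1) G' x + 4 * angularMode B c l G' x
      + 4 * ((x 0 - c 0) ^ 2 + (x 1 - c 1) ^ 2) * angularMode B c l G'' x
      - 2 * Complex.I * l * (x 1 - c 1) * angularMode B c (l - 1) G' x
      + B / 2 * (x 0 - c 0) * l * angularMode B c (l - 1) G x) * Complex.I_sq
    + (-(B / 2) * x 1 + B / 2 * c 1 * (Complex.I ^ 2 + 1)) * g0
    + (B / 2 * x 0 - B / 2 * c 0 * (Complex.I ^ 2 + 1)) * g1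

end Eigenfunction

/-! ### The weak eigenvalue equation. -/

section WeakEquation

variable {B : ℝ} {c : Plane} {l : ℕ} {R : ℝ}

/-- Each -i∂_j + A_j is formally symmetric because A is real. Only φ needs compact support; v may be
arbitrary at the boundary. -/
theorem integral_conj_magneticGradient_mul {φ v : Plane → ℂ} (hφ : ContDiff ℝ 1 φ)
    (hc : HasCompactSupport φ) (hv : ContDiff ℝ 1 v) (j : Fin 2) :
    ∫ x, starRingEnd ℂ (magneticGradient B φ x j) * v x
      = ∫ x, starRingEnd ℂ (φ x) * magneticGradient B v x j := by
  have cφ := hφ.continuous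
  have cv := hv.continuous
  have cdφ : Continuous fun x => fderiv ℝ φ x (planeBasis j) :=
    (hφ.continuous_fderiv one_ne_zero).clm_apply continuous_const
  have cdv : Continuous fun x => fderiv ℝ v x (planeBasis j) :=
    (hv.continuous_fderiv one_ne_zero).clm_apply continuous_const
  have cA := continuous_vectorPotential B j
  have hc1 : HasCompactSupport fun x => starRingEnd ℂ (φ x) :=
    hc.comp_left (g := starRingEnd ℂ) (map_zero _)
  have hc2 : HasCompactSupport fun x => starRingEnd ℂ (fderiv ℝ φ x (planeBasis j)) :=
    (hc.fderiv_apply ℝ (planeBasis j)).comp_left (g := starRingEnd ℂ) (map_zero _)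
  have cc := Complex.continuous_conj
  have i1 : Integrable fun x => starRingEnd ℂ (φ x) * fderiv ℝ v x (planeBasis j) :=
    Continuous.integrable_of_hasCompactSupport ((cc.comp cφ).mul cdv) hc1.mul_right
  have i2 : Integrable fun x => starRingEnd ℂ (fderiv ℝ φ x (planeBasis j)) * v x :=
    Continuous.integrable_of_hasCompactSupport ((cc.comp cdφ).mul cv) hc2.mul_right
  have i3 : Integrable fun x => starRingEnd ℂ (φ x) * v x :=
    Continuous.integrable_of_hasCompactSupport ((cc.comp cφ).mul cv) hc1.mul_right
  have i4 : Integrable fun x => (vectorPotential B x j : ℂ) * (starRingEnd ℂ (φ x) * v x) :=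
    Continuous.integrable_of_hasCompactSupport
      ((Complex.continuous_ofReal.comp cA).mul ((cc.comp cφ).mul cv)) (hc1.mul_right).mul_left
  have key := integral_bilinear_hasLineDerivAt_right_eq_neg_left_of_integrable
    (μ := (volume : Measure Plane)) (B := ContinuousLinearMap.mul ℝ ℂ) (v := planeBasis j)
    (f := fun x => starRingEnd ℂ (φ x))
    (f' := fun x => starRingEnd ℂ (fderiv ℝ φ x (planeBasis j))) (g := v)
    (g' := fun x => fderiv ℝ v x (planeBasis j)) i2 i1 i3
    (fun x _ => (Complex.conjCLE.toContinuousLinearMap.hasFDerivAt.comp x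
      (hφ.differentiable one_ne_zero x).hasFDerivAt).hasLineDerivAt (planeBasis j))
    (fun x _ => (hv.differentiable one_ne_zero x).hasFDerivAt.hasLineDerivAt (planeBasis j))
  simp only [ContinuousLinearMap.mul_apply'] at key
  have e1 : ∀ x, starRingEnd ℂ (magneticGradient B φ x j) * v x
      = Complex.I * (starRingEnd ℂ (fderiv ℝ φ x (planeBasis j)) * v x)
        + (vectorPotential B x j : ℂ) * (starRingEnd ℂ (φ x) * v x) := fun x => by
    rw [magneticGradient_apply]
    simp only [map_add, map_mul, map_neg, Complex.conj_I, Complex.conj_ofReal]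
    ring
  have e2 : ∀ x, starRingEnd ℂ (φ x) * magneticGradient B v x j
      = -Complex.I * (starRingEnd ℂ (φ x) * fderiv ℝ v x (planeBasis j))
        + (vectorPotential B x j : ℂ) * (starRingEnd ℂ (φ x) * v x) := fun x => by
    rw [magneticGradient_apply]; ring
  simp only [e1, e2]
  rw [integral_add (i2.const_mul _) i4, integral_add (i1.const_mul _) i4, integral_const_mul,
    integral_const_mul, key]
  ring

theorem setIntegral_eq_integral_of_tsupport {Ω : Set Plane} {φ : Plane → ℂ}
    (hs : tsupport φ ⊆ Ω) {F : Plane → ℂ} (hF : ∀ x, x ∉ tsupport φ → F x = 0) :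
    ∫ x in Ω, F x = ∫ x, F x :=
  setIntegral_eq_integral_of_forall_compl_eq_zero fun x hx => hF x fun h => hx (hs h)

theorem magneticGradient_eq_zero {φ : Plane → ℂ} {x : Plane} (hx : x ∉ tsupport φ) :
    magneticGradient B φ x = 0 := by
  ext j
  have h0 : fderiv ℝ φ x = 0 := image_eq_zero_of_notMem_tsupport (f := fderiv ℝ φ)
    fun h => hx (tsupport_fderiv_subset ℝ h)
  rw [magneticGradient_apply, h0, image_eq_zero_of_notMem_tsupport hx]
  simp

/-- Integration by parts in each component moves the magnetic gradient off the test function. The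
Dirichlet condition on G plays no role here; it matters only for membership in the form domain. -/
theorem inner_magneticGradient_angularMode {G G' G'' : ℝ → ℝ} {Λ : ℝ}
    (hG : ∀ s, HasDerivAt G (G' s) s) (hG' : ∀ s, HasDerivAt G' (G'' s) s)
    (hGc : ContDiff ℝ 1 G) (hGc' : ContDiff ℝ 1 G')
    (hode : ∀ s, -(4 * (l + 1)) * G' s - 4 * s * G'' s - B * l * G s + B ^ 2 * s / 4 * G s
      = Λ * G s) {f : L2Scalar (Metric.ball c R)} {W : L2Vector (Metric.ball c R)}
    (hf : f =ᵐ[volume.restrict (Metric.ball c R)] fun x => Λ * angularMode B c l G x)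
    (hW : W =ᵐ[volume.restrict (Metric.ball c R)] magneticGradient B (angularMode B c l G))
    {q : L2Scalar (Metric.ball c R) × L2Vector (Metric.ball c R)}
    (hq : q ∈ testGraph (Metric.ball c R) B) : inner ℂ q.2 W = inner ℂ q.1 f := by
  obtain ⟨φ, ⟨hsm, hcs, hsupp⟩, h1, h2⟩ := hq
  have hφ1 : ContDiff ℝ 1 φ := hsm.of_le (by simp)
  have c0 := contDiff_gradZero (B := B) (c := c) (l := l) hGc hGc'
  have c1 := contDiff_gradOne (B := B) (c := c) (l := l) hGc hGc'
  have e0 : ∀ x, magneticGradient B (angularMode B c l G) x 0 = gradZero B c l G G' x :=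
    magneticGradient_angularMode_zero hG hGc
  have e1 : ∀ x, magneticGradient B (angularMode B c l G) x 1 = gradOne B c l G G' x :=
    magneticGradient_angularMode_one hG hGc
  have key0 := integral_conj_magneticGradient_mul (B := B) hφ1 hcs c0 0
  have key1 := integral_conj_magneticGradient_mul (B := B) hφ1 hcs c1 1
  have cgφ := continuous_magneticGradient (B := B) hφ1
  have hcs1 : HasCompactSupport fun x => starRingEnd ℂ (φ x) :=
    hcs.comp_left (g := starRingEnd ℂ) (map_zero _)
  have hcs2 : ∀ j, HasCompactSupport fun x => starRingEnd ℂ (magneticGradient B φ x j) := fun j =>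
    HasCompactSupport.of_support_subset_isCompact hcs.isCompact fun x hx => by
      by_contra h
      exact hx (by simp [magneticGradient_eq_zero h])
  have cc := Complex.continuous_conj
  have cgj : ∀ j, Continuous fun x => magneticGradient B φ x j := fun j =>
    (continuous_apply j).comp ((PiLp.continuous_ofLp 2 _).comp cgφ)
  have cv0 := continuous_magneticGradient (B := B) c0
  have cv1 := continuous_magneticGradient (B := B) c1
  have cv0' : Continuous fun x => magneticGradient B (gradZero B c l G G') x 0 :=
    (continuous_apply 0).comp ((PiLp.continuous_ofLp 2 _).comp cv0)
  have cv1' : Continuous fun x => magneticGradient B (gradOne B c l G G') x 1 :=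
    (continuous_apply 1).comp ((PiLp.continuous_ofLp 2 _).comp cv1)
  have lhs : inner ℂ q.2 W = ∫ x in Metric.ball c R,
      (starRingEnd ℂ (magneticGradient B φ x 0) * gradZero B c l G G' x
        + starRingEnd ℂ (magneticGradient B φ x 1) * gradOne B c l G G' x) := by
    rw [L2.inner_def]
    refine integral_congr_ae ?_
    filter_upwards [h2, hW] with x hx hx'
    rw [hx, hx', PiLp.inner_apply, Fin.sum_univ_two, e0, e1, RCLike.inner_apply,
      RCLike.inner_apply, mul_comm, mul_comm (gradOne B c l G G' x)]
  rw [lhs, L2_inner_eq h1 hf, setIntegral_eq_integral_of_tsupport hsupp,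
    setIntegral_eq_integral_of_tsupport hsupp, integral_add, key0, key1, ← integral_add]
  · refine integral_congr_ae (Filter.Eventually.of_forall fun x => ?_)
    simp only
    rw [← magneticLaplacian_angularMode hG hG' hGc hGc' hode x]
    ring
  · exact Continuous.integrable_of_hasCompactSupport ((cc.comp hsm.continuous).mul cv0')
      hcs1.mul_right
  · exact Continuous.integrable_of_hasCompactSupport ((cc.comp hsm.continuous).mul cv1')
      hcs1.mul_right
  · exact Continuous.integrable_of_hasCompactSupport ((cc.comp (cgj 0)).mul c0.continuous)
      (hcs2 0).mul_right
  · exact Continuous.integrable_of_hasCompactSupport ((cc.comp (cgj 1)).mul c1.continuous)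
      (hcs2 1).mul_right
  · intro x hx
    rw [image_eq_zero_of_notMem_tsupport hx, map_zero, zero_mul]
  · intro x hx
    rw [magneticGradient_eq_zero hx]
    simp

end WeakEquation

/-! ### Membership of the eigenfunctions in the form domain. -/

section FormDomain

/-- Dominated convergence: the sequence is uniformly close to its limit and eventually equal to it
at each point of the ball. -/
theorem tendsto_toLp_ball {E : Type*} [NormedAddCommGroup E] [InnerProductSpace ℂ E]
    [SecondCountableTopology E] {h : ℕ → Plane → E} {g : Plane → E} (hh : ∀ k, Continuous (h k))
    (hg : Continuous g) (c : Plane) (R : ℝ) {C : ℝ}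
    (hC : ∀ k, ∀ x ∈ Metric.ball c R, ‖h k x - g x‖ ≤ C)
    (hlim : ∀ x ∈ Metric.ball c R, ∀ᶠ k in Filter.atTop, h k x = g x) :
    Filter.Tendsto (fun k => (memLp_ball (hh k) c R).toLp) Filter.atTop
      (nhds ((memLp_ball hg c R).toLp)) := by
  have hfin : IsFiniteMeasure (volume.restrict (Metric.ball c R)) :=
    ⟨by rw [Measure.restrict_apply_univ]; exact measure_ball_lt_top⟩
  have hn : ∀ k, ‖(memLp_ball (hh k) c R).toLp - (memLp_ball hg c R).toLp‖ ^ 2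
      = ∫ x in Metric.ball c R, ‖h k x - g x‖ ^ 2 := fun k => by
    refine L2_norm_sq_eq (g := fun x => h k x - g x) ?_
    refine (Lp.coeFn_sub _ _).trans ?_
    exact (MemLp.coeFn_toLp _).sub (MemLp.coeFn_toLp _)
  have hlim2 : Filter.Tendsto (fun k => ∫ x in Metric.ball c R, ‖h k x - g x‖ ^ 2) Filter.atTop
      (nhds (∫ x in Metric.ball c R, (0 : ℝ))) := by
    refine tendsto_integral_of_dominated_convergence (fun _ => C ^ 2) (fun k => ?_)
      (integrable_const _) (fun k => ?_) ?_
    · have := hh k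
      exact Continuous.aestronglyMeasurable (by fun_prop)
    · filter_upwards [ae_restrict_mem Metric.isOpen_ball.measurableSet] with x hx
      rw [norm_pow, norm_norm]
      exact pow_le_pow_left₀ (norm_nonneg _) (hC k x hx) 2
    · filter_upwards [ae_restrict_mem Metric.isOpen_ball.measurableSet] with x hx
      refine tendsto_const_nhds.congr' ?_
      filter_upwards [hlim x hx] with k hk
      simp [hk]
  rw [integral_zero] at hlim2
  simp only [← hn] at hlim2
  rw [tendsto_iff_norm_sub_tendsto_zero]
  have h3 := (Real.continuous_sqrt.tendsto 0).comp hlim2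
  simpa [Function.comp_def, Real.sqrt_sq (norm_nonneg _)] using h3

/-- A radial cutoff vanishing near `s = T`. -/
noncomputable def radialCutoff (T K s : ℝ) : ℝ := Real.smoothTransition (K * (T - s) - 1)

/-- The derivative of `radialCutoff`. -/
noncomputable def radialCutoffDeriv (T K s : ℝ) : ℝ :=
  deriv Real.smoothTransition (K * (T - s) - 1) * -K

theorem contDiff_radialCutoff (T K : ℝ) : ContDiff ℝ ∞ (radialCutoff T K) :=
  Real.smoothTransition.contDiff.comp (by fun_prop)

theorem hasDerivAt_radialCutoff (T K s : ℝ) :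
    HasDerivAt (radialCutoff T K) (radialCutoffDeriv T K s) s := by
  have h1 : HasDerivAt (fun s => K * (T - s) - 1) (-K) s := by
    refine ((((hasDerivAt_id' s).const_sub T).const_mul K).sub_const 1).congr_deriv ?_
    ring
  have h2 : HasDerivAt Real.smoothTransition
      (deriv Real.smoothTransition (K * (T - s) - 1)) (K * (T - s) - 1) :=
    ((Real.smoothTransition.contDiff (n := 1)).differentiable one_ne_zero _).hasDerivAt
  exact h2.comp s h1

theorem deriv_smoothTransition_of_one_lt {t : ℝ} (ht : 1 < t) :
    deriv Real.smoothTransition t = 0 := by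
  have : Real.smoothTransition =ᶠ[nhds t] fun _ => 1 := by
    filter_upwards [lt_mem_nhds ht] with x hx
    exact Real.smoothTransition.one_of_one_le hx.le
  rw [this.deriv_eq]
  simp

/-- Since G(T) = 0, |G(s)| ≤ C₁(T - s). The cutoff derivative is at most MK and vanishes once K(T -
s) > 2, so its product with G is at most 2MC₁, independently of K. -/
theorem exists_bound_radialCutoff {G G' : ℝ → ℝ} {T : ℝ} (hT : 0 ≤ T)
    (hG : ∀ s, HasDerivAt G (G' s) s) (hG' : Continuous G') (hGT : G T = 0) :
    ∃ C, 0 ≤ C ∧ ∀ K : ℝ, 0 < K → ∀ s ∈ Set.Ico 0 T, |G s * radialCutoff T K s| ≤ C ∧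
      |G' s * radialCutoff T K s + G s * radialCutoffDeriv T K s| ≤ C := by
  have hGc : Continuous G := continuous_iff_continuousAt.2 fun s => (hG s).continuousAt
  obtain ⟨C0, hC0⟩ := isCompact_Icc.exists_bound_of_continuousOn (s := Set.Icc 0 T)
    hGc.continuousOn
  obtain ⟨C1, hC1⟩ := isCompact_Icc.exists_bound_of_continuousOn (s := Set.Icc 0 T)
    hG'.continuousOn
  have hσ : Continuous (deriv Real.smoothTransition) :=
    (Real.smoothTransition.contDiff (n := 1)).continuous_deriv le_rfl
  obtain ⟨M, hM⟩ := isCompact_Icc.exists_bound_of_continuousOn (s := Set.Icc (-1 : ℝ) 1)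
    hσ.continuousOn
  have h00 : 0 ≤ C0 := (norm_nonneg _).trans (hC0 0 ⟨le_rfl, hT⟩)
  have h10 : 0 ≤ C1 := (norm_nonneg _).trans (hC1 0 ⟨le_rfl, hT⟩)
  have hM0 : 0 ≤ M := (norm_nonneg _).trans (hM 0 ⟨by norm_num, by norm_num⟩)
  have hlip : ∀ s ∈ Set.Icc 0 T, |G s| ≤ C1 * (T - s) := by
    intro s hs
    have := (convex_Icc 0 T).norm_image_sub_le_of_norm_hasDerivWithin_le
      (fun x _ => (hG x).hasDerivWithinAt) hC1 (⟨hT, le_rfl⟩ : T ∈ Set.Icc 0 T) hs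
    rw [hGT, sub_zero, Real.norm_eq_abs, Real.norm_eq_abs, abs_sub_comm s T,
      abs_of_nonneg (sub_nonneg.2 hs.2)] at this
    exact this
  have habs : ∀ K s, |radialCutoff T K s| ≤ 1 := fun K s => by
    unfold radialCutoff
    rw [abs_of_nonneg (Real.smoothTransition.nonneg _)]
    exact Real.smoothTransition.le_one _
  refine ⟨max C0 (C1 + C1 * (2 * M)), h00.trans (le_max_left _ _), fun K hK s hs => ⟨?_, ?_⟩⟩
  · refine le_trans ?_ (le_max_left _ _)
    rw [abs_mul]
    exact (mul_le_of_le_one_right (abs_nonneg _) (habs K s)).trans (hC0 s ⟨hs.1, hs.2.le⟩)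
  · refine le_trans ((abs_add_le _ _).trans (add_le_add ?_ ?_)) (le_max_right _ _)
    · rw [abs_mul]
      exact (mul_le_of_le_one_right (abs_nonneg _) (habs K s)).trans (hC1 s ⟨hs.1, hs.2.le⟩)
    · rw [abs_mul, radialCutoffDeriv]
      have hTs : 0 < T - s := sub_pos.2 hs.2
      rcases lt_or_ge 1 (K * (T - s) - 1) with h | h
      · rw [deriv_smoothTransition_of_one_lt h]
        simp only [zero_mul, abs_zero, mul_zero]
        positivity
      · have h1 : |deriv Real.smoothTransition (K * (T - s) - 1)| ≤ M :=
          hM _ ⟨by have : 0 < K * (T - s) := by positivity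
                   linarith, h⟩
        rw [abs_mul, abs_neg, abs_of_pos hK]
        calc |G s| * (|deriv Real.smoothTransition (K * (T - s) - 1)| * K)
            ≤ (C1 * (T - s)) * (M * K) := by
              gcongr
              exact hlip s ⟨hs.1, hs.2.le⟩
          _ = C1 * ((K * (T - s)) * M) := by ring
          _ ≤ C1 * (2 * M) := by gcongr; linarith

theorem distSq_eq (c x : Plane) : distSq c x = dist x c ^ 2 := (dist_plane_sq x c).symm

theorem angularMode_eq_mul (B : ℝ) (c : Plane) (l : ℕ) (G : ℝ → ℝ) (x : Plane) :
    angularMode B c l G x = angularMode B c l (fun _ => 1) x * (G (distSq c x) : ℝ) := by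
  simp [angularMode]

theorem magneticGradient_angularMode_eq {B : ℝ} {c : Plane} {l : ℕ} {G G' : ℝ → ℝ}
    (hG : ∀ s, HasDerivAt G (G' s) s) (hGc : ContDiff ℝ 1 G) (x : Plane) :
    magneticGradient B (angularMode B c l G) x
      = ((G (distSq c x) : ℝ) : ℂ) • WithLp.toLp 2
          ![-Complex.I * l * angularMode B c (l - 1) (fun _ => 1) x
            - B / 2 * (x 1 - c 1) * angularMode B c l (fun _ => 1) x,
            -l * angularMode B c (l - 1) (fun _ => 1) x
            + B / 2 * (x 0 - c 0) * angularMode B c l (fun _ => 1) x]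
        + ((G' (distSq c x) : ℝ) : ℂ) • WithLp.toLp 2
          ![-2 * Complex.I * (x 0 - c 0) * angularMode B c l (fun _ => 1) x,
            -2 * Complex.I * (x 1 - c 1) * angularMode B c l (fun _ => 1) x] := by
  ext j
  fin_cases j
  · simp only [Fin.zero_eta, Fin.isValue, PiLp.add_apply, PiLp.smul_apply]
    rw [magneticGradient_angularMode_zero hG hGc, angularMode_eq_mul B c (l - 1) G,
      angularMode_eq_mul B c l G, angularMode_eq_mul B c l G']
    simp
    ring
  · simp only [Fin.mk_one, Fin.isValue, PiLp.add_apply, PiLp.smul_apply]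
    rw [magneticGradient_angularMode_one hG hGc, angularMode_eq_mul B c (l - 1) G,
      angularMode_eq_mul B c l G, angularMode_eq_mul B c l G']
    simp
    ring

theorem isTestFunction_cutoff {B : ℝ} {c : Plane} {l : ℕ} {R : ℝ} (hR : 0 < R) {G : ℝ → ℝ}
    (hG : ContDiff ℝ ∞ G) {K : ℝ} (hK : 0 < K) :
    IsTestFunction (Metric.ball c R)
      (angularMode B c l fun s => G s * radialCutoff (R ^ 2) K s) := by
  have hsub : tsupport (angularMode B c l fun s => G s * radialCutoff (R ^ 2) K s)
      ⊆ {x | dist x c ^ 2 ≤ R ^ 2 - 1 / K} := by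
    refine closure_minimal (fun x hx => ?_) (isClosed_le (by fun_prop) continuous_const)
    by_contra h
    refine hx ?_
    simp only [Set.mem_ofPred_eq, not_le] at h
    have : radialCutoff (R ^ 2) K (distSq c x) = 0 := by
      refine Real.smoothTransition.zero_of_nonpos ?_
      rw [distSq_eq]
      have : K * (1 / K) = 1 := by field_simp
      nlinarith
    simp [angularMode, this]
  have hsub2 : {x : Plane | dist x c ^ 2 ≤ R ^ 2 - 1 / K} ⊆ Metric.ball c R := fun x hx => by
    rw [Metric.mem_ball]
    refine lt_of_pow_lt_pow_left₀ 2 hR.le (lt_of_le_of_lt hx ?_)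
    have : 0 < 1 / K := by positivity
    linarith
  refine ⟨contDiff_angularMode (hG.mul (contDiff_radialCutoff _ _)), ?_, hsub.trans hsub2⟩
  refine HasCompactSupport.of_support_subset_isCompact (isCompact_closedBall c R) ?_
  exact (subset_tsupport _).trans ((hsub.trans hsub2).trans Metric.ball_subset_closedBall)

theorem continuous_magneticGradient_angularMode {B : ℝ} {c : Plane} {l : ℕ} {G : ℝ → ℝ}
    (hG : ContDiff ℝ ∞ G) : Continuous (magneticGradient B (angularMode B c l G)) :=
  continuous_magneticGradient (contDiff_angularMode (hG.of_le (by simp)))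

/-- An angular mode vanishing on the boundary of the disk lies in the form domain. -/
theorem angularMode_mem_formGraph {B : ℝ} {c : Plane} {l : ℕ} {R : ℝ} (hR : 0 < R)
    {G G' : ℝ → ℝ} (hGd : ∀ s, HasDerivAt G (G' s) s) (hG : ContDiff ℝ ∞ G)
    (hG' : Continuous G') (hGR : G (R ^ 2) = 0) :
    ((memLp_ball (continuous_angularMode B c l hG.continuous) c R).toLp,
      (memLp_ball (continuous_magneticGradient_angularMode (B := B) (c := c) (l := l) hG) c R).toLp)
      ∈ formGraph (Metric.ball c R) B := by
  obtain ⟨C, hC0, hC⟩ := exists_bound_radialCutoff (sq_nonneg R) hGd hG' hGR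
  have hGc := hG.continuous
  have hdist : ∀ x ∈ Metric.ball c R, distSq c x ∈ Set.Ico 0 (R ^ 2) := fun x hx => by
    rw [distSq_eq]
    refine ⟨sq_nonneg _, ?_⟩
    have := Metric.mem_ball.1 hx
    gcongr
  obtain ⟨C1, hC1⟩ := isCompact_Icc.exists_bound_of_continuousOn (s := Set.Icc 0 (R ^ 2))
    hGc.continuousOn
  obtain ⟨C2, hC2⟩ := isCompact_Icc.exists_bound_of_continuousOn (s := Set.Icc 0 (R ^ 2))
    hG'.continuousOn
  set K : ℕ → ℝ := fun k => k + 1 with hK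
  have hKpos : ∀ k, 0 < K k := fun k => by simp only [hK]; positivity
  set Gk : ℕ → ℝ → ℝ := fun k s => G s * radialCutoff (R ^ 2) (K k) s with hGk
  set Gk' : ℕ → ℝ → ℝ := fun k s =>
    G' s * radialCutoff (R ^ 2) (K k) s + G s * radialCutoffDeriv (R ^ 2) (K k) s with hGk'
  have dGk : ∀ k s, HasDerivAt (Gk k) (Gk' k s) s := fun k s =>
    (hGd s).mul (hasDerivAt_radialCutoff _ _ s)
  have cGk : ∀ k, ContDiff ℝ ∞ (Gk k) := fun k => hG.mul (contDiff_radialCutoff _ _)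
  have hev : ∀ s ∈ Set.Ico 0 (R ^ 2), ∀ᶠ k in Filter.atTop, Gk k s = G s ∧ Gk' k s = G' s := by
    intro s hs
    have hpos : 0 < R ^ 2 - s := sub_pos.2 hs.2
    obtain ⟨N, hN⟩ := exists_nat_gt (2 / (R ^ 2 - s))
    filter_upwards [Filter.eventually_ge_atTop N] with k hk
    have h1 : 1 < K k * (R ^ 2 - s) - 1 := by
      rw [div_lt_iff₀ hpos] at hN
      have : (N : ℝ) ≤ K k := by
        have : (N : ℝ) ≤ k := by exact_mod_cast hk
        simp only [hK]; linarith
      nlinarith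
    have h2 : radialCutoff (R ^ 2) (K k) s = 1 := Real.smoothTransition.one_of_one_le h1.le
    have h3 : radialCutoffDeriv (R ^ 2) (K k) s = 0 := by
      rw [radialCutoffDeriv, deriv_smoothTransition_of_one_lt h1, zero_mul]
    simp only [hGk, hGk', h2, h3]
    constructor <;> ring
  -- the factors multiplying `G` and `G'`
  set V0 : Plane → EuclideanSpace ℂ (Fin 2) := fun x => WithLp.toLp 2
    ![-Complex.I * l * angularMode B c (l - 1) (fun _ => 1) x
      - B / 2 * (x 1 - c 1) * angularMode B c l (fun _ => 1) x,
      -l * angularMode B c (l - 1) (fun _ => 1) x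
      + B / 2 * (x 0 - c 0) * angularMode B c l (fun _ => 1) x] with hV0
  set V1 : Plane → EuclideanSpace ℂ (Fin 2) := fun x => WithLp.toLp 2
    ![-2 * Complex.I * (x 0 - c 0) * angularMode B c l (fun _ => 1) x,
      -2 * Complex.I * (x 1 - c 1) * angularMode B c l (fun _ => 1) x] with hV1
  have m0 : Continuous (angularMode B c (l - 1) fun _ => 1) :=
    continuous_angularMode B c _ continuous_const
  have m1 : Continuous (angularMode B c l fun _ => 1) :=
    continuous_angularMode B c _ continuous_const
  have cV0 : Continuous V0 := by
    refine (PiLp.continuous_toLp 2 _).comp (continuous_pi fun j => ?_)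
    fin_cases j <;> simp <;> fun_prop
  have cV1 : Continuous V1 := by
    refine (PiLp.continuous_toLp 2 _).comp (continuous_pi fun j => ?_)
    fin_cases j <;> simp <;> fun_prop
  obtain ⟨M, hM⟩ := (isCompact_closedBall c R).exists_bound_of_continuousOn m1.continuousOn
  obtain ⟨M0, hM0⟩ := (isCompact_closedBall c R).exists_bound_of_continuousOn cV0.continuousOn
  obtain ⟨M1, hM1⟩ := (isCompact_closedBall c R).exists_bound_of_continuousOn cV1.continuousOn
  have t1 := tendsto_toLp_ball (h := fun k => angularMode B c l (Gk k))
    (g := angularMode B c l G) (fun k => continuous_angularMode B c l (cGk k).continuous)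
    (continuous_angularMode B c l hGc) c R (C := M * (C + C1)) (fun k x hx => ?_) (fun x hx => ?_)
  · have t2 := tendsto_toLp_ball (h := fun k => magneticGradient B (angularMode B c l (Gk k)))
      (g := magneticGradient B (angularMode B c l G))
      (fun k => continuous_magneticGradient_angularMode (cGk k))
      (continuous_magneticGradient_angularMode hG) c R (C := (C + C1) * M0 + (C + C2) * M1)
      (fun k x hx => ?_) (fun x hx => ?_)
    · refine mem_closure_of_tendsto (t1.prodMk_nhds t2) (Filter.Eventually.of_forall fun k => ?_)
      exact ⟨_, isTestFunction_cutoff hR hG (hKpos k),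
        MemLp.coeFn_toLp (memLp_ball (continuous_angularMode B c l (cGk k).continuous) c R),
        MemLp.coeFn_toLp (memLp_ball (continuous_magneticGradient_angularMode (cGk k)) c R)⟩
    · rw [magneticGradient_angularMode_eq (dGk k) ((cGk k).of_le (by simp)),
        magneticGradient_angularMode_eq hGd (hG.of_le (by simp))]
      have e : ∀ (p q p' q' : ℂ) (v w : EuclideanSpace ℂ (Fin 2)),
          (p • v + q • w) - (p' • v + q' • w) = (p - p') • v + (q - q') • w := by
        intros; module
      rw [e]
      have hs := hdist x hx
      have b := hC (K k) (hKpos k) _ hs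
      have hx' := Metric.ball_subset_closedBall hx
      refine (norm_add_le _ _).trans (add_le_add ?_ ?_)
      · rw [norm_smul, ← Complex.ofReal_sub, Complex.norm_real]
        refine mul_le_mul ?_ (hM0 x hx') (norm_nonneg _)
          (add_nonneg hC0 ((norm_nonneg _).trans (hC1 _ ⟨hs.1, hs.2.le⟩)))
        exact (norm_sub_le _ _).trans (add_le_add b.1 (hC1 _ ⟨hs.1, hs.2.le⟩))
      · rw [norm_smul, ← Complex.ofReal_sub, Complex.norm_real]
        refine mul_le_mul ?_ (hM1 x hx') (norm_nonneg _)
          (add_nonneg hC0 ((norm_nonneg _).trans (hC2 _ ⟨hs.1, hs.2.le⟩)))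
        exact (norm_sub_le _ _).trans (add_le_add b.2 (hC2 _ ⟨hs.1, hs.2.le⟩))
    · filter_upwards [hev _ (hdist x hx)] with k hk
      rw [magneticGradient_angularMode_eq (dGk k) ((cGk k).of_le (by simp)),
        magneticGradient_angularMode_eq hGd (hG.of_le (by simp)), hk.1, hk.2]
  · have hs := hdist x hx
    have b := hC (K k) (hKpos k) _ hs
    rw [angularMode_eq_mul, angularMode_eq_mul B c l G, ← mul_sub, norm_mul,
      ← Complex.ofReal_sub, Complex.norm_real]
    have hx' := Metric.ball_subset_closedBall hx
    refine mul_le_mul (hM x hx') ?_ (norm_nonneg _) ((norm_nonneg _).trans (hM x hx'))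
    exact (norm_sub_le _ _).trans (add_le_add b.1 (hC1 _ ⟨hs.1, hs.2.le⟩))
  · filter_upwards [hev _ (hdist x hx)] with k hk
    rw [angularMode_eq_mul, angularMode_eq_mul B c l G, hk.1]

end FormDomain

/-! ### Eigenfunctions of the disk and the lower bound on the eigenvalue count. -/

section Assembly

variable {B : ℝ} {c : Plane} {l : ℕ} {R : ℝ} {α : ℝ}

/-- The radial profile, as a function of the squared radius, of the eigenfunctions of the disk. -/
noncomputable def diskProfile (B : ℝ) (l : ℕ) (α s : ℝ) : ℝ :=
  Real.exp (-(B * s / 4)) * kummerM α (l + 1) (B * s / 2)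

/-- The derivative of `diskProfile`. -/
noncomputable def diskProfileDeriv (B : ℝ) (l : ℕ) (α s : ℝ) : ℝ :=
  Real.exp (-(B * s / 4)) *
    (-(B / 4) * kummerM α (l + 1) (B * s / 2) + B / 2 * kummerDeriv α (l + 1) (B * s / 2))

/-- The second derivative of `diskProfile`. -/
noncomputable def diskProfileDeriv2 (B : ℝ) (l : ℕ) (α s : ℝ) : ℝ :=
  Real.exp (-(B * s / 4)) *
    (B ^ 2 / 16 * kummerM α (l + 1) (B * s / 2) - B ^ 2 / 4 * kummerDeriv α (l + 1) (B * s / 2)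
      + B ^ 2 / 4 * kummerDeriv2 α (l + 1) (B * s / 2))

theorem one_le_succ_cast (l : ℕ) : (1 : ℝ) ≤ (l : ℝ) + 1 := by
  have : (0 : ℝ) ≤ l := by positivity
  linarith

theorem hasDerivAt_gauss (B s : ℝ) : HasDerivAt (fun s => Real.exp (-(B * s / 4)))
    (Real.exp (-(B * s / 4)) * -(B / 4)) s := by
  have h : HasDerivAt (fun s => -(B * s / 4)) (-(B / 4)) s := by
    refine ((((hasDerivAt_id' s).const_mul B).div_const 4).fun_neg).congr_deriv ?_
    ring
  exact h.exp

theorem hasDerivAt_half (B s : ℝ) : HasDerivAt (fun s => B * s / 2) (B / 2) s := by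
  refine (((hasDerivAt_id' s).const_mul B).div_const 2).congr_deriv ?_
  ring

theorem hasDerivAt_diskProfile (hα : -1 ≤ α) (hα' : α ≤ 0) (s : ℝ) :
    HasDerivAt (diskProfile B l α) (diskProfileDeriv B l α s) s := by
  have h := (hasDerivAt_gauss B s).fun_mul
    (HasDerivAt.comp s (hasDerivAt_kummerM hα hα' (one_le_succ_cast l) (B * s / 2))
      (hasDerivAt_half B s))
  refine h.congr_deriv ?_
  simp only [diskProfileDeriv, Function.comp_apply]
  ring

theorem hasDerivAt_diskProfileDeriv (hα : -1 ≤ α) (hα' : α ≤ 0) (s : ℝ) :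
    HasDerivAt (diskProfileDeriv B l α) (diskProfileDeriv2 B l α s) s := by
  have h := (hasDerivAt_gauss B s).fun_mul
    (((HasDerivAt.comp s (hasDerivAt_kummerM hα hα' (one_le_succ_cast l) (B * s / 2))
      (hasDerivAt_half B s)).const_mul (-(B / 4))).fun_add
    ((HasDerivAt.comp s (hasDerivAt_kummerDeriv hα hα' (one_le_succ_cast l) (B * s / 2))
      (hasDerivAt_half B s)).const_mul (B / 2)))
  refine h.congr_deriv ?_
  simp only [diskProfileDeriv2, Function.comp_apply]
  ring

theorem contDiff_diskProfile (hα : -1 ≤ α) (hα' : α ≤ 0) : ContDiff ℝ ∞ (diskProfile B l α) := by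
  have h := contDiff_kummerM hα hα' (one_le_succ_cast l)
  unfold diskProfile
  exact (by fun_prop : ContDiff ℝ ∞ fun s => Real.exp (-(B * s / 4))).mul
    (h.comp (by fun_prop : ContDiff ℝ ∞ fun s => B * s / 2))

theorem contDiff_diskProfileDeriv (hα : -1 ≤ α) (hα' : α ≤ 0) :
    ContDiff ℝ ∞ (diskProfileDeriv B l α) := by
  have h := contDiff_kummerM hα hα' (one_le_succ_cast l)
  have h' : ContDiff ℝ ∞ (kummerDeriv α (l + 1)) :=
    contDiff_powerSum (factorialDecay_kummerCoeff hα hα' (one_le_succ_cast l)).derivCoeff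
  have hs : ContDiff ℝ ∞ fun s => B * s / 2 := by fun_prop
  unfold diskProfileDeriv
  exact (by fun_prop : ContDiff ℝ ∞ fun s => Real.exp (-(B * s / 4))).mul
    ((contDiff_const.mul (h.comp hs)).add (contDiff_const.mul (h'.comp hs)))

/-- The Gaussian factor and the substitution t = Bs/2 turn the radial equation into Kummer's
equation with parameter b = l + 1. -/
theorem diskProfile_ode (hα : -1 ≤ α) (hα' : α ≤ 0) (s : ℝ) :
    -(4 * ((l : ℝ) + 1)) * diskProfileDeriv B l α s - 4 * s * diskProfileDeriv2 B l α s
      - B * l * diskProfile B l α s + B ^ 2 * s / 4 * diskProfile B l α s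
      = ((1 - 2 * α) * B) * diskProfile B l α s := by
  have h := kummer_ode hα hα' (one_le_succ_cast l) (B * s / 2)
  simp only [diskProfile, diskProfileDeriv, diskProfileDeriv2]
  linear_combination (-2 * B * Real.exp (-(B * s / 4))) * h

/-- The eigenfunctions of the disk with angular momentum `-l`. -/
noncomputable def diskVector (B : ℝ) (c : Plane) (R : ℝ) (l : ℕ) (hα : -1 ≤ α) (hα' : α ≤ 0) :
    L2Scalar (Metric.ball c R) :=
  (memLp_ball (continuous_angularMode B c l
    (contDiff_diskProfile (B := B) (l := l) hα hα').continuous) c R).toLp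

theorem diskVector_mem_eigenspace (hR : 0 < R) (hα : -1 ≤ α) (hα' : α ≤ 0)
    (hroot : kummerM α (l + 1) (B * R ^ 2 / 2) = 0) :
    diskVector B c R l hα hα'
      ∈ magneticEigenspace (Metric.ball c R) B ((1 - 2 * α) * B) := by
  have hG := contDiff_diskProfile (B := B) (l := l) hα hα'
  have hG' := contDiff_diskProfileDeriv (B := B) (l := l) hα hα'
  have hmem := angularMode_mem_formGraph (B := B) (c := c) (l := l) hR
    (hasDerivAt_diskProfile hα hα') hG hG'.continuous
    (by rw [diskProfile, hroot, mul_zero])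
  refine ⟨_, hmem, fun q hq => ?_⟩
  refine inner_magneticGradient_angularMode (hasDerivAt_diskProfile hα hα')
    (hasDerivAt_diskProfileDeriv hα hα') (hG.of_le (by simp)) (hG'.of_le (by simp))
    (diskProfile_ode hα hα') ?_ (MemLp.coeFn_toLp _) hq
  refine (Lp.coeFn_smul _ _).trans ?_
  filter_upwards [MemLp.coeFn_toLp (memLp_ball (continuous_angularMode B c l hG.continuous) c R)]
    with x hx
  simp only [LinearMap.id_apply, Pi.smul_apply, smul_eq_mul]
  exact congrArg _ hx

theorem infinite_unit_circle : {z : ℂ | ‖z‖ = 1}.Infinite := by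
  refine Set.infinite_of_injOn_mapsTo (f := fun θ : ℝ => Complex.exp (θ * Complex.I))
    (s := Set.Ioo 0 1) ?_ ?_ (Set.Ioo_infinite zero_lt_one)
  · intro x hx y hy h
    have hpi := Real.pi_gt_three
    have := Complex.exp_inj_of_neg_pi_lt_of_le_pi (x := x * Complex.I) (y := y * Complex.I)
      (by simp; linarith [hx.1]) (by simp; linarith [hx.2]) (by simp; linarith [hy.1])
      (by simp; linarith [hy.2]) h
    simpa using this
  · intro x _
    exact Complex.norm_exp_ofReal_mul_I x

/-- Angular modes of different angular momenta whose profiles do not vanish on some circle are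
linearly independent. -/
theorem linearIndependent_angularMode {n : ℕ} {G : Fin n → ℝ → ℝ} (hG : ∀ i, Continuous (G i))
    {r : ℝ} (hr : 0 < r) (hrR : r < R) (hGr : ∀ i, G i (r ^ 2) ≠ 0) :
    LinearIndependent ℂ fun i : Fin n =>
      (memLp_ball (continuous_angularMode B c i (hG i)) c R).toLp := by
  rw [Fintype.linearIndependent_iff]
  intro a ha
  set F : Plane → ℂ := fun x => ∑ i, a i * angularMode B c i (G i) x with hF
  have hFc : Continuous F := continuous_finsetSum _ fun i _ =>
    continuous_const.mul (continuous_angularMode B c i (hG i))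
  have hae : F =ᵐ[volume.restrict (Metric.ball c R)] fun _ => 0 := by
    have h1 : ((∑ i, a i • (memLp_ball (continuous_angularMode B c i (hG i)) c R).toLp :
        L2Scalar (Metric.ball c R)) : Plane → ℂ) =ᵐ[volume.restrict (Metric.ball c R)] F := by
      have h2 : ∀ i, ∀ᵐ x ∂(volume.restrict (Metric.ball c R)),
          ((a i • (memLp_ball (continuous_angularMode B c i (hG i)) c R).toLp :
            L2Scalar (Metric.ball c R)) : Plane → ℂ) x = a i * angularMode B c i (G i) x := by
        intro i
        filter_upwards [Lp.coeFn_smul (a i) (memLp_ball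
          (continuous_angularMode B c i (hG i)) c R).toLp, MemLp.coeFn_toLp
          (memLp_ball (continuous_angularMode B c i (hG i)) c R)] with x h1 h2
        rw [h1, Pi.smul_apply, h2, smul_eq_mul]
      filter_upwards [Lp.coeFn_finsetSum Finset.univ fun i => a i • (memLp_ball
        (continuous_angularMode B c i (hG i)) c R).toLp, ae_all_iff.2 h2] with x hx hx'
      rw [hx, Finset.sum_apply]
      exact Finset.sum_congr rfl fun i _ => hx' i
    rw [ha] at h1
    exact h1.symm.trans (Lp.coeFn_zero _ _ _)
  -- A continuous function vanishing almost everywhere on an open set vanishes everywhere on it, so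
  -- F can be evaluated on a circle.
  have hzero : Set.EqOn F (fun _ => 0) (Metric.ball c R) :=
    Measure.eqOn_open_of_ae_eq hae Metric.isOpen_ball hFc.continuousOn continuousOn_const
  -- On the circle of radius r, F is a nonvanishing phase times p at z = e^{-iθ}; p then has
  -- infinitely many roots, and its coefficients give back those of the relation.
  set p : Polynomial ℂ := ∑ i : Fin n, Polynomial.monomial (i : ℕ)
    (a i * r ^ (i : ℕ) * (G i (r ^ 2) : ℝ)) with hp
  have hroots : {z : ℂ | ‖z‖ = 1} ⊆ {z | p.IsRoot z} := by
    intro z hz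
    obtain ⟨θ, hθ⟩ : ∃ θ : ℝ, starRingEnd ℂ z = Complex.exp (Complex.I * θ) := by
      refine ⟨Complex.arg (starRingEnd ℂ z), ?_⟩
      have := Complex.norm_mul_exp_arg_mul_I (starRingEnd ℂ z)
      rw [Complex.norm_conj, show ‖z‖ = 1 from hz, Complex.ofReal_one, one_mul] at this
      rw [mul_comm Complex.I]
      exact this.symm
    have h1 : F (polarPoint c r θ) = 0 := hzero (by
      rw [Metric.mem_ball, dist_polarPoint, abs_of_pos hr]; exact hrR)
    have hg : starRingEnd ℂ (gaugeFactor B c (polarPoint c r θ)) ≠ 0 := by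
      rw [Ne, map_eq_zero, ← norm_eq_zero, norm_gaugeFactor]
      exact one_ne_zero
    have h2 : F (polarPoint c r θ)
        = starRingEnd ℂ (gaugeFactor B c (polarPoint c r θ)) * p.eval z := by
      simp only [hF, hp, Polynomial.eval_finsetSum, Polynomial.eval_monomial, Finset.mul_sum,
        angularMode, complexCoord_polarPoint, distSq_polarPoint, ← hθ, map_mul, map_pow,
        Complex.conj_conj, Complex.conj_ofReal, mul_pow]
      exact Finset.sum_congr rfl fun i _ => by ring
    rw [h1] at h2
    exact (mul_eq_zero.1 h2.symm).resolve_left hg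
  have hp0 : p = 0 := Polynomial.eq_zero_of_infinite_isRoot p (infinite_unit_circle.mono hroots)
  intro i
  have hcoeff := congrArg (fun q : Polynomial ℂ => q.coeff i) hp0
  simp only [hp, Polynomial.finsetSum_coeff, Polynomial.coeff_monomial,
    Polynomial.coeff_zero] at hcoeff
  rw [Finset.sum_eq_single i (fun j _ hj => if_neg fun h => hj (Fin.ext h))
    (fun h => absurd (Finset.mem_univ i) h), if_pos rfl] at hcoeff
  have hr0 : ((r : ℂ)) ^ (i : ℕ) ≠ 0 := pow_ne_zero _ (by exact_mod_cast hr.ne')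
  have hG0 : ((G i (r ^ 2) : ℝ) : ℂ) ≠ 0 := by exact_mod_cast hGr i
  exact (mul_eq_zero.1 ((mul_eq_zero.1 hcoeff).resolve_right hG0)).resolve_right hr0

/-- Monotonicity in the second parameter gives M(a, l+1, z) ≤ 0 for every l < n, hence a root in [a,
0) and an eigenvalue not above (1 - 2a)B. -/
theorem le_eigenvalueCount {n : ℕ} (hB : 0 < B) (hR : 0 < R) {a : ℝ} (ha : -1 ≤ a) (ha' : a < 0)
    (hroot : kummerM a n (B * R ^ 2 / 2) = 0) {s : ℝ} (hs : (1 - 2 * a) * B ≤ s) :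
    (n : Cardinal) ≤ eigenvalueCount (Metric.ball c R) B s := by
  have hz : 0 < B * R ^ 2 / 2 := by positivity
  have hα : ∀ i : Fin n, ∃ α, a ≤ α ∧ α < 0 ∧ kummerM α ((i : ℕ) + 1) (B * R ^ 2 / 2) = 0 := by
    intro i
    have h1 : ((i : ℕ) : ℝ) + 1 ≤ n := by exact_mod_cast i.2
    have h2 : kummerM a ((i : ℕ) + 1) (B * R ^ 2 / 2) ≤ 0 := by
      rw [← hroot]
      exact kummerM_mono_right ha ha'.le (one_le_succ_cast _) h1 hz.le
    obtain ⟨α, hα, h3, h4⟩ := exists_isKummerRoot_one (one_le_succ_cast _) hz.le ha ha'.le h2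
    exact ⟨α, h3, h4, hα.1⟩
  choose α hα1 hα2 hα3 using hα
  have hα0 : ∀ i, -1 ≤ α i := fun i => ha.trans (hα1 i)
  have hmem : ∀ i : Fin n, diskVector B c R (i : ℕ) (hα0 i) (hα2 i).le
      ∈ ⨆ μ ∈ Set.Iic s, magneticEigenspace (Metric.ball c R) B μ := by
    intro i
    have h1 := diskVector_mem_eigenspace (c := c) hR (hα0 i) (hα2 i).le (hα3 i)
    have h2 : (1 - 2 * α i) * B ∈ Set.Iic s := by
      refine le_trans ?_ hs
      have := hα1 i
      gcongr
    exact Submodule.mem_iSup_of_mem _ (Submodule.mem_iSup_of_mem h2 h1)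
  have hli : LinearIndependent ℂ fun i : Fin n => diskVector B c R i (hα0 i) (hα2 i).le := by
    refine linearIndependent_angularMode (G := fun i => diskProfile B i (α i))
      (fun i => (contDiff_diskProfile (hα0 i) (hα2 i).le).continuous)
      (half_pos hR) (half_lt_self hR) fun i => ?_
    -- Every profile is positive at radius R/2, since the Kummer function strictly decreases to its
    -- zero at R; this supplies a common circle for the independence argument.
    have hlt : B * (R / 2) ^ 2 / 2 < B * R ^ 2 / 2 := by
      have : (R / 2) ^ 2 < R ^ 2 := by gcongr; exact half_lt_self hR
      gcongr
    have := kummerM_strictAnti (hα0 i) (hα2 i) (one_le_succ_cast i) (by positivity) hlt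
    rw [hα3 i] at this
    exact (mul_pos (Real.exp_pos _) this).ne'
  have hli' : LinearIndependent ℂ fun i : Fin n =>
      (⟨_, hmem i⟩ : ↥(⨆ μ ∈ Set.Iic s, magneticEigenspace (Metric.ball c R) B μ)) :=
    LinearIndependent.of_comp (Submodule.subtype _) hli
  have hrank := hli'.cardinal_le_rank
  rw [Cardinal.mk_fin] at hrank
  exact hrank

end Assembly

/-- The first two conjuncts certify that `sSup` and `sInf` in the definitions are taken over
nonempty sets, so that the final equation is not one between default values. -/
theorem corollary4p2 (c : Plane) (R : ℝ) (hR : 0 < R) (n : ℕ) (hn : 1 ≤ n) (B : ℝ)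
    (hB : 2 * (n : ℝ) / R ^ 2 ≤ B) :
    (∃ a : ℝ, IsKummerRoot 1 (n : ℝ) (B * R ^ 2 / 2) a) ∧
    IsSortedEigenvalue (Metric.ball c R) B n (sortedEigenvalue (Metric.ball c R) B n) ∧
    sortedEigenvalue (Metric.ball c R) B n = eigenvalueBranch R 1 (-((n : ℤ) - 1)) B := by
  have hn1 : (1 : ℝ) ≤ n := by exact_mod_cast hn
  have hn0 : (0 : ℝ) < n := by linarith
  have hB0 : 0 < B := lt_of_lt_of_le (by positivity) hB
  have hz : (n : ℝ) ≤ B * R ^ 2 / 2 := by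
    rw [div_le_iff₀ (by positivity)] at hB
    linarith
  -- The hypothesis on B is used through 1 - z/n ≤ 0 at a₀ = -1.
  obtain ⟨a, haroot, ha, ha'⟩ := exists_isKummerRoot_one hn1 (hn0.le.trans hz) le_rfl
    (by norm_num) (show kummerM (-1) n (B * R ^ 2 / 2) ≤ 0 by
      rw [kummerM_neg_one hn0, sub_nonpos, one_le_div hn0]; exact hz)
  have hleast : IsSortedEigenvalue (Metric.ball c R) B n ((1 - 2 * a) * B) := by
    refine ⟨le_eigenvalueCount hB0 hR ha ha' haroot.1 le_rfl, fun s hs => ?_⟩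
    by_contra! hlt
    exact absurd hs (not_le.2 (eigenvalueCount_lt hB0 hR ha ha' hn haroot.1 hlt))
  have hset : {t : ℝ | IsSortedEigenvalue (Metric.ball c R) B n t} = {(1 - 2 * a) * B} :=
    Set.eq_singleton_iff_unique_mem.2 ⟨hleast, fun t ht => IsLeast.unique ht hleast⟩
  have heq : sortedEigenvalue (Metric.ball c R) B n = (1 - 2 * a) * B := by
    rw [sortedEigenvalue, hset, csInf_singleton]
  refine ⟨⟨a, haroot⟩, heq ▸ hleast, ?_⟩
  -- For l = -(n-1) the terms l + |l| cancel and |l| + 1 = n, so the branch is (1 - 2a)B with a the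
  -- root for parameter n.
  have hl : |((-((n : ℤ) - 1) : ℤ) : ℝ)| = n - 1 := by
    push_cast
    rw [abs_neg, abs_of_nonneg (by linarith)]
  rw [heq, eigenvalueBranch, hl, sub_add_cancel, kummerRoot_eq haroot]
  push_cast
  ring
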